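/- Let $\nu\in\{2,3\}$ and let $\Omega\subset\mathbb{R}^\nu$ be a bounded open set with $C^2$ boundary $\partial\Omega$ and outer unit normal $\hat m$. Let a compact $C^2$ hypersurface $\Gamma\subset\Omega$ without boundary (hence disjoint from $\partial\Omega$) split $\Omega$ into two open sets: $\Omega=\Omega^+\sqcup\Gamma\sqcup\Omega^-$, where near each of its points $\Gamma$ has $\Omega^+$ on one side and $\Omega^-$ on the other; let $\hat n$ be the unit normal of $\Gamma$ pointing towards $\Omega^+$. (Connectedness of these sets and simple connectedness of $\Omega$ are not needed.) For $x\in\Gamma$ a superscript $\pm$ denotes the limit as $x^*\to x$ with $x^*\in\Omega^\pm$, $u_n^{\pm}(x)$ is the limit of $\hat n(x)\cdot\nabla u(x^*)$ as $x^*\to x$ with $x^*\in\Omega^\pm$, and $[q]=q^+-q^-$, $\langle q\rangle=\tfrac12(q^++q^-)$. Let $\beta^\pm>0$ be constants and $\lambda=[\beta]/\langle\beta\rangle$. Let $b:\Gamma\to\mathbb{R}$ and $g_D:\partial\Omega\to\mathbb{R}$ be given, and let $v$ be a given real function whose one-sided normal derivatives on $\Gamma$ exist and agree, $v_n^+=v_n^-=:v_n$.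 Let $\Phi(x,y)$ be the fundamental solution of the Laplace equation, normalised by $\Delta_x\Phi(x,y)=2\pi\,\delta(x-y)$, that is, $\Phi(x,y)=\log|x-y|$ if $\nu=2$ and $\Phi(x,y)=-\frac{1}{2|x-y|}$ if $\nu=3$. Write $\Phi_n(x,y)=\hat n(x)\cdot\nabla_x\Phi(x,y)$ for $x\in\Gamma$, $\Phi_m(x,y)=\hat m(y)\cdot\nabla_y\Phi(x,y)$ for $y\in\partial\Omega$, and $\Phi_{nm}(x,y)=\hat n(x)\cdot\nabla_x\Phi_m(x,y)$. Suppose that $\rho\in C^1(\Gamma)$ and $\mu\in C^1(\partial\Omega)$ solve $$\rho(x)+\frac{\lambda}{2\pi}\int_\Gamma\rho(y)\,\Phi_n(x,y)\,dS_y+\frac{\lambda}{2\pi}\int_{\partial\Omega}\mu(y)\,\Phi_{nm}(x,y)\,dS_y=\frac{b(x)}{\langle\beta\rangle}-\lambda v_n(x),\qquad x\in\Gamma,$$ $$\mu(x)+\frac1\pi\int_\Gamma\rho(y)\,\Phi(x,y)\,dS_y+\frac1\pi\int_{\partial\Omega}\mu(y)\,\Phi_m(x,y)\,dS_y=2\,(g_D(x)-v(x)),\qquad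 x\in\partial\Omega.$$ Then $$w(x)=\frac1{2\pi}\int_\Gamma\rho(y)\,\Phi(x,y)\,dS_y+\frac1{2\pi}\int_{\partial\Omega}\mu(y)\,\Phi_m(x,y)\,dS_y$$ solves the Laplace problem $$\Delta w=0\ \text{ in }\Omega^+\cup\Omega^-,\qquad w^+=w^-=w\ \text{ on }\Gamma,\qquad [\beta w_n]=b-[\beta v_n]\ \text{ on }\Gamma,\qquad w=g_D-v\ \text{ on }\partial\Omega,$$ where the one-sided normal derivatives $w_n^\pm$ exist on $\Gamma$ and the boundary values on $\partial\Omega$ are attained as limits from inside $\Omega$. -/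

import Mathlib

open Filter Topology MeasureTheory Laplacian InnerProductSpace

noncomputable section

namespace InterfaceProblem

/-- The Euclidean space `ℝ^ν`. -/
abbrev Space (ν : ℕ) : Type := EuclideanSpace ℝ (Fin ν)

variable {ν : ℕ}

/-! ### Geometry -/

/-- `S` is a (two-sided, boundaryless) `C²` hypersurface that locally separates the set `A` from
the set `B`, and `n` restricted to `S` is the unit normal of `S` pointing from `A` to `B`:
near each point of `S` there is a `C²` function `φ` with non-vanishing gradient such that
`S`, `A`, `B` are locally the sets `φ = 0`, `φ < 0`, `φ > 0`. -/
def IsC2Interface (S A B : Set (Space ν)) (n : Space ν → Space ν) : Prop :=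
  ∀ p ∈ S, ∃ φ : Space ν → ℝ,
    ContDiffAt ℝ 2 φ p ∧ gradient φ p ≠ 0 ∧
    n p = ‖gradient φ p‖⁻¹ • gradient φ p ∧
    ∀ᶠ x in 𝓝 p, (x ∈ S ↔ φ x = 0) ∧ (x ∈ A ↔ φ x < 0) ∧ (x ∈ B ↔ 0 < φ x)

/-- The geometric setting: a bounded open set `Ω` with `C²` boundary and outer unit normal `m`,
split into the open sets `Ωp` (that is, `Ω⁺`) and `Ωm` (that is, `Ω⁻`) by a compact `C²`
hypersurface `Γ ⊆ Ω` whose unit normal `n` points towards `Ωp`. None of the sets is required to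
be connected. -/
structure IsSplitDomain (Ω Ωp Ωm Γ : Set (Space ν)) (n m : Space ν → Space ν) : Prop where
  isOpen : IsOpen Ω
  isBounded : Bornology.IsBounded Ω
  isOpen_plus : IsOpen Ωp
  isOpen_minus : IsOpen Ωm
  isCompact_interface : IsCompact Γ
  union_eq : Ωp ∪ Γ ∪ Ωm = Ω
  disjoint_plus_minus : Disjoint Ωp Ωm
  disjoint_plus_interface : Disjoint Ωp Γ
  disjoint_minus_interface : Disjoint Ωm Γ
  interface : IsC2Interface Γ Ωm Ωp n
  boundary : IsC2Interface (frontier Ω) Ω (closure Ω)ᶜ m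

/-! ### Layer potentials -/

/-- Surface measure: the `(ν - 1)`-dimensional Hausdorff measure, normalised as usual
(arc length for `ν = 2`, area for `ν = 3`). -/
def surfaceMeasure (ν : ℕ) : Measure (Space ν) := μHE[ν - 1]

/-- The surface integral `∫_S f dS`. -/
def surfaceIntegral (S : Set (Space ν)) (f : Space ν → ℝ) : ℝ :=
  ∫ y in S, f y ∂(surfaceMeasure ν)

/-- The fundamental solution `Φ(x, y)` of the Laplace equation for `ν = 2` and `ν = 3`,
normalised in both cases so that `Δₓ Φ(x, y) = 2π δ(x - y)`. -/
def Phi (x y : Space ν) : ℝ :=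
  if ν = 2 then Real.log ‖x - y‖ else -(1 / (2 * ‖x - y‖))

/-- `Φ_n(x, y)`: derivative of `Φ` in its first argument `x`, in the direction `n x`. -/
def Phi_n (n : Space ν → Space ν) (x y : Space ν) : ℝ :=
  fderiv ℝ (fun z => Phi z y) x (n x)

/-- `Φ_m(x, y)`: derivative of `Φ` in its second argument `y` (the point of the integration
surface), in the direction `m y`. -/
def Phi_m (m : Space ν → Space ν) (x y : Space ν) : ℝ :=
  fderiv ℝ (fun z => Phi x z) y (m y)

/-- `Φ_nm(x, y)`: the mixed derivative, in `x` along `n x` and in `y` along `m y`. -/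
def Phi_nm (n m : Space ν → Space ν) (x y : Space ν) : ℝ :=
  fderiv ℝ (fun z => Phi_m m z y) x (n x)

/-- The mean `⟨β⟩` of the two values of a piecewise constant coefficient. -/
def mean (βp βm : ℝ) : ℝ := (βp + βm) / 2

/-- `λ = [β] / ⟨β⟩`. -/
def lam (βp βm : ℝ) : ℝ := (βp - βm) / mean βp βm

/-- The coupled system of integral equations for the single layer density `ρ` on `Γ` and the
double layer density `μ` on `∂Ω`. -/
structure SolvesIntegralSystem (Ω Γ : Set (Space ν)) (n m : Space ν → Space ν) (βp βm : ℝ)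
    (b vn gD v ρ μ : Space ν → ℝ) : Prop where
  on_interface : ∀ x ∈ Γ,
    ρ x + lam βp βm / (2 * Real.pi) * surfaceIntegral Γ (fun y => ρ y * Phi_n n x y)
      + lam βp βm / (2 * Real.pi) *
          surfaceIntegral (frontier Ω) (fun y => μ y * Phi_nm n m x y)
      = b x / mean βp βm - lam βp βm * vn x
  on_boundary : ∀ x ∈ frontier Ω,
    μ x + 1 / Real.pi * surfaceIntegral Γ (fun y => ρ y * Phi x y)
      + 1 / Real.pi * surfaceIntegral (frontier Ω) (fun y => μ y * Phi_m m x y)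
      = 2 * (gD x - v x)

/-- The sum of the single layer potential of `ρ` on `Γ` and the double layer potential of `μ`
on `∂Ω`. -/
def layerPotential (Ω Γ : Set (Space ν)) (m : Space ν → Space ν) (ρ μ : Space ν → ℝ)
    (x : Space ν) : ℝ :=
  1 / (2 * Real.pi) * surfaceIntegral Γ (fun y => ρ y * Phi x y)
    + 1 / (2 * Real.pi) * surfaceIntegral (frontier Ω) (fun y => μ y * Phi_m m x y)

/-! ### The deficit problem -/

/-- `l` is the value at `x` of `u` taken from the side `A`. -/
def HasSideValue (u : Space ν → ℝ) (A : Set (Space ν)) (x : Space ν) (l : ℝ) : Prop :=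
  Tendsto u (𝓝[A] x) (𝓝 l)

/-- `l` is the value at `x` of the normal derivative `u_n` taken from the side `A`: the limit of
`n(x) · ∇u(x*)` as `x* → x` in `A`. -/
def HasSideNormalDeriv (u : Space ν → ℝ) (A : Set (Space ν)) (n : Space ν → Space ν)
    (x : Space ν) (l : ℝ) : Prop :=
  (∀ᶠ y in 𝓝[A] x, DifferentiableAt ℝ u y) ∧
    Tendsto (fun y => fderiv ℝ u y (n x)) (𝓝[A] x) (𝓝 l)

/-- `w` solves the deficit problem with Dirichlet boundary condition:
`Δw = 0` in `Ω⁺ ∪ Ω⁻`, `w` is continuous across `Γ`, `[β w_n] = b - [β v_n]` on `Γ`, and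
`w = g_D - v` on `∂Ω` (attained as a limit from inside `Ω`). -/
structure SolvesDeficitProblem (Ω Ωp Ωm Γ : Set (Space ν)) (n : Space ν → Space ν)
    (βp βm : ℝ) (b gD v w : Space ν → ℝ) : Prop where
  harmonic : HarmonicOnNhd w (Ωp ∪ Ωm)
  jump_value : ∀ x ∈ Γ, HasSideValue w Ωp x (w x) ∧ HasSideValue w Ωm x (w x)
  jump_flux : ∀ x ∈ Γ, ∃ wnp wnm vnp vnm : ℝ,
    HasSideNormalDeriv w Ωp n x wnp ∧ HasSideNormalDeriv w Ωm n x wnm ∧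
    HasSideNormalDeriv v Ωp n x vnp ∧ HasSideNormalDeriv v Ωm n x vnm ∧
    βp * wnp - βm * wnm = b x - (βp * vnp - βm * vnm)
  dirichlet : ∀ x ∈ frontier Ω, HasSideValue w Ω x (gD x - v x)

end InterfaceProblem

end

/-!
The layer potentials solve the deficit problem because of the classical jump relations: across `Γ`
the single layer potential is continuous while its normal derivative jumps by `2π ρ`, and at the
boundary the double layer potential differs from its interior limit by `π μ`. Inserting the
one-sided limits, the two integral equations become the flux and the boundary condition.

Both relations are cases of one statement (`tendsto_field`) about the field
`x ↦ ∫_S ⟪q(y), K(x - y)⟫ dS_y` of a vector density `q`, where `K(z) = z / |z| ^ (d + 1)`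
(`gradKernel`) is `d` times the gradient of the fundamental solution in `ℝ ^ (d + 1)`. If `q` is
locally Lipschitz and normal at `x₀ ∈ S`, with `q(x₀) = a n(x₀)`, the field has one-sided limits at
`x₀`, equal to its value there plus or minus `d π a`. For the derivative of the single layer in the
fixed direction `n(x₀)` one takes `q(y) = ρ(y) n(x₀)`, for the double layer
`q(y) = - d⁻¹ μ(y) m(y)`.

The proof of the jump relation uses neither the divergence theorem nor an area formula. A point `x`
near `x₀` is written as `p + t n(p)` with a nearest point `p` of `S`. The part of `S` above the
tangential disk of radius `δ` at `p` is projected to the tangent plane at `p`. This projection is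
`1`-Lipschitz, and its inverse is `1 + O(ρ)`-Lipschitz over the disk of radius `ρ`; hence the image
of surface measure is Lebesgue measure plus a measure which gives the disk of radius `ρ` a mass of
order `ρ ^ (d + 1)` (`IsPatchScale.exists_map_eq_add`), in particular too little to see the
singularity of order `d` of the kernel. Flattening the surface and freezing the density at `p` also
costs only `O(δ)`, uniformly in `t` (`IsLocalInterface.exists_patch_estimate`). What remains is the
field on the axis of a flat disk with constant density, which tends to `± d π a`, half of the full
solid angle (`tendsto_diskFlux`). The rest of the surface contributes continuously, and the field at
`x₀` itself has no flat part, because there the kernel is only weakly singular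
(`IsLocalInterface.norm_inner_gradKernel_le`).

Harmonicity off the surfaces follows by differentiation under the integral sign
(`hasFDerivAt_potential`, `harmonicAt_potential`), and the continuity of the single layer from the
weak singularity of the fundamental solution and the Ahlfors regularity of the surface
(`continuousAt_potential`).
-/

noncomputable section

namespace InterfaceProblem

/-! ### Integrals of power singularities -/

section Singular

variable {X : Type*} [PseudoMetricSpace X] [MeasurableSpace X] [OpensMeasurableSpace X]
  {F : Type*} [NormedAddCommGroup F] [NormedSpace ℝ F]

/-- The constant of the dyadic summation in `lintegral_rpow_neg_le`. -/
def dyadicConst (s α : ℝ) : ℝ := 2 ^ α * (1 - (2⁻¹ : ℝ) ^ (s - α))⁻¹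

lemma dyadicConst_pos {s α : ℝ} (h : α < s) : 0 < dyadicConst s α := by
  have : (2⁻¹ : ℝ) ^ (s - α) < 1 := Real.rpow_lt_one (by norm_num) (by norm_num) (by linarith)
  unfold dyadicConst
  have : 0 < (1 - (2⁻¹ : ℝ) ^ (s - α))⁻¹ := inv_pos.2 (by linarith)
  positivity

/-- If balls around `p` have measure at most `C r ^ s`, then `dist y p ^ (-α)` is integrable near
`p` for `α < s`, with integral of order `δ ^ (s - α)` over the ball of radius `δ`. -/
lemma lintegral_rpow_neg_le {τ : Measure X} {p : X} {C s α δ : ℝ} (hC : 0 ≤ C)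
    (hα : 0 ≤ α) (hs : α < s) (hδ : 0 < δ)
    (hτ : ∀ r, 0 < r → r ≤ δ → τ (Metric.ball p r) ≤ ENNReal.ofReal (C * r ^ s)) :
    ∫⁻ y in Metric.ball p δ \ {y | dist y p = 0}, ENNReal.ofReal (dist y p ^ (-α)) ∂τ
      ≤ ENNReal.ofReal (C * dyadicConst s α * δ ^ (s - α)) := by
  set R : ℕ → ℝ := fun j => 2⁻¹ ^ j * δ with hR
  have hRpos : ∀ j, 0 < R j := fun j => by positivity
  have hRle : ∀ j, R j ≤ δ := fun j => by
    have : (2⁻¹ : ℝ) ^ j ≤ 1 := pow_le_one₀ (by norm_num) (by norm_num)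
    exact (mul_le_mul_of_nonneg_right this hδ.le).trans_eq (one_mul δ)
  have hq : (2⁻¹ : ℝ) ^ (s - α) < 1 := Real.rpow_lt_one (by norm_num) (by norm_num) (by linarith)
  have hq0 : 0 < (2⁻¹ : ℝ) ^ (s - α) := by positivity
  have hpt : ∀ y ∈ Metric.ball p δ \ {y | dist y p = 0}, ENNReal.ofReal (dist y p ^ (-α)) ≤
      ∑' j, (Metric.ball p (R j)).indicator
        (fun _ => ENNReal.ofReal ((2⁻¹ * R j) ^ (-α))) y := by
    rintro y ⟨hy, hy0⟩
    have hpos : 0 < dist y p := lt_of_le_of_ne dist_nonneg (Ne.symm hy0)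
    have hex : ∃ j, R j ≤ dist y p := by
      obtain ⟨j, hj⟩ := exists_pow_lt_of_lt_one (div_pos hpos hδ) (by norm_num : (2⁻¹ : ℝ) < 1)
      exact ⟨j, ((lt_div_iff₀ hδ).1 hj).le⟩
    classical
    obtain ⟨j, hj⟩ : ∃ j, Nat.find hex = j + 1 := by
      refine Nat.exists_eq_succ_of_ne_zero fun h0 => ?_
      have := Nat.find_spec hex
      rw [h0] at this
      simp only [hR, pow_zero, one_mul] at this
      exact absurd (Metric.mem_ball.1 hy) (not_lt.2 this)
    have h1 : R (j + 1) ≤ dist y p := hj ▸ Nat.find_spec hex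
    have h2 : dist y p < R j := not_le.1 (Nat.find_min hex (by omega))
    have h3 : R (j + 1) = 2⁻¹ * R j := by simp only [hR]; ring
    refine le_trans ?_ (ENNReal.le_tsum j)
    rw [Set.indicator_of_mem (Metric.mem_ball.2 h2), ← h3]
    exact ENNReal.ofReal_le_ofReal (Real.rpow_le_rpow_of_nonpos (hRpos _) h1 (by linarith))
  have hmeas : ∀ j, Measurable ((Metric.ball p (R j)).indicator
      (fun _ : X => ENNReal.ofReal ((2⁻¹ * R j) ^ (-α)))) := fun j =>
    measurable_const.indicator Metric.isOpen_ball.measurableSet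
  have hterm : ∀ j, C * R j ^ s * (2⁻¹ * R j) ^ (-α) =
      C * 2 ^ α * δ ^ (s - α) * ((2⁻¹ : ℝ) ^ (s - α)) ^ j := fun j => by
    rw [Real.mul_rpow (by norm_num) (hRpos j).le, Real.rpow_neg (by norm_num : (0 : ℝ) ≤ 2⁻¹),
      Real.inv_rpow (by norm_num), inv_inv, ← Real.rpow_natCast ((2⁻¹ : ℝ) ^ (s - α)),
      ← Real.rpow_mul (by norm_num), mul_comm (s - α) (j : ℝ), Real.rpow_mul (by norm_num),
      Real.rpow_natCast, mul_assoc _ (δ ^ _), ← Real.mul_rpow hδ.le (by positivity), mul_comm δ,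
      sub_eq_add_neg, Real.rpow_add (hRpos j)]
    ring
  have hnn : ∀ j : ℕ, 0 ≤ C * 2 ^ α * δ ^ (s - α) * ((2⁻¹ : ℝ) ^ (s - α)) ^ j := fun j => by
    positivity
  have hM : MeasurableSet (Metric.ball p δ \ {y | dist y p = 0}) :=
    Metric.isOpen_ball.measurableSet.diff
      (isClosed_eq (by fun_prop) continuous_const).measurableSet
  calc ∫⁻ y in Metric.ball p δ \ {y | dist y p = 0}, ENNReal.ofReal (dist y p ^ (-α)) ∂τ
      ≤ ∫⁻ y in Metric.ball p δ \ {y | dist y p = 0}, ∑' j, (Metric.ball p (R j)).indicator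
        (fun _ => ENNReal.ofReal ((2⁻¹ * R j) ^ (-α))) y ∂τ := setLIntegral_mono' hM hpt
    _ ≤ ∫⁻ y, ∑' j, (Metric.ball p (R j)).indicator
        (fun _ => ENNReal.ofReal ((2⁻¹ * R j) ^ (-α))) y ∂τ := setLIntegral_le_lintegral _ _
    _ = ∑' j, ∫⁻ y, (Metric.ball p (R j)).indicator
        (fun _ => ENNReal.ofReal ((2⁻¹ * R j) ^ (-α))) y ∂τ :=
      lintegral_tsum fun j => (hmeas j).aemeasurable
    _ ≤ ∑' j : ℕ, ENNReal.ofReal (C * 2 ^ α * δ ^ (s - α) * ((2⁻¹ : ℝ) ^ (s - α)) ^ j) := by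
      refine ENNReal.tsum_le_tsum fun j => ?_
      have : 0 < 2⁻¹ * R j := mul_pos (by norm_num) (hRpos j)
      rw [lintegral_indicator_const Metric.isOpen_ball.measurableSet, ← hterm, mul_comm,
        ENNReal.ofReal_mul' (by positivity)]
      gcongr
      exact hτ _ (hRpos j) (hRle j)
    _ = ENNReal.ofReal (C * dyadicConst s α * δ ^ (s - α)) := by
      rw [← ENNReal.ofReal_tsum_of_nonneg hnn
        ((summable_geometric_of_lt_one hq0.le hq).mul_left _), tsum_mul_left,
        tsum_geometric_of_lt_one hq0.le hq, dyadicConst]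
      congr 1; ring

/-- Standing hypothesis of the estimates below: `τ` lives on the ball of radius `δ` around `p`, and
smaller balls around `p` have measure at most `C r ^ s`. -/
structure RegularAt (τ : Measure X) (p : X) (C s δ : ℝ) : Prop where
  ball_le : ∀ r, 0 < r → r ≤ δ → τ (Metric.ball p r) ≤ ENNReal.ofReal (C * r ^ s)
  ae_mem : ∀ᵐ y ∂τ, y ∈ Metric.ball p δ

variable {τ : Measure X} {p : X} {C s α δ M : ℝ} {f : X → F}

/-- A function with a singularity of order `α < s` at `p` is integrable, with integral of order
`δ ^ (s - α)`. Its value at `p` is irrelevant, because `p` is not an atom of `τ`. -/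
lemma RegularAt.lintegral_enorm_le (h : RegularAt τ p C s δ) (hC : 0 ≤ C)
    (hα : 0 ≤ α) (hs : α < s) (hδ : 0 < δ) (hM : 0 ≤ M)
    (hf : ∀ᵐ y ∂τ, dist y p ≠ 0 → ‖f y‖ ≤ M * dist y p ^ (-α)) :
    ∫⁻ y, ‖f y‖ₑ ∂τ ≤ ENNReal.ofReal (M * (C * dyadicConst s α * δ ^ (s - α))) := by
  have h0 : τ {y | dist y p = 0} = 0 := by
    have hs0 : 0 < s := hα.trans_lt hs
    have hlim : Tendsto (fun r : ℝ => ENNReal.ofReal (C * r ^ s)) (𝓝[>] 0) (𝓝 0) := by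
      have h1 : Tendsto (fun r : ℝ => C * r ^ s) (𝓝 0) (𝓝 (C * 0 ^ s)) :=
        ((Real.continuousAt_rpow_const 0 s (Or.inr hs0.le)).tendsto).const_mul C
      rw [Real.zero_rpow hs0.ne', mul_zero] at h1
      simpa using (ENNReal.tendsto_ofReal h1).mono_left nhdsWithin_le_nhds
    refine le_antisymm (ge_of_tendsto hlim ?_) bot_le
    filter_upwards [Ioc_mem_nhdsGT hδ] with r hr
    refine (measure_mono fun y hy => ?_).trans (h.ball_le r hr.1 hr.2)
    have hy0 : dist y p = 0 := hy
    exact Metric.mem_ball.2 (hy0.symm ▸ hr.1)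
  have hne : ∀ᵐ y ∂τ, dist y p ≠ 0 := by
    simpa [ae_iff] using h0
  calc ∫⁻ y, ‖f y‖ₑ ∂τ
      ≤ ∫⁻ y, (Metric.ball p δ \ {y | dist y p = 0}).indicator
          (fun y => ENNReal.ofReal M * ENNReal.ofReal (dist y p ^ (-α))) y ∂τ := by
        refine lintegral_mono_ae ?_
        filter_upwards [hf, hne, h.ae_mem] with y h1 h2 h3
        have hmem : y ∈ Metric.ball p δ \ {y | dist y p = 0} := ⟨h3, h2⟩
        rw [Set.indicator_of_mem hmem, ← ENNReal.ofReal_mul hM, ← ofReal_norm]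
        exact ENNReal.ofReal_le_ofReal (h1 h2)
    _ ≤ ENNReal.ofReal M * ∫⁻ y in Metric.ball p δ \ {y | dist y p = 0},
          ENNReal.ofReal (dist y p ^ (-α)) ∂τ := by
        refine (lintegral_indicator_le _ _).trans_eq ?_
        rw [lintegral_const_mul']
        exact ENNReal.ofReal_ne_top
    _ ≤ _ := by
        rw [ENNReal.ofReal_mul hM]
        gcongr
        exact lintegral_rpow_neg_le hC hα hs hδ h.ball_le

lemma RegularAt.norm_integral_le (h : RegularAt τ p C s δ) (hC : 0 ≤ C)
    (hα : 0 ≤ α) (hs : α < s) (hδ : 0 < δ) (hM : 0 ≤ M)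
    (hf : ∀ᵐ y ∂τ, dist y p ≠ 0 → ‖f y‖ ≤ M * dist y p ^ (-α)) :
    ‖∫ y, f y ∂τ‖ ≤ M * (C * dyadicConst s α * δ ^ (s - α)) := by
  have h1 := (enorm_integral_le_lintegral_enorm f).trans
    (h.lintegral_enorm_le hC hα hs hδ hM hf)
  have := dyadicConst_pos hs
  rw [← ofReal_norm] at h1
  exact (ENNReal.ofReal_le_ofReal_iff (by positivity)).1 h1

lemma RegularAt.integrable (h : RegularAt τ p C s δ) (hC : 0 ≤ C)
    (hα : 0 ≤ α) (hs : α < s) (hδ : 0 < δ) (hM : 0 ≤ M) (hfm : AEStronglyMeasurable f τ)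
    (hf : ∀ᵐ y ∂τ, dist y p ≠ 0 → ‖f y‖ ≤ M * dist y p ^ (-α)) :
    Integrable f τ :=
  ⟨hfm, (h.lintegral_enorm_le hC hα hs hδ hM hf).trans_lt ENNReal.ofReal_lt_top⟩

end Singular

/-! ### The kernels -/

section Kernel

variable {E : Type*} [NormedAddCommGroup E] [InnerProductSpace ℝ E]

/-- The kernel `z / |z| ^ (d + 1)`, which in `ℝ ^ (d + 1)` is proportional to the gradient of the
fundamental solution. Its value at the origin is `0`. -/
def gradKernel (d : ℕ) (z : E) : E := (‖z‖ ^ (d + 1))⁻¹ • z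

@[simp] lemma gradKernel_zero (d : ℕ) : gradKernel d (0 : E) = 0 := by simp [gradKernel]

lemma norm_gradKernel_le (d : ℕ) (z : E) : ‖gradKernel d z‖ ≤ (‖z‖ ^ d)⁻¹ := by
  rcases eq_or_ne z 0 with rfl | hz
  · simp
  · have : 0 < ‖z‖ := norm_pos_iff.2 hz
    rw [gradKernel, norm_smul, norm_inv, norm_pow, norm_norm, pow_succ]
    field_simp
    rfl

/-- Away from the origin, the kernel is Lipschitz with constant of order `m ^ (-(d + 1))`. -/
lemma norm_gradKernel_sub_le (d : ℕ) {a b : E} {m : ℝ} (hm : 0 < m) (ha : m ≤ ‖a‖)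
    (hb : m ≤ ‖b‖) :
    ‖gradKernel d a - gradKernel d b‖ ≤ (d + 2) * ‖a - b‖ * (m ^ (d + 1))⁻¹ := by
  have ha0 : 0 < ‖a‖ := hm.trans_le ha
  have hb0 : 0 < ‖b‖ := hm.trans_le hb
  have hx : ‖a‖⁻¹ ≤ m⁻¹ := inv_anti₀ hm ha
  have hy : ‖b‖⁻¹ ≤ m⁻¹ := inv_anti₀ hm hb
  have hsplit : gradKernel d a - gradKernel d b =
      (‖a‖⁻¹ ^ (d + 1)) • (a - b) + (‖a‖⁻¹ ^ (d + 1) - ‖b‖⁻¹ ^ (d + 1)) • b := by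
    simp only [gradKernel, inv_pow]; module
  have hdiff : |‖a‖⁻¹ - ‖b‖⁻¹| * ‖b‖ ≤ ‖a - b‖ * m⁻¹ := by
    have : ‖a‖⁻¹ - ‖b‖⁻¹ = (‖b‖ - ‖a‖) * (‖a‖⁻¹ * ‖b‖⁻¹) := by field_simp
    rw [this, abs_mul, abs_of_pos (by positivity : 0 < ‖a‖⁻¹ * ‖b‖⁻¹)]
    calc |‖b‖ - ‖a‖| * (‖a‖⁻¹ * ‖b‖⁻¹) * ‖b‖ = |‖b‖ - ‖a‖| * ‖a‖⁻¹ := by field_simp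
      _ ≤ ‖a - b‖ * m⁻¹ := by
        gcongr
        rw [norm_sub_rev]
        exact abs_norm_sub_norm_le b a
  have hpow := abs_pow_sub_pow_le ‖a‖⁻¹ ‖b‖⁻¹ (d + 1)
  have hmax : max |‖a‖⁻¹| |‖b‖⁻¹| ≤ m⁻¹ := by
    rw [abs_of_pos (inv_pos.2 ha0), abs_of_pos (inv_pos.2 hb0)]; exact max_le hx hy
  rw [hsplit]
  refine (norm_add_le _ _).trans ?_
  rw [norm_smul, norm_smul, Real.norm_eq_abs, Real.norm_eq_abs, abs_of_pos (by positivity)]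
  have h1 : ‖a‖⁻¹ ^ (d + 1) * ‖a - b‖ ≤ m⁻¹ ^ (d + 1) * ‖a - b‖ := by gcongr
  have h2 : |‖a‖⁻¹ ^ (d + 1) - ‖b‖⁻¹ ^ (d + 1)| * ‖b‖ ≤
      (d + 1) * (‖a - b‖ * m⁻¹) * m⁻¹ ^ d := by
    calc _ ≤ (|‖a‖⁻¹ - ‖b‖⁻¹| * (d + 1 : ℕ) * max |‖a‖⁻¹| |‖b‖⁻¹| ^ (d + 1 - 1)) * ‖b‖ := by
          gcongr
      _ = (d + 1) * (|‖a‖⁻¹ - ‖b‖⁻¹| * ‖b‖) * max |‖a‖⁻¹| |‖b‖⁻¹| ^ d := by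
          rw [Nat.add_sub_cancel]; push_cast; ring
      _ ≤ _ := by gcongr
  calc _ ≤ m⁻¹ ^ (d + 1) * ‖a - b‖ + (d + 1) * (‖a - b‖ * m⁻¹) * m⁻¹ ^ d := add_le_add h1 h2
    _ = _ := by rw [← inv_pow]; ring

lemma measurable_gradKernel [MeasurableSpace E] [BorelSpace E] [SecondCountableTopology E]
    (d : ℕ) : Measurable (gradKernel d : E → E) := by
  unfold gradKernel; fun_prop

end Kernel

/-! ### Potentials away from the charge -/

section Smooth

set_option linter.unusedSectionVars false

universe u

variable {E : Type u} [NormedAddCommGroup E] [InnerProductSpace ℝ E]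
  [MeasurableSpace E] [BorelSpace E] [FiniteDimensional ℝ E]
  {σ : Measure E} {S : Set E} {f : E → ℝ} {x : E}

/-- The potential `∫_S f(y) H(x - y) dσ(y)` of the charge `f σ` on `S` with kernel `H`. -/
def potential {F : Type*} [NormedAddCommGroup F] [NormedSpace ℝ F]
    (σ : Measure E) (S : Set E) (f : E → ℝ) (H : E → F) (x : E) : F :=
  ∫ y in S, f y • H (x - y) ∂σ

variable {F : Type*} [NormedAddCommGroup F] [NormedSpace ℝ F] {H : E → F}

/-- A point off the compact charge has a neighbourhood on which the kernel is uniformly bounded. -/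
lemma exists_closedBall_bound (hS : IsCompact S) (hx : x ∉ S) (hH : ContinuousOn H {0}ᶜ) :
    ∃ ε > 0, Metric.closedBall x ε ⊆ Sᶜ ∧
      ∃ B, ∀ x' ∈ Metric.closedBall x ε, ∀ y ∈ S, ‖H (x' - y)‖ ≤ B := by
  obtain ⟨ε, hε, hball⟩ := Metric.nhds_basis_closedBall.mem_iff.1
    (hS.isClosed.isOpen_compl.mem_nhds hx)
  refine ⟨ε, hε, hball, ?_⟩
  have hK : IsCompact (Metric.closedBall x ε ×ˢ S) := (isCompact_closedBall x ε).prod hS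
  have hc : ContinuousOn (fun q : E × E => H (q.1 - q.2)) (Metric.closedBall x ε ×ˢ S) := by
    refine hH.comp (by fun_prop) fun q hq => ?_
    have h1 := hball hq.1
    intro h0
    rw [sub_eq_zero.1 h0] at h1
    exact h1 hq.2
  obtain ⟨B, hB⟩ := hK.exists_bound_of_continuousOn hc
  exact ⟨B, fun x' hx' y hy => hB (x', y) ⟨hx', hy⟩⟩

lemma aestronglyMeasurable_kernel (hS : IsCompact S) (hx : x ∉ S) (hH : ContinuousOn H {0}ᶜ) :
    AEStronglyMeasurable (fun y => H (x - y)) (σ.restrict S) := by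
  refine ContinuousOn.aestronglyMeasurable_of_isCompact ?_ hS hS.measurableSet
  refine hH.comp (by fun_prop) fun y hy h0 => ?_
  rw [sub_eq_zero.1 h0] at hx
  exact hx hy

lemma integrable_potential (hS : IsCompact S) (hf : IntegrableOn f S σ) (hx : x ∉ S)
    (hH : ContinuousOn H {0}ᶜ) : IntegrableOn (fun y => f y • H (x - y)) S σ := by
  obtain ⟨ε, hε, -, B, hB⟩ := exists_closedBall_bound hS hx hH
  refine Integrable.smul_bdd hf B (aestronglyMeasurable_kernel hS hx hH) ?_
  exact (ae_restrict_mem hS.measurableSet).mono fun y hy =>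
    hB x (Metric.mem_closedBall_self hε.le) y hy

lemma hasFDerivAt_potential (hS : IsCompact S) (hf : IntegrableOn f S σ) (hx : x ∉ S)
    (hH : ContDiffOn ℝ 1 H {0}ᶜ) :
    HasFDerivAt (potential σ S f H) (potential σ S f (fderiv ℝ H) x) x := by
  have hopen : IsOpen ({0}ᶜ : Set E) := isOpen_compl_singleton
  have hH' : ContinuousOn (fderiv ℝ H) {0}ᶜ := hH.continuousOn_fderiv_of_isOpen hopen le_rfl
  obtain ⟨ε, hε, hball, B, hB⟩ := exists_closedBall_bound hS hx hH'
  refine hasFDerivAt_integral_of_dominated_of_fderiv_le (μ := σ.restrict S)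
    (F := fun x y => f y • H (x - y)) (F' := fun x y => f y • fderiv ℝ H (x - y))
    (bound := fun y => ‖f y‖ * B)
    (Metric.closedBall_mem_nhds x hε) ?_ (integrable_potential hS hf hx hH.continuousOn)
    ((integrable_potential hS hf hx hH').aestronglyMeasurable) ?_ (hf.norm.mul_const B) ?_
  · filter_upwards [Metric.closedBall_mem_nhds x hε] with x' hx'
    exact (integrable_potential hS hf (hball hx') hH.continuousOn).aestronglyMeasurable
  · refine (ae_restrict_mem hS.measurableSet).mono fun y hy x' hx' => ?_
    rw [norm_smul]
    gcongr
    exact hB x' hx' y hy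
  · refine (ae_restrict_mem hS.measurableSet).mono fun y hy x' hx' => ?_
    have hne : x' - y ∈ ({0}ᶜ : Set E) := fun h0 => hball hx' (by rwa [sub_eq_zero.1 h0])
    have hd : HasFDerivAt H (fderiv ℝ H (x' - y)) (x' - y) :=
      ((hH.contDiffAt (hopen.mem_nhds hne)).differentiableAt (by norm_num)).hasFDerivAt
    have := hd.comp x' ((hasFDerivAt_id x').sub_const y)
    exact this.const_smul (f y)

/-- The codomain `F` varies in the induction, in which it is replaced by `E →L[ℝ] F`; this is why
it is restricted to the universe of `E`. -/
lemma contDiffOn_potential (hS : IsCompact S) (hf : IntegrableOn f S σ) (n : ℕ) :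
    ∀ {F : Type u} [NormedAddCommGroup F] [NormedSpace ℝ F] {H : E → F},
      ContDiffOn ℝ (n + 1 : ℕ) H {0}ᶜ → ContDiffOn ℝ n (potential σ S f H) Sᶜ := by
  have hSo : IsOpen Sᶜ := hS.isClosed.isOpen_compl
  have hopen : IsOpen ({0}ᶜ : Set E) := isOpen_compl_singleton
  induction n with
  | zero =>
    intro F _ _ H hH
    exact contDiffOn_zero.2 fun x hx =>
      (hasFDerivAt_potential hS hf hx (hH.of_le (by simp))).continuousAt.continuousWithinAt
  | succ n ih =>
    intro F _ _ H hH
    have h1 : ContDiffOn ℝ 1 H {0}ᶜ := hH.of_le (by norm_cast; omega)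
    have hH' : ContDiffOn ℝ (n + 1 : ℕ) (fderiv ℝ H) {0}ᶜ :=
      hH.fderiv_of_isOpen hopen (by norm_cast)
    have := ih hH'
    push_cast
    rw [contDiffOn_succ_iff_fderiv_of_isOpen hSo]
    refine ⟨fun x hx => (hasFDerivAt_potential hS hf hx
      h1).differentiableAt.differentiableWithinAt, by simp, ?_⟩
    exact this.congr fun x hx => (hasFDerivAt_potential hS hf hx h1).fderiv

/-- The potential of a harmonic kernel is harmonic off the charge. -/
lemma harmonicAt_potential {F : Type u} [NormedAddCommGroup F] [NormedSpace ℝ F] {H : E → F}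
    {ι : Type*} [Fintype ι] (b : OrthonormalBasis ι ℝ E)
    (hS : IsCompact S) (hf : IntegrableOn f S σ) (hx : x ∉ S)
    (hH : ContDiffOn ℝ 3 H {0}ᶜ)
    (hΔ : ∀ z ≠ 0, ∑ i, fderiv ℝ (fderiv ℝ H) z (b i) (b i) = 0) :
    HarmonicAt (potential σ S f H) x := by
  have hSo : IsOpen Sᶜ := hS.isClosed.isOpen_compl
  have hopen : IsOpen ({0}ᶜ : Set E) := isOpen_compl_singleton
  have hH1 : ContDiffOn ℝ 2 (fderiv ℝ H) {0}ᶜ := hH.fderiv_of_isOpen hopen (by norm_num)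
  have hH2 : ContDiffOn ℝ 1 (fderiv ℝ (fderiv ℝ H)) {0}ᶜ :=
    hH1.fderiv_of_isOpen hopen (by norm_num)
  refine ⟨(contDiffOn_potential hS hf 2 hH).contDiffAt (hSo.mem_nhds hx), ?_⟩
  filter_upwards [hSo.mem_nhds hx] with x' hx'
  have hfd : fderiv ℝ (potential σ S f H) =ᶠ[𝓝 x'] potential σ S f (fderiv ℝ H) := by
    filter_upwards [hSo.mem_nhds hx'] with z hz
    exact (hasFDerivAt_potential hS hf hz (hH.of_le (by norm_num))).fderiv
  have hint := integrable_potential hS hf hx' hH2.continuousOn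
  rw [laplacian_eq_iteratedFDeriv_orthonormalBasis _ b]
  simp only [iteratedFDeriv_two_apply, Matrix.cons_val_zero, Matrix.cons_val_one, hfd.fderiv_eq,
    (hasFDerivAt_potential hS hf hx' (hH1.of_le (by norm_num))).fderiv, Pi.zero_apply]
  unfold potential
  have happ : ∀ i, (∫ y in S, f y • fderiv ℝ (fderiv ℝ H) (x' - y) ∂σ) (b i) (b i) =
      ∫ y in S, f y • fderiv ℝ (fderiv ℝ H) (x' - y) (b i) (b i) ∂σ := fun i => by
    rw [ContinuousLinearMap.integral_apply hint,
      ContinuousLinearMap.integral_apply (hint.apply_continuousLinearMap _)]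
    rfl
  simp only [happ]
  rw [← integral_finsetSum]
  · refine integral_eq_zero_of_ae ?_
    refine (ae_restrict_mem hS.measurableSet).mono fun y hy => ?_
    have hne : x' - y ≠ 0 := fun h0 => hx' (by rwa [sub_eq_zero.1 h0])
    simp [← Finset.smul_sum, hΔ _ hne]
  · intro i _
    exact (hint.apply_continuousLinearMap (b i)).apply_continuousLinearMap (b i)

end Smooth

/-! ### Derivatives of the kernels -/

section KernelDeriv

variable {E : Type*} [NormedAddCommGroup E] [InnerProductSpace ℝ E] {z : E}

lemma hasFDerivAt_norm_of_ne (hz : z ≠ 0) :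
    HasFDerivAt (fun z : E => ‖z‖) (‖z‖⁻¹ • innerSL ℝ z) z := by
  have h := ((hasStrictFDerivAt_norm_sq z).hasFDerivAt).sqrt (pow_ne_zero 2 (norm_ne_zero_iff.2 hz))
  simp only [Real.sqrt_sq (norm_nonneg _)] at h
  refine h.congr_fderiv ?_
  ext v
  simp
  field_simp

lemma hasFDerivAt_inv_norm_pow (k : ℕ) (hz : z ≠ 0) :
    HasFDerivAt (fun z : E => (‖z‖ ^ k)⁻¹) (-((k : ℝ) * (‖z‖ ^ (k + 2))⁻¹) • innerSL ℝ z) z := by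
  have hn : ‖z‖ ≠ 0 := norm_ne_zero_iff.2 hz
  have h := (((hasDerivAt_pow k ‖z‖).inv (pow_ne_zero k hn))).comp_hasFDerivAt z
    (hasFDerivAt_norm_of_ne hz)
  refine h.congr_fderiv ?_
  rw [smul_smul]
  congr 1
  rcases k with _ | k
  · simp
  · rw [Nat.add_sub_cancel]; field_simp; ring

lemma contDiffOn_inv_norm_pow (k : ℕ) (n : WithTop ℕ∞) :
    ContDiffOn ℝ n (fun z : E => (‖z‖ ^ k)⁻¹) {0}ᶜ := fun _ hz =>
  (((contDiffAt_norm ℝ hz).pow k).inv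
    (pow_ne_zero k (norm_ne_zero_iff.2 hz))).contDiffWithinAt

lemma contDiffOn_inner_gradKernel (d : ℕ) (e : E) (n : WithTop ℕ∞) :
    ContDiffOn ℝ n (fun z : E => inner ℝ e (gradKernel d z)) {0}ᶜ := by
  unfold gradKernel
  exact contDiffOn_const.inner ℝ ((contDiffOn_inv_norm_pow (d + 1) n).smul contDiffOn_id)

lemma hasFDerivAt_inner_gradKernel (d : ℕ) (e : E) (hz : z ≠ 0) :
    HasFDerivAt (fun z : E => inner ℝ e (gradKernel d z))
      ((‖z‖ ^ (d + 1))⁻¹ • innerSL ℝ e -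
        ((d + 1 : ℝ) * inner ℝ e z * (‖z‖ ^ (d + 3))⁻¹) • innerSL ℝ z) z := by
  have h1 : HasFDerivAt (fun z : E => inner ℝ e z) (innerSL ℝ e) z := (innerSL ℝ e).hasFDerivAt
  have h := (hasFDerivAt_inv_norm_pow (d + 1) hz).mul h1
  have heq : (fun z : E => inner ℝ e (gradKernel d z)) =
      fun z => (‖z‖ ^ (d + 1))⁻¹ * inner ℝ e z := by
    funext z; simp [gradKernel, inner_smul_right]
  rw [heq]
  refine h.congr_fderiv ?_
  ext v
  simp
  ring

variable {ι : Type*} [Fintype ι]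

/-- The components of `gradKernel d` are harmonic in dimension `d + 1`. The Laplacian is written as
the trace of the second derivative, the form in which `harmonicAt_potential` asks for it. -/
lemma laplacian_inner_gradKernel [FiniteDimensional ℝ E] (b : OrthonormalBasis ι ℝ E) (d : ℕ)
    (hd : Fintype.card ι = d + 1) (e : E) (hz : z ≠ 0) :
    ∑ i, fderiv ℝ (fderiv ℝ (fun z : E => inner ℝ e (gradKernel d z))) z (b i) (b i) = 0 := by
  have hev : ∀ v, (fun w => fderiv ℝ (fun z : E => inner ℝ e (gradKernel d z)) w v) =ᶠ[𝓝 z]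
      fun w => inner ℝ e v * (‖w‖ ^ (d + 1))⁻¹ -
        (d + 1) * (inner ℝ e w * inner ℝ w v * (‖w‖ ^ (d + 3))⁻¹) := by
    intro v
    filter_upwards [isOpen_compl_singleton.mem_nhds hz] with w hw
    rw [(hasFDerivAt_inner_gradKernel d e hw).fderiv]
    simp
    ring
  have hdiff : DifferentiableAt ℝ (fderiv ℝ (fun z : E => inner ℝ e (gradKernel d z))) z :=
    (((contDiffOn_inner_gradKernel d e 2).fderiv_of_isOpen isOpen_compl_singleton
      (m := 1) (by norm_num)).contDiffAt (isOpen_compl_singleton.mem_nhds hz)).differentiableAt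
      (by norm_num)
  have key : ∀ v, fderiv ℝ (fderiv ℝ (fun z : E => inner ℝ e (gradKernel d z))) z v v =
      -(2 * (d + 1) * (‖z‖ ^ (d + 3))⁻¹) * (inner ℝ e v * inner ℝ v z)
      - (d + 1) * inner ℝ e z * (‖z‖ ^ (d + 3))⁻¹ * ‖v‖ ^ 2
      + (d + 1) * (d + 3) * inner ℝ e z * (‖z‖ ^ (d + 5))⁻¹ * (inner ℝ z v * inner ℝ v z) := by
    intro v
    have h0 : fderiv ℝ (fderiv ℝ (fun z : E => inner ℝ e (gradKernel d z))) z v v =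
        fderiv ℝ (fun w => fderiv ℝ (fun z : E => inner ℝ e (gradKernel d z)) w v) z v := by
      rw [fderiv_clm_apply hdiff (by fun_prop)]
      simp
    rw [h0, (hev v).fderiv_eq]
    have h1 : HasFDerivAt (fun w : E => inner ℝ e w) (innerSL ℝ e) z := (innerSL ℝ e).hasFDerivAt
    have h2 : HasFDerivAt (fun w : E => inner ℝ w v) (innerSL ℝ v) z := by
      simpa only [real_inner_comm] using! (innerSL ℝ v).hasFDerivAt (x := z)
    have h3 := ((hasFDerivAt_inv_norm_pow (d + 1) hz).const_mul (inner ℝ e v)).sub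
      (((h1.mul h2).mul (hasFDerivAt_inv_norm_pow (d + 3) hz)).const_mul ((d : ℝ) + 1))
    have h4 := h3.fderiv
    refine (congrArg (fun L : E →L[ℝ] ℝ => L v) h4).trans ?_
    simp [real_inner_comm z v]
    ring
  simp only [key]
  rw [Finset.sum_add_distrib, Finset.sum_sub_distrib, ← Finset.mul_sum, ← Finset.mul_sum,
    ← Finset.mul_sum, b.sum_inner_mul_inner, b.sum_inner_mul_inner]
  have hn : ‖z‖ ≠ 0 := norm_ne_zero_iff.2 hz
  simp [hd]
  field_simp
  ring

end KernelDeriv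

/-! ### Local geometry of a `C²` hypersurface -/

section LevelSet

set_option linter.unusedSectionVars false

variable {E : Type*} [NormedAddCommGroup E] [InnerProductSpace ℝ E] [FiniteDimensional ℝ E]
  {φ : E → ℝ} {p₀ : E}

/-- The normalised gradient. -/
def unitGradient (φ : E → ℝ) (x : E) : E := ‖gradient φ x‖⁻¹ • gradient φ x

lemma inner_gradient (φ : E → ℝ) (x v : E) : inner ℝ (gradient φ x) v = fderiv ℝ φ x v := by
  simp [gradient]

/-- Quantitative non-degeneracy of `φ` on the ball of radius `r` around `p₀`: the gradient is
`L`-Lipschitz and it makes a uniformly positive product with all its unit directions. -/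
structure GradientBounds (φ : E → ℝ) (p₀ : E) (L g r : ℝ) : Prop where
  L_pos : 0 < L
  g_pos : 0 < g
  contDiffAt : ∀ x ∈ Metric.ball p₀ r, ContDiffAt ℝ 1 φ x
  lipschitz : ∀ x ∈ Metric.ball p₀ r, ∀ y ∈ Metric.ball p₀ r,
    ‖gradient φ x - gradient φ y‖ ≤ L * ‖x - y‖
  le_inner : ∀ x ∈ Metric.ball p₀ r, ∀ y ∈ Metric.ball p₀ r,
    g ≤ inner ℝ (gradient φ x) (unitGradient φ y)
  norm_unit : ∀ x ∈ Metric.ball p₀ r, ‖unitGradient φ x‖ = 1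

/-- The constants `L` and `g` do not depend on the radius, which may be decreased later. -/
lemma exists_gradientBounds (hφ : ContDiffAt ℝ 2 φ p₀) (h0 : gradient φ p₀ ≠ 0) :
    ∃ L g R, 0 < R ∧ ∀ r, 0 < r → r ≤ R → GradientBounds φ p₀ L g r := by
  have hg0 : 0 < ‖gradient φ p₀‖ := norm_pos_iff.2 h0
  obtain ⟨K, t, ht, hK⟩ := (hφ.fderiv_right (m := 1) (by norm_num)).exists_lipschitzOnWith
  have hev : ∀ᶠ x in 𝓝 p₀, ContDiffAt ℝ 1 φ x := by
    filter_upwards [hφ.eventually (by simp)] with x hx using hx.of_le (by norm_num)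
  obtain ⟨R₁, hR₁, hball⟩ := Metric.mem_nhds_iff.1 (inter_mem ht hev)
  set g := ‖gradient φ p₀‖ / 4 with hg
  set L : ℝ := K + 1 with hL
  have hLpos : 0 < L := by positivity
  refine ⟨L, g, min R₁ (g / (2 * L)), by positivity, fun r hr hrR => ?_⟩
  have hrR₁ : r ≤ R₁ := hrR.trans (min_le_left _ _)
  have hrL : L * (2 * r) ≤ g := by
    have := hrR.trans (min_le_right _ _)
    rw [le_div_iff₀ (by positivity)] at this
    linarith
  have hmem : ∀ x ∈ Metric.ball p₀ r, x ∈ t ∧ ContDiffAt ℝ 1 φ x := fun x hx =>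
    hball (Metric.ball_subset_ball hrR₁ hx)
  have hlip : ∀ x ∈ Metric.ball p₀ r, ∀ y ∈ Metric.ball p₀ r,
      ‖gradient φ x - gradient φ y‖ ≤ L * ‖x - y‖ := fun x hx y hy => by
    have h1 := hK.norm_sub_le (hmem x hx).1 (hmem y hy).1
    have h2 : ‖gradient φ x - gradient φ y‖ = ‖fderiv ℝ φ x - fderiv ℝ φ y‖ := by
      unfold gradient
      rw [← map_sub, LinearIsometryEquiv.norm_map]
    rw [h2]
    refine h1.trans ?_
    gcongr
    linarith
  have hlip2 : ∀ x ∈ Metric.ball p₀ r, ∀ y ∈ Metric.ball p₀ r,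
      ‖gradient φ x - gradient φ y‖ ≤ g := fun x hx y hy => by
    refine (hlip x hx y hy).trans (le_trans ?_ hrL)
    gcongr
    have h1 := dist_triangle_right x y p₀
    have h2 := Metric.mem_ball.1 hx
    have h3 := Metric.mem_ball.1 hy
    rw [← dist_eq_norm]
    linarith
  have hlow : ∀ x ∈ Metric.ball p₀ r, 3 * g ≤ ‖gradient φ x‖ := fun x hx => by
    have h1 := hlip2 x hx p₀ (Metric.mem_ball_self hr)
    have h2 := norm_sub_norm_le (gradient φ p₀) (gradient φ x)
    rw [norm_sub_rev] at h2
    linarith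
  have hgpos : 0 < g := by positivity
  have hunit : ∀ x ∈ Metric.ball p₀ r, ‖unitGradient φ x‖ = 1 := fun x hx => by
    have : ‖gradient φ x‖ ≠ 0 := by linarith [hlow x hx]
    rw [unitGradient, norm_smul, norm_inv, norm_norm, inv_mul_cancel₀ this]
  refine ⟨hLpos, hgpos, fun x hx => (hmem x hx).2, hlip, fun x hx y hy => ?_, hunit⟩
  have h1 : inner ℝ (gradient φ y) (unitGradient φ y) = ‖gradient φ y‖ := by
    have : ‖gradient φ y‖ ≠ 0 := by linarith [hlow y hy]
    rw [unitGradient, inner_smul_right, real_inner_self_eq_norm_sq]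
    field_simp
  have h2 : |inner ℝ (gradient φ x - gradient φ y) (unitGradient φ y)| ≤ g := by
    refine (abs_real_inner_le_norm _ _).trans ?_
    rw [hunit y hy, mul_one]
    exact hlip2 x hx y hy
  rw [inner_sub_left, h1] at h2
  have := (abs_le.1 h2).1
  linarith [hlow y hy]

namespace GradientBounds

variable {L g r : ℝ} (h : GradientBounds φ p₀ L g r)
include h

lemma le_norm {x : E} (hx : x ∈ Metric.ball p₀ r) : g ≤ ‖gradient φ x‖ := by
  refine (h.le_inner x hx x hx).trans ((real_inner_le_norm _ _).trans ?_)
  rw [h.norm_unit x hx, mul_one]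

lemma taylor {x y : E} (hx : x ∈ Metric.ball p₀ r) (hy : y ∈ Metric.ball p₀ r) :
    |φ y - φ x - inner ℝ (gradient φ x) (y - x)| ≤ L * ‖y - x‖ ^ 2 := by
  have hseg : segment ℝ x y ⊆ Metric.ball p₀ r := (convex_ball p₀ r).segment_subset hx hy
  have := (convex_segment x y).norm_image_sub_le_of_norm_hasFDerivWithin_le' (f := φ)
    (f' := fderiv ℝ φ) (φ := fderiv ℝ φ x) (C := L * ‖y - x‖)
    (fun z hz => ((h.contDiffAt z (hseg hz)).differentiableAt
      (by norm_num)).hasFDerivAt.hasFDerivWithinAt)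
    (fun z hz => ?_) (left_mem_segment ℝ x y) (right_mem_segment ℝ x y)
  · rw [inner_gradient, ← Real.norm_eq_abs]
    refine this.trans_eq (by ring)
  · have h2 : ‖fderiv ℝ φ z - fderiv ℝ φ x‖ = ‖gradient φ z - gradient φ x‖ := by
      unfold gradient
      rw [← map_sub, LinearIsometryEquiv.norm_map]
    rw [h2]
    refine (h.lipschitz z (hseg hz) x hx).trans ?_
    have := h.L_pos
    gcongr
    obtain ⟨s, hs, rfl⟩ := (segment_eq_image' ℝ x y ▸ hz :)
    rw [add_sub_cancel_left, norm_smul, Real.norm_eq_abs, abs_of_nonneg hs.1]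
    exact mul_le_of_le_one_left (norm_nonneg _) hs.2

/-- `φ` increases along all its unit gradients with rate at least `g`. -/
lemma le_sub {x p : E} {s : ℝ} (hp : p ∈ Metric.ball p₀ r) (hx : x ∈ Metric.ball p₀ r)
    (hs : 0 ≤ s) (hxs : x + s • unitGradient φ p ∈ Metric.ball p₀ r) :
    g * s ≤ φ (x + s • unitGradient φ p) - φ x := by
  have hmem : ∀ u ∈ Set.Icc (0 : ℝ) s, x + u • unitGradient φ p ∈ Metric.ball p₀ r := by
    intro u hu
    rcases hs.eq_or_lt with rfl | hs0
    · have : u = 0 := le_antisymm hu.2 hu.1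
      simpa [this] using hx
    · refine (convex_ball p₀ r).segment_subset hx hxs ?_
      rw [segment_eq_image']
      refine ⟨u / s, ⟨by have := hu.1; positivity, (div_le_one hs0).2 hu.2⟩, ?_⟩
      dsimp only
      rw [add_sub_cancel_left, smul_smul, div_mul_cancel₀ _ hs0.ne']
  have hder : ∀ u ∈ Set.Icc (0 : ℝ) s, HasDerivAt (fun u : ℝ => φ (x + u • unitGradient φ p))
      (fderiv ℝ φ (x + u • unitGradient φ p) (unitGradient φ p)) u := fun u hu => by
    have h1 := ((h.contDiffAt _ (hmem u hu)).differentiableAt (by norm_num)).hasFDerivAt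
    have h2 : HasDerivAt (fun u : ℝ => x + u • unitGradient φ p) (unitGradient φ p) u := by
      simpa using ((hasDerivAt_id u).smul_const (unitGradient φ p)).const_add x
    exact h1.comp_hasDerivAt u h2
  have := (convex_Icc (0 : ℝ) s).mul_sub_le_image_sub_of_le_deriv
    (f := fun u : ℝ => φ (x + u • unitGradient φ p)) (C := g)
    (fun u hu => (hder u hu).continuousAt.continuousWithinAt)
    (fun u hu => (hder u (interior_subset hu)).differentiableAt.differentiableWithinAt)
    (fun u hu => ?_) 0 (Set.left_mem_Icc.2 hs) s (Set.right_mem_Icc.2 hs) hs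
  · simpa using this
  · rw [(hder u (interior_subset hu)).deriv, ← inner_gradient]
    exact h.le_inner _ (hmem u (interior_subset hu)) p hp

end GradientBounds

/-- A function which vanishes at `p` is positive on the ray in a direction of increase. -/
lemma eventually_pos_of_fderiv_pos {p u : E} (hφ : DifferentiableAt ℝ φ p) (h0 : φ p = 0)
    (hu : 0 < fderiv ℝ φ p u) : ∀ᶠ s : ℝ in 𝓝[>] 0, 0 < φ (p + s • u) := by
  have h2 : HasDerivAt (fun s : ℝ => p + s • u) u 0 := by
    simpa using ((hasDerivAt_id (0 : ℝ)).smul_const u).const_add p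
  have hφ' : HasFDerivAt φ (fderiv ℝ φ p) (p + (0 : ℝ) • u) := by simpa using hφ.hasFDerivAt
  have h3 := hφ'.comp_hasDerivAt (0 : ℝ) h2
  have h4 := (hasDerivAt_iff_tendsto_slope.1 h3).mono_left
    (nhdsWithin_mono (0 : ℝ) (fun s (hs : 0 < s) => hs.ne'))
  filter_upwards [h4.eventually (lt_mem_nhds hu), self_mem_nhdsWithin] with s hs hs0
  have hs0 : (0 : ℝ) < s := hs0
  simp only [slope, Function.comp, vsub_eq_sub, sub_zero, zero_smul, add_zero, h0, smul_eq_mul]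
    at hs
  exact (mul_pos_iff_of_pos_left (inv_pos.2 hs0)).1 hs

/-- Two defining functions which are negative and positive on the same sets have the same unit
gradient. -/
lemma unitGradient_eq_of_sides {φ ψ : E → ℝ} {p : E} {A B : Set E}
    (hφ : DifferentiableAt ℝ φ p) (hψ : DifferentiableAt ℝ ψ p) (hφ0 : φ p = 0) (hψ0 : ψ p = 0)
    (hφn : ‖unitGradient φ p‖ = 1) (hψn : ‖unitGradient ψ p‖ = 1)
    (hφs : ∀ᶠ x in 𝓝 p, (x ∈ A ↔ φ x < 0) ∧ (x ∈ B ↔ 0 < φ x))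
    (hψs : ∀ᶠ x in 𝓝 p, (x ∈ A ↔ ψ x < 0) ∧ (x ∈ B ↔ 0 < ψ x)) :
    unitGradient φ p = unitGradient ψ p := by
  by_contra hne
  set a := unitGradient φ p
  set b := unitGradient ψ p
  have hab : inner ℝ a b < 1 := by
    refine lt_of_le_of_ne ((real_inner_le_norm a b).trans (by rw [hφn, hψn, mul_one])) fun h1 => ?_
    exact hne ((inner_eq_one_iff_of_norm_eq_one hφn hψn).1 h1)
  have hga : 0 < ‖gradient φ p‖ := by
    refine norm_pos_iff.2 fun h0 => ?_
    have ha0 : a = 0 := by simp [a, unitGradient, h0]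
    simp [ha0] at hφn
  have hgb : 0 < ‖gradient ψ p‖ := by
    refine norm_pos_iff.2 fun h0 => ?_
    have hb0 : b = 0 := by simp [b, unitGradient, h0]
    simp [hb0] at hψn
  have hia : gradient φ p = ‖gradient φ p‖ • a := by
    simp [a, unitGradient, smul_smul, mul_inv_cancel₀ hga.ne']
  have hib : gradient ψ p = ‖gradient ψ p‖ • b := by
    simp [b, unitGradient, smul_smul, mul_inv_cancel₀ hgb.ne']
  have h1 : fderiv ℝ (fun x => -φ x) p (b - a) > 0 := by
    rw [fderiv_fun_neg, neg_apply, ← inner_gradient, hia, real_inner_smul_left,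
      inner_sub_right, real_inner_self_eq_norm_sq, hφn]
    nlinarith
  have h2 : fderiv ℝ ψ p (b - a) > 0 := by
    rw [← inner_gradient, hib, real_inner_smul_left, inner_sub_right,
      real_inner_self_eq_norm_sq, hψn, real_inner_comm]
    nlinarith
  have e1 := eventually_pos_of_fderiv_pos hφ.neg (by simp [hφ0]) h1
  have e2 := eventually_pos_of_fderiv_pos hψ hψ0 h2
  have hlim : Tendsto (fun s : ℝ => p + s • (b - a)) (𝓝[>] 0) (𝓝 p) := by
    have : Tendsto (fun s : ℝ => p + s • (b - a)) (𝓝 0) (𝓝 (p + (0 : ℝ) • (b - a))) :=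
      Continuous.tendsto (by fun_prop) 0
    simp only [zero_smul, add_zero] at this
    exact this.mono_left nhdsWithin_le_nhds
  obtain ⟨s, hs1, hs2, hs3, hs4⟩ :=
    (e1.and (e2.and ((hlim.eventually hφs).and (hlim.eventually hψs)))).exists
  have := hs3.2.1 (hs4.2.2 hs2)
  simp only [Pi.neg_apply] at hs1
  linarith

/-- Local description, with uniform constants, of a `C²` hypersurface `S` with unit normal `n`
pointing from `A` to `B`, in the ball of radius `r` around `p₀`. -/
structure IsLocalInterface (S A B : Set E) (n : E → E) (p₀ : E) (C r : ℝ) : Prop where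
  C_pos : 0 < C
  r_pos : 0 < r
  norm_normal : ∀ p ∈ S ∩ Metric.ball p₀ r, ‖n p‖ = 1
  abs_inner_le : ∀ p ∈ S ∩ Metric.ball p₀ r, ∀ q ∈ S ∩ Metric.ball p₀ r,
    |inner ℝ (n p) (q - p)| ≤ C * ‖q - p‖ ^ 2
  normal_lipschitz : ∀ p ∈ S ∩ Metric.ball p₀ r, ∀ q ∈ S ∩ Metric.ball p₀ r,
    ‖n p - n q‖ ≤ C * ‖p - q‖
  /-- The surface covers a disk of radius `r` in each of its tangent planes. -/
  exists_height : ∀ p ∈ S ∩ Metric.ball p₀ r, ∀ z, inner ℝ (n p) z = 0 → ‖z‖ ≤ r →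
    ∃ s : ℝ, |s| ≤ C * ‖z‖ ^ 2 ∧ p + z + s • n p ∈ S
  /-- Points near the surface lie on one of its normals, on the side given by the sign of the
  distance. -/
  exists_foot : ∀ x ∈ Metric.ball p₀ r, ∃ p ∈ S, ∃ t : ℝ, x = p + t • n p ∧ |t| ≤ dist x p₀ ∧
    dist p p₀ ≤ 2 * dist x p₀ ∧ (x ∈ A → t < 0) ∧ (x ∈ B → 0 < t)

/-- If `p` is a point of its level set nearest to `x`, then `x - p` is normal to the level set, by
Lagrange multipliers. -/
lemma exists_eq_add_smul_of_isMinOn {φ : E → ℝ} {p x : E} (hφ : ContDiffAt ℝ 1 φ p)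
    (hg : gradient φ p ≠ 0) (hmin : ∀ᶠ y in 𝓝 p, φ y = φ p → dist x p ≤ dist x y) :
    ∃ t : ℝ, x = p + t • unitGradient φ p := by
  have hextr : IsLocalExtrOn (fun y => ‖y - x‖ ^ 2) {y | φ y = φ p} p := by
    refine Or.inl ?_
    refine eventually_nhdsWithin_iff.2 (hmin.mono fun y hy hyS => ?_)
    have := hy hyS
    rw [dist_comm x p, dist_comm x y, dist_eq_norm, dist_eq_norm] at this
    exact pow_le_pow_left₀ (norm_nonneg _) this 2
  have hψ : HasStrictFDerivAt (fun y : E => ‖y - x‖ ^ 2) (2 • innerSL ℝ (p - x)) p := by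
    have := (hasStrictFDerivAt_norm_sq (p - x)).comp p ((hasStrictFDerivAt_id p).sub_const x)
    exact this
  obtain ⟨a, b, hab, hsum⟩ := hextr.exists_multipliers_of_hasStrictFDerivAt_1d
    (hφ.hasStrictFDerivAt (by norm_num)) hψ
  have hall : ∀ v, inner ℝ (a • gradient φ p + (2 * b) • (p - x)) v = 0 := fun v => by
    have := congrArg (fun l : E →L[ℝ] ℝ => l v) hsum
    simp only [add_apply, smul_apply, smul_eq_mul, innerSL_apply_apply,
      zero_apply, nsmul_eq_mul] at this
    rw [inner_add_left, real_inner_smul_left, real_inner_smul_left, inner_gradient]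
    push_cast at this
    linarith
  have hzero : a • gradient φ p + (2 * b) • (p - x) = 0 := by
    have := hall (a • gradient φ p + (2 * b) • (p - x))
    exact inner_self_eq_zero.1 this
  have hb : b ≠ 0 := by
    rintro rfl
    simp only [mul_zero, zero_smul, add_zero, smul_eq_zero, hg, or_false] at hzero
    exact hab (by simp [hzero])
  have hn : ‖gradient φ p‖ ≠ 0 := norm_ne_zero_iff.2 hg
  refine ⟨a / (2 * b) * ‖gradient φ p‖, ?_⟩
  rw [unitGradient, smul_smul, mul_assoc, mul_inv_cancel₀ hn, mul_one, div_eq_inv_mul, mul_smul]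
  have : a • gradient φ p = (2 * b) • (x - p) := by
    rw [eq_neg_of_add_eq_zero_left hzero, ← smul_neg, neg_sub]
  rw [this, smul_smul, inv_mul_cancel₀ (by simpa using hb), one_smul, add_sub_cancel]

end LevelSet

/-- A compact `C²` interface satisfies `IsLocalInterface` near each of its points. -/
lemma IsC2Interface.exists_isLocalInterface {ν : ℕ} {S A B : Set (Space ν)}
    {n : Space ν → Space ν} (hS : IsCompact S) (hI : IsC2Interface S A B n) {p₀ : Space ν}
    (hp₀ : p₀ ∈ S) : ∃ C r, IsLocalInterface S A B n p₀ C r := by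
  obtain ⟨φ, hφ, hφ0, -, hsides⟩ := hI p₀ hp₀
  obtain ⟨L, g, R, hR, hbounds⟩ := exists_gradientBounds hφ hφ0
  obtain ⟨R', hR', hsidesR⟩ := Metric.eventually_nhds_iff_ball.1 hsides
  set R₁ := min R R' with hR₁
  have hR₁pos : 0 < R₁ := lt_min hR hR'
  have h := hbounds R₁ hR₁pos (min_le_left _ _)
  replace hsidesR : ∀ x ∈ Metric.ball p₀ R₁, (x ∈ S ↔ φ x = 0) ∧ (x ∈ A ↔ φ x < 0) ∧
      (x ∈ B ↔ 0 < φ x) := fun x hx =>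
    hsidesR x (Metric.ball_subset_ball (min_le_right _ _) hx)
  have hLpos := h.L_pos
  have hgpos := h.g_pos
  -- the normal is the unit gradient of the defining function chosen at `p₀`
  have hn : ∀ p ∈ S ∩ Metric.ball p₀ R₁, n p = unitGradient φ p := by
    rintro p ⟨hpS, hpB⟩
    obtain ⟨ψ, hψ, hψ0, hnp, hψs⟩ := hI p hpS
    rw [hnp]
    have hu : ‖unitGradient ψ p‖ = 1 := by
      rw [unitGradient, norm_smul, norm_inv, norm_norm, inv_mul_cancel₀ (norm_ne_zero_iff.2 hψ0)]
    refine unitGradient_eq_of_sides (A := A) (B := B) (hψ.differentiableAt (by norm_num))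
      ((h.contDiffAt p hpB).differentiableAt (by norm_num)) (hψs.self_of_nhds.1.1 hpS)
      ((hsidesR p hpB).1.1 hpS) hu (h.norm_unit p hpB) (hψs.mono fun x hx => hx.2) ?_
    filter_upwards [Metric.isOpen_ball.mem_nhds hpB] with x hx using (hsidesR x hx).2
  set C := 2 * L / g with hC
  have hCpos : 0 < C := by positivity
  have hLC : L / g ≤ C := by rw [hC]; gcongr; linarith
  set r := min (R₁ / 4) (min 1 (R₁ / 4 / (C + 1))) with hr
  have hrpos : 0 < r := by positivity
  have hrR : r ≤ R₁ / 4 := min_le_left _ _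
  have hrC : C * r ^ 2 ≤ R₁ / 4 := by
    have h1 : r ≤ 1 := (min_le_right _ _).trans (min_le_left _ _)
    have h2 : r ≤ R₁ / 4 / (C + 1) := (min_le_right _ _).trans (min_le_right _ _)
    rw [le_div_iff₀ (by positivity)] at h2
    nlinarith
  have hsub : Metric.ball p₀ r ⊆ Metric.ball p₀ R₁ := Metric.ball_subset_ball (by linarith)
  refine ⟨C, r, hCpos, hrpos, ?_, ?_, ?_, ?_, ?_⟩
  · rintro p ⟨hpS, hpB⟩
    rw [hn p ⟨hpS, hsub hpB⟩, h.norm_unit p (hsub hpB)]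
  · rintro p ⟨hpS, hpB⟩ q ⟨hqS, hqB⟩
    have h1 := h.taylor (hsub hpB) (hsub hqB)
    rw [(hsidesR p (hsub hpB)).1.1 hpS, (hsidesR q (hsub hqB)).1.1 hqS, sub_zero, zero_sub,
      abs_neg] at h1
    have h2 := h.le_norm (hsub hpB)
    rw [hn p ⟨hpS, hsub hpB⟩, unitGradient, real_inner_smul_left, abs_mul, abs_inv, abs_norm]
    calc ‖gradient φ p‖⁻¹ * |inner ℝ (gradient φ p) (q - p)|
        ≤ g⁻¹ * (L * ‖q - p‖ ^ 2) := by gcongr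
      _ = L / g * ‖q - p‖ ^ 2 := by ring
      _ ≤ C * ‖q - p‖ ^ 2 := by gcongr
  · rintro p ⟨hpS, hpB⟩ q ⟨hqS, hqB⟩
    rw [hn p ⟨hpS, hsub hpB⟩, hn q ⟨hqS, hsub hqB⟩]
    have h1 := norm_gradKernel_sub_le 0 hgpos (h.le_norm (hsub hpB)) (h.le_norm (hsub hqB))
    simp only [gradKernel, zero_add, pow_one, Nat.cast_zero] at h1
    refine h1.trans ?_
    calc 2 * ‖gradient φ p - gradient φ q‖ * g⁻¹ ≤ 2 * (L * ‖p - q‖) * g⁻¹ := by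
          gcongr
          exact h.lipschitz p (hsub hpB) q (hsub hqB)
      _ = C * ‖p - q‖ := by rw [hC]; ring
  · rintro p ⟨hpS, hpB⟩ z hz hzr
    rw [hn p ⟨hpS, hsub hpB⟩] at hz ⊢
    set u := unitGradient φ p
    have hu : ‖u‖ = 1 := h.norm_unit p (hsub hpB)
    have hin : ∀ s : ℝ, |s| ≤ C * ‖z‖ ^ 2 → p + z + s • u ∈ Metric.ball p₀ R₁ := by
      intro s hs
      have h1 : C * ‖z‖ ^ 2 ≤ C * r ^ 2 := by gcongr
      rw [Metric.mem_ball, dist_eq_norm] at hpB ⊢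
      calc ‖p + z + s • u - p₀‖ = ‖(p - p₀) + z + s • u‖ := by congr 1; abel
        _ ≤ ‖p - p₀‖ + ‖z‖ + ‖s • u‖ := norm_add₃_le
        _ < R₁ := by
          rw [norm_smul, hu, mul_one, Real.norm_eq_abs]
          linarith
    have hz0 : p + z ∈ Metric.ball p₀ R₁ := by
      simpa using hin 0 (by rw [abs_zero]; positivity)
    have hgz : inner ℝ (gradient φ p) z = 0 := by
      have : ‖gradient φ p‖ ≠ 0 := (hgpos.trans_le (h.le_norm (hsub hpB))).ne'
      have h1 : inner ℝ u z = ‖gradient φ p‖⁻¹ * inner ℝ (gradient φ p) z := real_inner_smul_left ..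
      rw [h1] at hz
      simpa [this] using hz
    have hφz : |φ (p + z)| ≤ L * ‖z‖ ^ 2 := by
      have := h.taylor (hsub hpB) hz0
      rwa [add_sub_cancel_left, hgz, (hsidesR p (hsub hpB)).1.1 hpS, sub_zero, sub_zero] at this
    set H := C * ‖z‖ ^ 2 with hH
    have hH0 : 0 ≤ H := by positivity
    have hgH : L * ‖z‖ ^ 2 ≤ g * H := by
      rw [hH, hC]; field_simp; nlinarith [sq_nonneg ‖z‖, hLpos]
    have hplus : 0 ≤ φ (p + z + H • u) := by
      have := h.le_sub (hsub hpB) hz0 hH0 (hin H (by rw [abs_of_nonneg hH0]))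
      linarith [(abs_le.1 hφz).1]
    have hminus : φ (p + z + (-H) • u) ≤ 0 := by
      have hx := hin (-H) (by rw [abs_neg, abs_of_nonneg hH0])
      have := h.le_sub (x := p + z + (-H) • u) (hsub hpB) hx hH0
        (by rw [neg_smul, neg_add_cancel_right]; exact hz0)
      rw [neg_smul, neg_add_cancel_right, ← neg_smul] at this
      linarith [(abs_le.1 hφz).2]
    have hcont : ContinuousOn (fun s : ℝ => φ (p + z + s • u)) (Set.Icc (-H) H) := fun s hs => by
      have h1 := (h.contDiffAt _ (hin s (abs_le.2 hs))).continuousAt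
      exact (ContinuousAt.comp (f := fun s : ℝ => p + z + s • u) h1
        (Continuous.continuousAt (by fun_prop))).continuousWithinAt
    obtain ⟨s, hs, hs0⟩ := intermediate_value_Icc (by linarith) hcont ⟨hminus, hplus⟩
    exact ⟨s, abs_le.2 hs, (hsidesR _ (hin s (abs_le.2 hs))).1.2 hs0⟩
  · intro x hx
    obtain ⟨p, hpS, hpx⟩ := hS.exists_infDist_eq_dist ⟨p₀, hp₀⟩ x
    have hxp : dist x p ≤ dist x p₀ := hpx ▸ Metric.infDist_le_dist_of_mem hp₀
    have hpR : p ∈ Metric.ball p₀ R₁ := by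
      have := dist_triangle_left p p₀ x
      rw [Metric.mem_ball] at hx ⊢
      linarith
    have hφp : φ p = 0 := (hsidesR p hpR).1.1 hpS
    obtain ⟨t, ht⟩ := exists_eq_add_smul_of_isMinOn (x := x) (h.contDiffAt p hpR)
      (norm_pos_iff.1 (hgpos.trans_le (h.le_norm hpR))) (by
        filter_upwards [Metric.isOpen_ball.mem_nhds hpR] with y hy hyp
        rw [hφp] at hyp
        exact hpx ▸ Metric.infDist_le_dist_of_mem ((hsidesR y hy).1.2 hyp))
    have hxR := hsub hx
    refine ⟨p, hpS, t, by rw [hn p ⟨hpS, hpR⟩]; exact ht, ?_,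
      by linarith [dist_triangle_left p p₀ x], fun hxA => ?_, fun hxB => ?_⟩
    · rw [ht, dist_self_add_left, norm_smul, h.norm_unit p hpR, mul_one, Real.norm_eq_abs] at hxp
      rwa [← ht] at hxp
    · by_contra hcon
      have := h.le_sub hpR hpR (not_lt.1 hcon) (ht ▸ hxR)
      rw [← ht, hφp] at this
      have h2 := (hsidesR x hxR).2.1.1 hxA
      nlinarith [not_lt.1 hcon]
    · by_contra hcon
      have ht0 : 0 ≤ -t := by linarith
      have hpx : x + (-t) • unitGradient φ p = p := by rw [ht]; simp
      have := h.le_sub (x := x) hpR hxR ht0 (by rw [hpx]; exact hpR)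
      rw [hpx, hφp] at this
      have h2 := (hsidesR x hxR).2.2.1 hxB
      nlinarith

/-! ### Surface measure in tangential coordinates -/

section SurfaceMeasure

set_option linter.unusedSectionVars false

variable {d : ℕ}

/-- Orthonormal coordinates on the hyperplane orthogonal to a unit vector `u`: `coord` is the
orthogonal projection to the hyperplane followed by the coordinates, `lift` is the inclusion. -/
structure TangentFrame (u : Space (d + 1)) where
  coord : Space (d + 1) →L[ℝ] Space d
  lift : Space d →ₗᵢ[ℝ] Space (d + 1)
  coord_lift : ∀ z, coord (lift z) = z
  coord_normal : coord u = 0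
  inner_lift : ∀ z, inner ℝ u (lift z) = 0
  lift_coord : ∀ v, v = lift (coord v) + (inner ℝ u v : ℝ) • u

lemma nonempty_tangentFrame {u : Space (d + 1)} (hu : ‖u‖ = 1) : Nonempty (TangentFrame u) := by
  have hu0 : u ≠ 0 := by rintro rfl; simp at hu
  have : Fact (Module.finrank ℝ (Space (d + 1)) = d + 1) := ⟨by simp⟩
  let b := OrthonormalBasis.fromOrthogonalSpanSingleton (𝕜 := ℝ) d hu0
  let K : Submodule ℝ (Space (d + 1)) := (ℝ ∙ u)ᗮ
  refine ⟨⟨(b.repr.toContinuousLinearEquiv : K →L[ℝ] Space d) ∘L K.orthogonalProjectionOnto,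
    K.subtypeₗᵢ.comp b.repr.symm.toLinearIsometry, fun z => ?_, ?_, fun z => ?_, fun v => ?_⟩⟩
  · simp
  · simp [K]
  · exact (b.repr.symm z).2 u (Submodule.mem_span_singleton_self u)
  · have h1 : (K.orthogonalProjectionOnto v : Space (d + 1)) = v - (inner ℝ u v : ℝ) • u := by
      rw [← Submodule.starProjection_unit_singleton ℝ hu]
      exact Submodule.starProjection_orthogonal_val v
    simp [h1]

namespace TangentFrame

variable {u : Space (d + 1)} (T : TangentFrame u)

lemma norm_sq_eq (hu : ‖u‖ = 1) (v : Space (d + 1)) :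
    ‖v‖ ^ 2 = ‖T.coord v‖ ^ 2 + inner ℝ u v ^ 2 := by
  conv_lhs => rw [T.lift_coord v]
  rw [norm_add_sq_real, real_inner_smul_right, real_inner_comm u (T.lift _), T.inner_lift,
    norm_smul, hu, T.lift.norm_map, Real.norm_eq_abs, mul_one, sq_abs]
  ring

lemma norm_coord_le (hu : ‖u‖ = 1) (v : Space (d + 1)) : ‖T.coord v‖ ≤ ‖v‖ := by
  have := T.norm_sq_eq hu v
  refine (sq_le_sq₀ (norm_nonneg _) (norm_nonneg _)).1 ?_
  nlinarith [sq_nonneg (inner ℝ u v)]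

lemma norm_le_add (hu : ‖u‖ = 1) (v : Space (d + 1)) :
    ‖v‖ ≤ ‖T.coord v‖ + |inner ℝ u v| := by
  conv_lhs => rw [T.lift_coord v]
  refine (norm_add_le _ _).trans ?_
  rw [norm_smul, hu, T.lift.norm_map, Real.norm_eq_abs, mul_one]

end TangentFrame

lemma euclideanHausdorffMeasure_image_le {X Y : Type*} [EMetricSpace X] [MeasurableSpace X]
    [BorelSpace X] [EMetricSpace Y] [MeasurableSpace Y] [BorelSpace Y] {f : X → Y} {K : NNReal}
    {s : Set X} (hf : LipschitzOnWith K f s) (d : ℕ) :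
    μHE[d] (f '' s) ≤ (K : ENNReal) ^ d * μHE[d] s := by
  simp only [Measure.euclideanHausdorffMeasure_def, Measure.smul_apply]
  have := hf.hausdorffMeasure_image_le (d := d) (by positivity)
  rw [ENNReal.rpow_natCast] at this
  rw [ENNReal.smul_def, smul_eq_mul, ENNReal.smul_def, smul_eq_mul, mul_left_comm]
  gcongr

/-- The part of `S` above the tangential disk of radius `δ` at `p`. -/
def patch (S : Set (Space (d + 1))) {u : Space (d + 1)} (T : TangentFrame u) (p : Space (d + 1))
    (δ : ℝ) : Set (Space (d + 1)) :=
  {y | y ∈ S ∧ dist y p < 4 * δ ∧ ‖T.coord (y - p)‖ < δ}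

section Patch

variable {S A B : Set (Space (d + 1))} {n : Space (d + 1) → Space (d + 1)}
  {p₀ p : Space (d + 1)} {C r δ : ℝ}

/-- The smallness conditions under which the patch of size `δ` around `p` is a graph with small
slope. -/
structure IsPatchScale (S : Set (Space (d + 1))) (p₀ : Space (d + 1)) (C r : ℝ)
    (p : Space (d + 1)) (δ : ℝ) : Prop where
  mem : p ∈ S
  dist_le : dist p p₀ ≤ r / 4
  pos : 0 < δ
  le : 8 * δ ≤ r
  slope : 24 * C * δ ≤ 1

lemma measurableSet_patch {u : Space (d + 1)} (T : TangentFrame u) (hS : MeasurableSet S) :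
    MeasurableSet (patch S T p δ) := by
  have h1 : IsOpen {y : Space (d + 1) | dist y p < 4 * δ} :=
    isOpen_lt (by fun_prop) continuous_const
  have h2 : IsOpen {y : Space (d + 1) | ‖T.coord (y - p)‖ < δ} :=
    isOpen_lt (by fun_prop) continuous_const
  exact hS.inter (h1.measurableSet.inter h2.measurableSet)

lemma volume_ball_eq {ρ : ℝ} (hρ : 0 < ρ) : volume (Metric.ball (0 : Space d) ρ) =
    ENNReal.ofReal (ρ ^ d * (volume (Metric.ball (0 : Space d) 1)).toReal) := by
  rw [Measure.addHaar_ball_of_pos _ _ hρ, finrank_euclideanSpace_fin,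
    ENNReal.ofReal_mul (by positivity), ENNReal.ofReal_toReal measure_ball_lt_top.ne]

namespace IsPatchScale

variable (hp : IsPatchScale S p₀ C r p δ) (h : IsLocalInterface S A B n p₀ C r)
  (T : TangentFrame (n p))

include hp

lemma mem_ball_of_dist_lt {y : Space (d + 1)} (hy : dist y p < 4 * δ) :
    y ∈ Metric.ball p₀ r := by
  have := dist_triangle y p p₀
  have h1 := hp.dist_le
  have h2 := hp.le
  have h3 := hp.pos
  rw [Metric.mem_ball]
  linarith

include h

lemma mem_inter : p ∈ S ∩ Metric.ball p₀ r :=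
  ⟨hp.mem, hp.mem_ball_of_dist_lt (by rw [dist_self]; linarith [hp.pos])⟩

lemma norm_normal : ‖n p‖ = 1 := h.norm_normal p (hp.mem_inter h)

/-- Over the tangent plane at `p`, the part of the surface at distance at most `s` from `p` is a
Lipschitz graph: chords are longer than their projections by a factor of at most `1 + O(s)`. -/
lemma norm_sub_le_of_dist_le {y y' : Space (d + 1)} {s : ℝ} (hy : y ∈ S) (hy' : y' ∈ S)
    (hs : dist y p ≤ s) (hs' : dist y' p ≤ s) (hd : dist y p < 4 * δ) (hd' : dist y' p < 4 * δ)
    (hsδ : s ≤ 4 * δ) :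
    ‖y - y'‖ ≤ (1 + 6 * C * s) * ‖T.coord (y - y')‖ := by
  have hC := h.C_pos
  have hs0 : 0 ≤ s := dist_nonneg.trans hs
  have h1 := T.norm_le_add (hp.norm_normal h) (y - y')
  have h2 := h.abs_inner_le y' ⟨hy', hp.mem_ball_of_dist_lt hd'⟩ y ⟨hy, hp.mem_ball_of_dist_lt hd⟩
  have h3 := h.normal_lipschitz p (hp.mem_inter h) y' ⟨hy', hp.mem_ball_of_dist_lt hd'⟩
  have h4 : inner ℝ (n p) (y - y') = inner ℝ (n p - n y') (y - y') + inner ℝ (n y') (y - y') := by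
    rw [inner_sub_left]; ring
  have h5 : |inner ℝ (n p - n y') (y - y')| ≤ C * s * ‖y - y'‖ := by
    refine (abs_real_inner_le_norm _ _).trans ?_
    gcongr
    refine h3.trans ?_
    gcongr
    rwa [← dist_eq_norm, dist_comm]
  have h6 : ‖y - y'‖ ≤ 2 * s := by
    rw [← dist_eq_norm]
    have := dist_triangle_right y y' p
    linarith
  have h7 : |inner ℝ (n p) (y - y')| ≤ 3 * C * s * ‖y - y'‖ := by
    rw [h4]
    refine (abs_add_le _ _).trans ?_
    have : C * ‖y - y'‖ ^ 2 ≤ C * (2 * s) * ‖y - y'‖ := by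
      rw [pow_two, ← mul_assoc]; gcongr
    linarith
  have hx : 6 * C * s ≤ 1 := by
    have := hp.slope
    nlinarith
  have hx0 : 0 ≤ C * s := by positivity
  have hN := norm_nonneg (y - y')
  have h8 : (1 - 3 * C * s) * ‖y - y'‖ ≤ ‖T.coord (y - y')‖ := by linarith
  calc ‖y - y'‖ ≤ (1 + 6 * C * s) * ((1 - 3 * C * s) * ‖y - y'‖) := by
        have : 1 ≤ (1 + 6 * C * s) * (1 - 3 * C * s) := by nlinarith
        rw [← mul_assoc]
        exact le_mul_of_one_le_left hN this
    _ ≤ _ := by gcongr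

lemma dist_le_two_mul {y : Space (d + 1)} (hy : y ∈ patch S T p δ) :
    dist y p ≤ 2 * ‖T.coord (y - p)‖ := by
  obtain ⟨hyS, hyd, -⟩ := hy
  have hpd : dist p p < 4 * δ := by rw [dist_self]; linarith [hp.pos]
  have h1 := hp.norm_sub_le_of_dist_le h T hyS hp.mem hyd.le hpd.le hyd hpd le_rfl
  rw [dist_eq_norm]
  refine h1.trans ?_
  gcongr
  linarith [hp.slope]

/-- The patch covers the whole tangential disk. -/
lemma exists_mem_patch {z : Space d} (hz : ‖z‖ < δ) :
    ∃ y ∈ patch S T p δ, T.coord (y - p) = z := by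
  have hC := h.C_pos
  have hu := hp.norm_normal h
  obtain ⟨s, hs, hy⟩ := h.exists_height p (hp.mem_inter h) (T.lift z) (T.inner_lift z)
    (by rw [T.lift.norm_map]; linarith [hp.le, hp.pos])
  rw [T.lift.norm_map] at hs
  have hsub : p + T.lift z + s • n p - p = T.lift z + s • n p := by abel
  have hco : T.coord (p + T.lift z + s • n p - p) = z := by
    rw [hsub, map_add, map_smul, T.coord_normal, T.coord_lift, smul_zero, add_zero]
  refine ⟨_, ⟨hy, ?_, by rwa [hco]⟩, hco⟩
  rw [dist_eq_norm, hsub]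
  refine (norm_add_le _ _).trans_lt ?_
  rw [norm_smul, hu, mul_one, T.lift.norm_map, Real.norm_eq_abs]
  have hz0 := norm_nonneg z
  have hδ := hp.pos
  have h1 : C * ‖z‖ ^ 2 ≤ C * δ * δ := by
    rw [pow_two, ← mul_assoc]; gcongr
  nlinarith [hp.slope, hp.pos]

/-- The projection to the tangent plane does not increase area. -/
lemma volume_le {U : Set (Space d)} (hU : U ⊆ Metric.ball 0 δ) :
    volume U ≤ surfaceMeasure (d + 1) (patch S T p δ ∩ (fun y => T.coord (y - p)) ⁻¹' U) := by
  have hlip : LipschitzOnWith 1 (fun y => T.coord (y - p))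
      (patch S T p δ ∩ (fun y => T.coord (y - p)) ⁻¹' U) := by
    refine LipschitzOnWith.of_dist_le_mul fun y _ y' _ => ?_
    rw [dist_eq_norm, dist_eq_norm, ← map_sub, sub_sub_sub_cancel_right, NNReal.coe_one, one_mul]
    exact T.norm_coord_le (hp.norm_normal h) _
  have himg : U ⊆ (fun y => T.coord (y - p)) ''
      (patch S T p δ ∩ (fun y => T.coord (y - p)) ⁻¹' U) := by
    intro z hz
    obtain ⟨y, hy, hyz⟩ := hp.exists_mem_patch h T (by simpa using hU hz)
    exact ⟨y, ⟨hy, by rwa [Set.mem_preimage, hyz]⟩, hyz⟩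
  rw [← EuclideanSpace.euclideanHausdorffMeasure_eq_volume]
  refine (measure_mono himg).trans ((euclideanHausdorffMeasure_image_le hlip d).trans ?_)
  simp [surfaceMeasure]

/-- The inverse of the projection increases area by a factor close to `1`. -/
lemma surfaceMeasure_patch_le {ρ : ℝ} (hρ : 0 < ρ) (hρδ : ρ ≤ δ) :
    surfaceMeasure (d + 1) (patch S T p δ ∩ (fun y => T.coord (y - p)) ⁻¹' Metric.ball 0 ρ) ≤
      ENNReal.ofReal ((1 + 12 * C * ρ) ^ d) * volume (Metric.ball (0 : Space d) ρ) := by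
  have hC := h.C_pos
  have hex : ∀ z : Space d, ∃ y, ‖z‖ < δ → y ∈ patch S T p δ ∧ T.coord (y - p) = z := fun z => by
    by_cases hz : ‖z‖ < δ
    · obtain ⟨y, hy, hyz⟩ := hp.exists_mem_patch h T hz
      exact ⟨y, fun _ => ⟨hy, hyz⟩⟩
    · exact ⟨0, fun h => absurd h hz⟩
  choose G hG using hex
  have hlt : ∀ z ∈ Metric.ball (0 : Space d) ρ, ‖z‖ < δ := fun z hz =>
    (by simpa using hz : ‖z‖ < ρ).trans_le hρδ
  have hest : ∀ y ∈ patch S T p δ, ‖T.coord (y - p)‖ ≤ ρ → ∀ y' ∈ patch S T p δ,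
      ‖T.coord (y' - p)‖ ≤ ρ → ‖y - y'‖ ≤ (1 + 12 * C * ρ) * ‖T.coord (y - y')‖ := by
    intro y hy hyρ y' hy' hyρ'
    have h1 := hp.dist_le_two_mul h T hy
    have h2 := hp.dist_le_two_mul h T hy'
    have := hp.norm_sub_le_of_dist_le h T (s := 2 * ρ) hy.1 hy'.1 (by linarith) (by linarith)
      hy.2.1 hy'.2.1 (by linarith)
    refine this.trans_eq (by ring)
  have hlip : LipschitzOnWith (Real.toNNReal (1 + 12 * C * ρ)) G (Metric.ball 0 ρ) := by
    refine LipschitzOnWith.of_dist_le_mul fun z hz z' hz' => ?_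
    obtain ⟨h1, h2⟩ := hG z (hlt z hz)
    obtain ⟨h3, h4⟩ := hG z' (hlt z' hz')
    rw [Real.coe_toNNReal _ (by positivity), dist_eq_norm, dist_eq_norm]
    have := hest _ h1 (by rw [h2]; exact (by simpa using hz : ‖z‖ < ρ).le) _ h3
      (by rw [h4]; exact (by simpa using hz' : ‖z'‖ < ρ).le)
    rw [← sub_sub_sub_cancel_right _ _ p, map_sub, h2, h4] at this
    rwa [sub_sub_sub_cancel_right] at this
  have himg : patch S T p δ ∩ (fun y => T.coord (y - p)) ⁻¹' Metric.ball 0 ρ ⊆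
      G '' Metric.ball 0 ρ := by
    rintro y ⟨hy, hyρ⟩
    have hyρ : T.coord (y - p) ∈ Metric.ball (0 : Space d) ρ := hyρ
    refine ⟨_, hyρ, ?_⟩
    obtain ⟨h1, h2⟩ := hG _ (hlt _ hyρ)
    have hyn : ‖T.coord (y - p)‖ ≤ ρ := by simpa using (Metric.mem_ball.1 hyρ).le
    have := hest _ h1 (by rw [h2]; exact hyn) y hy hyn
    have h3 : T.coord (G (T.coord (y - p)) - y) = 0 := by
      rw [← sub_sub_sub_cancel_right _ _ p, map_sub T.coord (_ - p), h2, sub_self]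
    rw [h3, norm_zero, mul_zero] at this
    exact sub_eq_zero.1 (norm_le_zero_iff.1 this)
  rw [← EuclideanSpace.euclideanHausdorffMeasure_eq_volume]
  refine (measure_mono himg).trans ((euclideanHausdorffMeasure_image_le hlip d).trans_eq ?_)
  rw [ENNReal.ofReal_pow (by positivity)]
  rfl

lemma surfaceMeasure_patch_le' {ρ : ℝ} (hρ : 0 < ρ) (hρδ : ρ ≤ δ) :
    surfaceMeasure (d + 1) (patch S T p δ ∩ (fun y => T.coord (y - p)) ⁻¹' Metric.ball 0 ρ) ≤
      ENNReal.ofReal (2 ^ d * (volume (Metric.ball (0 : Space d) 1)).toReal * ρ ^ (d : ℝ)) := by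
  have hC := h.C_pos
  have hx : 12 * C * ρ ≤ 1 := by nlinarith [hp.slope]
  refine (hp.surfaceMeasure_patch_le h T hρ hρδ).trans ?_
  rw [volume_ball_eq hρ, ← ENNReal.ofReal_mul (by positivity), Real.rpow_natCast]
  refine ENNReal.ofReal_le_ofReal ?_
  rw [mul_comm (ρ ^ d), ← mul_assoc]
  gcongr
  linarith

lemma patch_subset_ball_inter {ρ : ℝ} (hρδ : ρ ≤ δ) :
    S ∩ Metric.ball p ρ ⊆ patch S T p δ ∩ (fun y => T.coord (y - p)) ⁻¹' Metric.ball 0 ρ := by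
  rintro y ⟨hyS, hy⟩
  have h1 : dist y p < ρ := hy
  have h2 := T.norm_coord_le (hp.norm_normal h) (y - p)
  rw [← dist_eq_norm] at h2
  refine ⟨⟨hyS, by linarith [hp.pos], by linarith⟩, ?_⟩
  rw [Set.mem_preimage, mem_ball_zero_iff]
  linarith

lemma surfaceMeasure_inter_ball_le {ρ : ℝ} (hρ : 0 < ρ) (hρδ : ρ ≤ δ) :
    surfaceMeasure (d + 1) (S ∩ Metric.ball p ρ) ≤
      ENNReal.ofReal (2 ^ d * (volume (Metric.ball (0 : Space d) 1)).toReal * ρ ^ (d : ℝ)) := by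
  obtain ⟨T⟩ := nonempty_tangentFrame (hp.norm_normal h)
  exact (measure_mono (hp.patch_subset_ball_inter h T hρδ)).trans
    (hp.surfaceMeasure_patch_le' h T hρ hρδ)

/-- Surface measure on the patch is `d`-dimensional at `p`. -/
lemma regularAt_patch (hS : MeasurableSet S) :
    RegularAt ((surfaceMeasure (d + 1)).restrict (patch S T p δ)) p
      (2 ^ d * (volume (Metric.ball (0 : Space d) 1)).toReal) d (4 * δ) := by
  refine ⟨fun ρ hρ _ => ?_, ?_⟩
  · rw [Measure.restrict_apply Metric.isOpen_ball.measurableSet]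
    rcases le_total ρ δ with hle | hle
    · refine (measure_mono fun y hy => ?_).trans (hp.surfaceMeasure_inter_ball_le h hρ hle)
      exact ⟨hy.2.1, hy.1⟩
    · refine (measure_mono fun y hy => ?_).trans
        ((hp.surfaceMeasure_patch_le' h T hp.pos le_rfl).trans (ENNReal.ofReal_le_ofReal ?_))
      · exact ⟨hy.2, by simpa using hy.2.2.2⟩
      · have := hp.pos
        gcongr
  · exact (ae_restrict_mem (measurableSet_patch T hS)).mono fun y hy => hy.2.1

/-- In tangential coordinates, surface measure is Lebesgue measure plus a measure which gives disks
of radius `ρ` a mass of order `ρ ^ (d + 1)`. -/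
lemma exists_map_eq_add (hS : MeasurableSet S) :
    ∃ τ : Measure (Space d), ((surfaceMeasure (d + 1)).restrict (patch S T p δ)).map
        (fun y => T.coord (y - p)) = volume.restrict (Metric.ball 0 δ) + τ ∧
      RegularAt τ 0 (12 * C * d * 2 ^ d * (volume (Metric.ball (0 : Space d) 1)).toReal)
        (d + 1) δ := by
  have hC := h.C_pos
  set κ := (volume (Metric.ball (0 : Space d) 1)).toReal with hκ
  have hQ : Measurable fun y => T.coord (y - p) := by fun_prop
  set σ' := ((surfaceMeasure (d + 1)).restrict (patch S T p δ)).map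
    (fun y => T.coord (y - p)) with hσ'
  have happ : ∀ U : Set (Space d), MeasurableSet U → σ' U =
      surfaceMeasure (d + 1) (patch S T p δ ∩ (fun y => T.coord (y - p)) ⁻¹' U) := fun U hU => by
    rw [hσ', Measure.map_apply hQ hU, Measure.restrict_apply (hQ hU), Set.inter_comm]
  have hfin : IsFiniteMeasure ((volume : Measure (Space d)).restrict (Metric.ball 0 δ)) :=
    ⟨by rw [Measure.restrict_apply_univ]; exact measure_ball_lt_top⟩
  have hle : (volume : Measure (Space d)).restrict (Metric.ball 0 δ) ≤ σ' := by
    refine Measure.le_iff.2 fun U hU => ?_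
    rw [Measure.restrict_apply hU, happ U hU]
    refine (hp.volume_le h T Set.inter_subset_right).trans (measure_mono ?_)
    gcongr
    exact Set.inter_subset_left
  refine ⟨σ' - volume.restrict (Metric.ball 0 δ), ?_, ?_, ?_⟩
  · rw [add_comm, Measure.sub_add_cancel_of_le hle]
  · intro ρ hρ hρδ
    have hx : 12 * C * ρ ≤ 1 := by nlinarith [hp.slope]
    rw [Measure.sub_apply Metric.isOpen_ball.measurableSet hle,
      happ _ Metric.isOpen_ball.measurableSet, Measure.restrict_apply
        Metric.isOpen_ball.measurableSet, Set.inter_eq_left.2 (Metric.ball_subset_ball hρδ)]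
    refine (tsub_le_tsub_right (hp.surfaceMeasure_patch_le h T hρ hρδ) _).trans ?_
    rw [volume_ball_eq hρ, ← ENNReal.ofReal_mul (by positivity), ← hκ,
      ← ENNReal.ofReal_sub _ (by positivity)]
    refine ENNReal.ofReal_le_ofReal ?_
    have hpow : (1 + 12 * C * ρ) ^ d - 1 ≤ 12 * C * ρ * d * 2 ^ d := by
      have h1 := abs_pow_sub_pow_le (1 + 12 * C * ρ) 1 d
      have h0 : 0 ≤ 12 * C * ρ := by positivity
      rw [one_pow, abs_one, add_sub_cancel_left, abs_of_nonneg h0,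
        abs_of_nonneg (by linarith : 0 ≤ 1 + 12 * C * ρ), max_eq_left (by linarith)] at h1
      refine (le_abs_self _).trans (h1.trans ?_)
      gcongr
      calc (1 + 12 * C * ρ) ^ (d - 1) ≤ 2 ^ (d - 1) := by gcongr; linarith
        _ ≤ 2 ^ d := pow_le_pow_right₀ (by norm_num) (Nat.sub_le _ _)
    have hr : ρ ^ ((d : ℝ) + 1) = ρ ^ d * ρ := by
      rw [Real.rpow_add_one hρ.ne', Real.rpow_natCast]
    rw [hr]
    have hκ0 : 0 ≤ κ := ENNReal.toReal_nonneg
    calc (1 + 12 * C * ρ) ^ d * (ρ ^ d * κ) - ρ ^ d * κ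
        = ((1 + 12 * C * ρ) ^ d - 1) * (ρ ^ d * κ) := by ring
      _ ≤ 12 * C * ρ * d * 2 ^ d * (ρ ^ d * κ) := by gcongr
      _ = _ := by ring
  · refine Measure.absolutelyContinuous_of_le Measure.sub_le ?_
    rw [hσ']
    refine (ae_map_iff hQ.aemeasurable Metric.isOpen_ball.measurableSet).2 ?_
    exact (ae_restrict_mem (measurableSet_patch T hS)).mono fun y hy => by simpa using hy.2.2

end IsPatchScale

lemma IsLocalInterface.exists_patchScale (h : IsLocalInterface S A B n p₀ C r) :
    ∃ δ₀ > 0, ∀ p ∈ S, dist p p₀ ≤ r / 4 → ∀ δ, 0 < δ → δ ≤ δ₀ → IsPatchScale S p₀ C r p δ := by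
  have hC := h.C_pos
  have hr := h.r_pos
  refine ⟨min (r / 8) (1 / (24 * C)), by positivity, fun p hp hpd δ hδ hle =>
    ⟨hp, hpd, hδ, ?_, ?_⟩⟩
  · linarith [hle.trans (min_le_left _ _)]
  · have := hle.trans (min_le_right _ _)
    rw [le_div_iff₀ (by positivity)] at this
    linarith

/-- Upper Ahlfors regularity, also for centers which are not on the surface. -/
lemma IsLocalInterface.exists_measure_inter_ball_le (h : IsLocalInterface S A B n p₀ C r) :
    ∃ c R, 0 ≤ c ∧ 0 < R ∧ ∀ x, dist x p₀ ≤ R → ∀ ρ, 0 < ρ → ρ ≤ R →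
      surfaceMeasure (d + 1) (S ∩ Metric.ball x ρ) ≤ ENNReal.ofReal (c * ρ ^ (d : ℝ)) := by
  obtain ⟨δ₀, hδ₀, hscale⟩ := h.exists_patchScale
  have hr := h.r_pos
  refine ⟨2 ^ d * (volume (Metric.ball (0 : Space d) 1)).toReal * 2 ^ (d : ℝ),
    min (r / 8) (δ₀ / 2), by positivity, by positivity, fun x hx ρ hρ hρR => ?_⟩
  have hx := hx.trans (min_le_left _ _)
  have h1 := hρR.trans (min_le_left _ _)
  have h2 := hρR.trans (min_le_right _ _)
  rcases (S ∩ Metric.ball x ρ).eq_empty_or_nonempty with hem | ⟨q, hqS, hq⟩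
  · simp [hem]
  have hq : dist q x < ρ := hq
  have hqd : dist q p₀ ≤ r / 4 := by linarith [dist_triangle q x p₀]
  have hs := hscale q hqS hqd (2 * ρ) (by positivity) (by linarith)
  refine (measure_mono fun y hy => ?_).trans
    ((hs.surfaceMeasure_inter_ball_le h (by positivity) le_rfl).trans_eq ?_)
  · refine ⟨hy.1, ?_⟩
    have : dist y x < ρ := hy.2
    rw [Metric.mem_ball]
    linarith [dist_triangle_right y q x]
  · rw [Real.mul_rpow (by norm_num) hρ.le]
    congr 1
    ring

end Patch

lemma IsC2Interface.surfaceMeasure_lt_top {S A B : Set (Space (d + 1))}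
    {n : Space (d + 1) → Space (d + 1)} (hS : IsCompact S) (hI : IsC2Interface S A B n) :
    surfaceMeasure (d + 1) S < ⊤ := by
  refine hS.measure_lt_top_of_nhdsWithin fun x hx => ?_
  obtain ⟨C, r, h⟩ := hI.exists_isLocalInterface hS hx
  obtain ⟨c, R, -, hR, hb⟩ := h.exists_measure_inter_ball_le
  refine ⟨S ∩ Metric.ball x R, inter_mem self_mem_nhdsWithin
    (mem_nhdsWithin_of_mem_nhds (Metric.ball_mem_nhds x hR)), ?_⟩
  exact (hb x (by simpa using hR.le) R hR le_rfl).trans_lt ENNReal.ofReal_lt_top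

end SurfaceMeasure

/-! ### The flux through a flat disk -/

section Flat

variable {d : ℕ}

/-- The flux of `gradKernel d` from a point at signed height `t` through the disk of radius `δ`. -/
def diskFlux (d : ℕ) (t δ : ℝ) : ℝ :=
  ∫ z in Metric.ball (0 : Space d) δ, t * (√(t ^ 2 + ‖z‖ ^ 2) ^ (d + 1))⁻¹

lemma diskFlux_neg (d : ℕ) (t δ : ℝ) : diskFlux d (-t) δ = -diskFlux d t δ := by
  simp [diskFlux, ← integral_neg]

lemma norm_smul_sub_lift {u : Space (d + 1)} (hu : ‖u‖ = 1) (T : TangentFrame u) (t : ℝ)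
    (z : Space d) : ‖t • u - T.lift z‖ = √(t ^ 2 + ‖z‖ ^ 2) := by
  rw [eq_comm, Real.sqrt_eq_iff_mul_self_eq (by positivity) (norm_nonneg _), ← pow_two,
    norm_sub_sq_real, real_inner_smul_left, T.inner_lift, norm_smul, hu, T.lift.norm_map,
    Real.norm_eq_abs, mul_one, sq_abs]
  ring

lemma continuous_sqrt_pow_inv {t : ℝ} (ht : t ≠ 0) :
    Continuous fun z : Space d => (√(t ^ 2 + ‖z‖ ^ 2) ^ (d + 1))⁻¹ := by
  refine Continuous.inv₀ (by fun_prop) fun z => ?_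
  have : 0 < t ^ 2 + ‖z‖ ^ 2 := by positivity
  positivity

/-- By symmetry, the field of a flat disk on its axis is normal to the disk. -/
lemma integral_disk_gradKernel {u : Space (d + 1)} (hu : ‖u‖ = 1) (T : TangentFrame u) {t : ℝ}
    (ht : t ≠ 0) (δ : ℝ) (v : Space (d + 1)) :
    ∫ z in Metric.ball (0 : Space d) δ, inner ℝ v (gradKernel d (t • u - T.lift z)) =
      diskFlux d t δ * inner ℝ v u := by
  have hc := continuous_sqrt_pow_inv (d := d) ht
  have hint : ∀ f : Space d → ℝ, Continuous f → IntegrableOn f (Metric.ball 0 δ) := fun f hf =>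
    (hf.continuousOn.integrableOn_compact (isCompact_closedBall 0 δ)).mono_set
      Metric.ball_subset_closedBall
  have hodd : ∫ z in Metric.ball (0 : Space d) δ,
      (√(t ^ 2 + ‖z‖ ^ 2) ^ (d + 1))⁻¹ * inner ℝ v (T.lift z) = 0 := by
    set f : Space d → ℝ := fun z => (√(t ^ 2 + ‖z‖ ^ 2) ^ (d + 1))⁻¹ * inner ℝ v (T.lift z) with hf
    have h1 := (Measure.measurePreserving_neg (volume : Measure (Space d))).setIntegral_preimage_emb
      (MeasurableEquiv.neg _).measurableEmbedding f (Metric.ball 0 δ)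
    have h2 : (Neg.neg ⁻¹' Metric.ball (0 : Space d) δ) = Metric.ball 0 δ := by
      ext z; simp
    have h3 : ∀ z, f (-z) = - f z := fun z => by simp [hf]
    simp only [h2, h3, integral_neg] at h1
    linarith
  have heq : ∀ z, inner ℝ v (gradKernel d (t • u - T.lift z)) =
      t * (√(t ^ 2 + ‖z‖ ^ 2) ^ (d + 1))⁻¹ * inner ℝ v u -
        (√(t ^ 2 + ‖z‖ ^ 2) ^ (d + 1))⁻¹ * inner ℝ v (T.lift z) := fun z => by
    rw [gradKernel, norm_smul_sub_lift hu, inner_smul_right, inner_sub_right, inner_smul_right]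
    ring
  simp only [heq]
  rw [integral_sub (hint _ (by fun_prop)) (hint _ (by fun_prop)), hodd, sub_zero,
    integral_mul_const, diskFlux]

/-- The flux in polar coordinates. -/
lemma diskFlux_eq [Nontrivial (Space d)] (t : ℝ) {δ : ℝ} (hδ : 0 < δ) :
    diskFlux d t δ = d * (volume (Metric.ball (0 : Space d) 1)).toReal *
      ∫ y in (0 : ℝ)..δ, y ^ (d - 1) * (t * (√(t ^ 2 + y ^ 2) ^ (d + 1))⁻¹) := by
  have h := integral_fun_norm_addHaar (volume : Measure (Space d))
    ((Set.Iio δ).indicator fun y => t * (√(t ^ 2 + y ^ 2) ^ (d + 1))⁻¹)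
  have h1 : ∀ z : Space d, (Set.Iio δ).indicator (fun y => t * (√(t ^ 2 + y ^ 2) ^ (d + 1))⁻¹) ‖z‖ =
      (Metric.ball (0 : Space d) δ).indicator
        (fun z => t * (√(t ^ 2 + ‖z‖ ^ 2) ^ (d + 1))⁻¹) z := fun z => by
    by_cases hz : ‖z‖ < δ <;> simp [Set.indicator, hz]
  simp only [h1] at h
  rw [integral_indicator Metric.isOpen_ball.measurableSet] at h
  rw [diskFlux, h, finrank_euclideanSpace_fin, intervalIntegral.integral_of_le hδ.le,
    integral_Ioc_eq_integral_Ioo, nsmul_eq_mul, smul_eq_mul, Measure.real, mul_assoc]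
  congr 2
  have h2 : ∀ y : ℝ, y ^ (d - 1) • (Set.Iio δ).indicator
      (fun y => t * (√(t ^ 2 + y ^ 2) ^ (d + 1))⁻¹) y =
      (Set.Iio δ).indicator (fun y => y ^ (d - 1) * (t * (√(t ^ 2 + y ^ 2) ^ (d + 1))⁻¹)) y :=
    fun y => by by_cases hy : y < δ <;> simp [Set.indicator, hy]
  simp only [h2]
  rw [setIntegral_indicator measurableSet_Iio]
  rfl

lemma tendsto_diskFlux_one {δ : ℝ} (hδ : 0 < δ) :
    Tendsto (fun t => diskFlux 1 t δ) (𝓝[>] 0) (𝓝 Real.pi) := by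
  have hvol : (volume (Metric.ball (0 : Space 1) 1)).toReal = 2 := by
    have hπ : √Real.pi ≠ 0 := (Real.sqrt_pos.2 Real.pi_pos).ne'
    have hg : √Real.pi / Real.Gamma (1 / 2 + 1) = 2 := by
      rw [Real.Gamma_add_one (by norm_num), Real.Gamma_one_half_eq]
      field_simp
    rw [EuclideanSpace.volume_ball]
    simp only [Fintype.card_fin, pow_one, Nat.cast_one, hg]
    simp
  have heq : ∀ t : ℝ, 0 < t → 2 * Real.arctan (t⁻¹ * δ) = diskFlux 1 t δ := by
    intro t ht
    rw [diskFlux_eq t hδ, hvol]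
    have hder : ∀ y ∈ Set.uIcc 0 δ, HasDerivAt (fun y => Real.arctan (t⁻¹ * y))
        (y ^ (1 - 1) * (t * (√(t ^ 2 + y ^ 2) ^ (1 + 1))⁻¹)) y := fun y _ => by
      have h1 : HasDerivAt (fun y => t⁻¹ * y) t⁻¹ y := by
        simpa using (hasDerivAt_id y).const_mul t⁻¹
      refine h1.arctan.congr_deriv ?_
      rw [Real.sq_sqrt (by positivity)]
      simp
      field_simp
    rw [intervalIntegral.integral_eq_sub_of_hasDerivAt hder]
    · simp
    · refine Continuous.intervalIntegrable ?_ _ _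
      have : Continuous fun y : ℝ => (√(t ^ 2 + y ^ 2) ^ (1 + 1))⁻¹ := by
        refine Continuous.inv₀ (by fun_prop) fun z => ?_
        have : 0 < t ^ 2 + z ^ 2 := by positivity
        positivity
      fun_prop
  have hlim : Tendsto (fun t : ℝ => 2 * Real.arctan (t⁻¹ * δ)) (𝓝[>] 0) (𝓝 (2 * (Real.pi / 2))) :=
    (((Real.tendsto_arctan_atTop.mono_right nhdsWithin_le_nhds).comp
      (tendsto_inv_nhdsGT_zero.atTop_mul_const hδ))).const_mul 2
  rw [mul_div_cancel₀ _ (by norm_num)] at hlim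
  exact hlim.congr' (by filter_upwards [self_mem_nhdsWithin] with t ht using heq t ht)

lemma tendsto_diskFlux_two {δ : ℝ} (hδ : 0 < δ) :
    Tendsto (fun t => diskFlux 2 t δ) (𝓝[>] 0) (𝓝 (2 * Real.pi)) := by
  have hvol : (volume (Metric.ball (0 : Space 2) 1)).toReal = Real.pi := by
    rw [EuclideanSpace.volume_ball_fin_two]
    simp [Real.pi_nonneg]
  have heq : ∀ t : ℝ, 0 < t → 2 * Real.pi * (1 - t * (√(t ^ 2 + δ ^ 2))⁻¹) = diskFlux 2 t δ := by
    intro t ht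
    rw [diskFlux_eq t hδ, hvol]
    have hder : ∀ y ∈ Set.uIcc 0 δ, HasDerivAt (fun y => -(t * (√(t ^ 2 + y ^ 2))⁻¹))
        (y ^ (2 - 1) * (t * (√(t ^ 2 + y ^ 2) ^ (2 + 1))⁻¹)) y := fun y _ => by
      have h0 : 0 < t ^ 2 + y ^ 2 := by positivity
      have h1 : HasDerivAt (fun y => t ^ 2 + y ^ 2) (2 * y) y := by
        simpa using (hasDerivAt_pow 2 y).const_add (t ^ 2)
      refine (((h1.sqrt h0.ne').inv (by positivity)).const_mul t).neg.congr_deriv ?_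
      field_simp
      norm_num
      ring
    rw [intervalIntegral.integral_eq_sub_of_hasDerivAt hder]
    · simp [Real.sqrt_sq ht.le, mul_inv_cancel₀ ht.ne']
      ring
    · refine Continuous.intervalIntegrable ?_ _ _
      have : Continuous fun y : ℝ => (√(t ^ 2 + y ^ 2) ^ (2 + 1))⁻¹ := by
        refine Continuous.inv₀ (by fun_prop) fun z => ?_
        have : 0 < t ^ 2 + z ^ 2 := by positivity
        positivity
      fun_prop
  have hlim : Tendsto (fun t : ℝ => 2 * Real.pi * (1 - t * (√(t ^ 2 + δ ^ 2))⁻¹)) (𝓝 0)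
      (𝓝 (2 * Real.pi * (1 - 0 * (√(0 ^ 2 + δ ^ 2))⁻¹))) := by
    have : ContinuousAt (fun t : ℝ => (√(t ^ 2 + δ ^ 2))⁻¹) 0 :=
      ContinuousAt.inv₀ (by fun_prop) (by positivity)
    exact ContinuousAt.tendsto (by fun_prop)
  rw [zero_mul, sub_zero, mul_one] at hlim
  exact (hlim.mono_left nhdsWithin_le_nhds).congr'
    (by filter_upwards [self_mem_nhdsWithin] with t ht using heq t ht)

/-- The point sees the disk under half of the full solid angle in the limit. -/
lemma tendsto_diskFlux (hd : d = 1 ∨ d = 2) {δ : ℝ} (hδ : 0 < δ) :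
    Tendsto (fun t => diskFlux d t δ) (𝓝[>] 0) (𝓝 (d * Real.pi)) := by
  rcases hd with rfl | rfl
  · simpa using tendsto_diskFlux_one hδ
  · simpa using tendsto_diskFlux_two hδ

end Flat

/-! ### The jump of a surface field -/

section Jump

set_option linter.unusedSectionVars false

variable {d : ℕ} {S A B : Set (Space (d + 1))} {n q : Space (d + 1) → Space (d + 1)}
  {p₀ p : Space (d + 1)} {C r δ : ℝ}

lemma aestronglyMeasurable_inner_gradKernel {τ : Measure (Space (d + 1))}
    (hq : AEStronglyMeasurable q τ) (x : Space (d + 1)) :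
    AEStronglyMeasurable (fun y => (inner ℝ (q y) (gradKernel d (x - y)) : ℝ)) τ :=
  hq.inner ((measurable_gradKernel d).comp (by fun_prop)).aestronglyMeasurable

lemma mul_inv_pow_eq {e : ℝ} (he : 0 < e) (d : ℕ) :
    e * ((e / 2) ^ d)⁻¹ = 2 ^ d * e ^ (-((d : ℝ) - 1)) := by
  rw [neg_sub, Real.rpow_sub he, Real.rpow_one, Real.rpow_natCast, div_pow]
  field_simp

lemma sq_mul_inv_pow_eq {e : ℝ} (he : 0 < e) (d : ℕ) :
    e ^ 2 * ((e / 2) ^ (d + 1))⁻¹ = 2 ^ (d + 1) * e ^ (-((d : ℝ) - 1)) := by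
  rw [neg_sub, Real.rpow_sub he, Real.rpow_one, Real.rpow_natCast, div_pow]
  field_simp
  ring

/-- Near a foot point `p`, the field of the density `q` at `p + t n(p)` is that of a flat disk of
constant density `q(p)`, up to an error of the order of the size `δ` of the patch. -/
lemma IsLocalInterface.exists_patch_estimate (h : IsLocalInterface S A B n p₀ C r) (hd : 1 ≤ d)
    (hS : MeasurableSet S) :
    ∃ c, 0 ≤ c ∧ ∀ p δ, IsPatchScale S p₀ C r p δ → ∀ (T : TangentFrame (n p)) (t : ℝ), t ≠ 0 →
      ∀ (q : Space (d + 1) → Space (d + 1)) (L M : ℝ), 0 ≤ L → 0 ≤ M →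
      AEStronglyMeasurable q ((surfaceMeasure (d + 1)).restrict (patch S T p δ)) → ‖q p‖ ≤ M →
      (∀ y ∈ S, dist y p < 4 * δ → ‖q y - q p‖ ≤ L * dist y p) →
      IntegrableOn (fun y => (inner ℝ (q y) (gradKernel d (p + t • n p - y)) : ℝ))
        (patch S T p δ) (surfaceMeasure (d + 1)) ∧
      |∫ y in patch S T p δ, inner ℝ (q y) (gradKernel d (p + t • n p - y))
          ∂(surfaceMeasure (d + 1)) - diskFlux d t δ * inner ℝ (q p) (n p)| ≤ c * (L + M) * δ := by
  have hC := h.C_pos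
  have hd1 : (1 : ℝ) ≤ d := by exact_mod_cast hd
  set V := (volume (Metric.ball (0 : Space d) 1)).toReal with hV
  have hV0 : 0 ≤ V := ENNReal.toReal_nonneg
  set D₁ := dyadicConst (d : ℝ) ((d : ℝ) - 1) with hD₁
  have hD₁pos : 0 < D₁ := dyadicConst_pos (by linarith)
  set D₂ := dyadicConst ((d : ℝ) + 1) (d : ℝ) with hD₂
  have hD₂pos : 0 < D₂ := dyadicConst_pos (by linarith)
  set c₁ := 2 ^ d * (2 ^ d * V * D₁ * 4) with hc₁
  set c₂ := (d + 2) * C * 2 ^ (d + 1) * (2 ^ d * V * D₁ * 4) with hc₂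
  set c₃ := 12 * C * d * 2 ^ d * V * D₂ with hc₃
  have hc₁0 : 0 ≤ c₁ := by positivity
  have hc₂0 : 0 ≤ c₂ := by positivity
  have hc₃0 : 0 ≤ c₃ := by positivity
  refine ⟨c₁ + c₂ + c₃, by positivity, fun p δ hp T t ht q L M hL hM hqm hqp hlip => ?_⟩
  have hδ := hp.pos
  have hu := hp.norm_normal h
  set σ := (surfaceMeasure (d + 1)).restrict (patch S T p δ) with hσ
  have hmem : ∀ᵐ y ∂σ, y ∈ patch S T p δ := ae_restrict_mem (measurableSet_patch T hS)
  have hreg : RegularAt σ p (2 ^ d * V) d (4 * δ) := hp.regularAt_patch h T hS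
  have hpow : ∀ e : ℝ, e ^ ((d : ℝ) - ((d : ℝ) - 1)) = e := fun e => by
    rw [sub_sub_cancel, Real.rpow_one]
  have hpow' : ∀ e : ℝ, e ^ ((d : ℝ) + 1 - (d : ℝ)) = e := fun e => by
    rw [add_sub_cancel_left, Real.rpow_one]
  have hfin : IsFiniteMeasure σ := by
    refine ⟨?_⟩
    have h1 := hreg.ball_le (4 * δ) (by positivity) le_rfl
    have h2 : σ Set.univ = σ (Metric.ball p (4 * δ)) :=
      (measure_congr (eventuallyEq_univ.2 hreg.ae_mem)).symm
    rw [h2]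
    exact h1.trans_lt ENNReal.ofReal_lt_top
  have hcoord : ∀ y, T.coord (p + t • n p - y) = -T.coord (y - p) := fun y => by
    rw [← map_neg, neg_sub, add_sub_right_comm, map_add, map_smul, T.coord_normal, smul_zero,
      add_zero]
  have hlow : ∀ y, ‖T.coord (y - p)‖ ≤ ‖p + t • n p - y‖ := fun y => by
    have := T.norm_coord_le hu (p + t • n p - y)
    rwa [hcoord, norm_neg] at this
  -- replacing the density by its value at `p`
  set f₁ : Space (d + 1) → ℝ := fun y => inner ℝ (q y - q p) (gradKernel d (p + t • n p - y))
    with hf₁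
  have hb₁ : ∀ᵐ y ∂σ, dist y p ≠ 0 → ‖f₁ y‖ ≤ L * 2 ^ d * dist y p ^ (-((d : ℝ) - 1)) := by
    filter_upwards [hmem] with y hy hy0
    have he : 0 < dist y p := lt_of_le_of_ne dist_nonneg (Ne.symm hy0)
    have h2 : dist y p / 2 ≤ ‖p + t • n p - y‖ := by
      linarith [hp.dist_le_two_mul h T hy, hlow y]
    calc ‖f₁ y‖ ≤ ‖q y - q p‖ * ‖gradKernel d (p + t • n p - y)‖ := norm_inner_le_norm _ _
      _ ≤ (L * dist y p) * ((dist y p / 2) ^ d)⁻¹ := by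
        refine mul_le_mul (hlip y hy.1 hy.2.1) ((norm_gradKernel_le _ _).trans ?_)
          (norm_nonneg _) (by positivity)
        gcongr
      _ = _ := by rw [mul_assoc, mul_inv_pow_eq he]; ring
  have hm₁ : AEStronglyMeasurable f₁ σ :=
    aestronglyMeasurable_inner_gradKernel (hqm.sub aestronglyMeasurable_const) _
  have hi₁ : Integrable f₁ σ := hreg.integrable (by positivity) (by linarith) (by linarith)
    (by positivity) (by positivity) hm₁ hb₁
  have he₁ : ‖∫ y, f₁ y ∂σ‖ ≤ c₁ * L * δ := by
    refine (hreg.norm_integral_le (by positivity) (by linarith) (by linarith)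
      (by positivity) (by positivity) hb₁).trans_eq ?_
    rw [hpow, hc₁]; ring
  -- flattening the surface
  set f₂ : Space (d + 1) → ℝ := fun y => inner ℝ (q p)
    (gradKernel d (p + t • n p - y) - gradKernel d (t • n p - T.lift (T.coord (y - p)))) with hf₂
  have hb₂ : ∀ᵐ y ∂σ, dist y p ≠ 0 → ‖f₂ y‖ ≤
      M * ((d + 2) * C * 2 ^ (d + 1)) * dist y p ^ (-((d : ℝ) - 1)) := by
    filter_upwards [hmem] with y hy hy0
    have he : 0 < dist y p := lt_of_le_of_ne dist_nonneg (Ne.symm hy0)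
    have h2 : dist y p / 2 ≤ ‖T.coord (y - p)‖ := by linarith [hp.dist_le_two_mul h T hy]
    have h3 : ‖T.coord (y - p)‖ ≤ ‖t • n p - T.lift (T.coord (y - p))‖ := by
      have := T.norm_coord_le hu (t • n p - T.lift (T.coord (y - p)))
      rwa [map_sub, map_smul, T.coord_normal, T.coord_lift, smul_zero, zero_sub, norm_neg] at this
    have h4 : p + t • n p - y - (t • n p - T.lift (T.coord (y - p))) =
        -((inner ℝ (n p) (y - p) : ℝ) • n p) := by
      have := T.lift_coord (y - p)
      calc _ = -(y - p) + T.lift (T.coord (y - p)) := by abel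
        _ = -(T.lift (T.coord (y - p)) + (inner ℝ (n p) (y - p) : ℝ) • n p) +
            T.lift (T.coord (y - p)) := by rw [← this]
        _ = _ := by abel
    have h5 : ‖p + t • n p - y - (t • n p - T.lift (T.coord (y - p)))‖ ≤ C * dist y p ^ 2 := by
      rw [h4, norm_neg, norm_smul, hu, mul_one, dist_eq_norm]
      exact h.abs_inner_le p (hp.mem_inter h) y ⟨hy.1, hp.mem_ball_of_dist_lt hy.2.1⟩
    calc ‖f₂ y‖ ≤ ‖q p‖ * ‖gradKernel d (p + t • n p - y) -
          gradKernel d (t • n p - T.lift (T.coord (y - p)))‖ := norm_inner_le_norm _ _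
      _ ≤ M * ((d + 2) * (C * dist y p ^ 2) * ((dist y p / 2) ^ (d + 1))⁻¹) := by
        refine mul_le_mul hqp ((norm_gradKernel_sub_le d (by positivity : 0 < dist y p / 2)
          (h2.trans (hlow y)) (h2.trans h3)).trans ?_) (norm_nonneg _) hM
        gcongr
      _ = M * ((d + 2) * C * (dist y p ^ 2 * ((dist y p / 2) ^ (d + 1))⁻¹)) := by ring
      _ = _ := by rw [sq_mul_inv_pow_eq he]; ring
  have hm₂ : AEStronglyMeasurable f₂ σ :=
    (aestronglyMeasurable_const.inner (((measurable_gradKernel d).comp (by fun_prop)).sub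
      ((measurable_gradKernel d).comp
        (by have := T.lift.continuous; fun_prop))).aestronglyMeasurable)
  have hi₂ : Integrable f₂ σ := hreg.integrable (by positivity) (by linarith) (by linarith)
    (by positivity) (by positivity) hm₂ hb₂
  have he₂ : ‖∫ y, f₂ y ∂σ‖ ≤ c₂ * M * δ := by
    refine (hreg.norm_integral_le (by positivity) (by linarith) (by linarith)
      (by positivity) (by positivity) hb₂).trans_eq ?_
    rw [hpow, hc₂]; ring
  -- replacing surface measure by Lebesgue measure on the tangent plane
  set k : Space d → ℝ := fun z => inner ℝ (q p) (gradKernel d (t • n p - T.lift z)) with hk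
  have hkm : Measurable k :=
    Measurable.inner measurable_const ((measurable_gradKernel d).comp
      (by have := T.lift.continuous; fun_prop))
  have hQ : Measurable fun y => T.coord (y - p) := by fun_prop
  obtain ⟨τ, hτ, hτreg⟩ := hp.exists_map_eq_add h T hS
  have hkσ : Integrable k (σ.map fun y => T.coord (y - p)) := by
    refine Integrable.of_bound hkm.aestronglyMeasurable (M * (|t| ^ d)⁻¹) (ae_of_all _ fun z => ?_)
    have h1 : |t| ≤ ‖t • n p - T.lift z‖ := by
      rw [norm_smul_sub_lift hu]
      exact Real.abs_le_sqrt (by nlinarith [sq_nonneg ‖z‖])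
    calc ‖k z‖ ≤ ‖q p‖ * ‖gradKernel d (t • n p - T.lift z)‖ := norm_inner_le_norm _ _
      _ ≤ M * (|t| ^ d)⁻¹ := by
        refine mul_le_mul hqp ((norm_gradKernel_le _ _).trans ?_) (norm_nonneg _) hM
        have : 0 < |t| := abs_pos.2 ht
        gcongr
  have hi₃ : Integrable (fun y => k (T.coord (y - p))) σ := hkσ.comp_measurable hQ
  have hsplit : ∫ y, k (T.coord (y - p)) ∂σ =
      diskFlux d t δ * inner ℝ (q p) (n p) + ∫ z, k z ∂τ := by
    rw [← integral_map hQ.aemeasurable hkm.aestronglyMeasurable]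
    rw [hτ] at hkσ ⊢
    rw [integral_add_measure hkσ.left_of_add_measure hkσ.right_of_add_measure,
      integral_disk_gradKernel hu T ht]
  have he₃ : ‖∫ z, k z ∂τ‖ ≤ c₃ * M * δ := by
    refine (hτreg.norm_integral_le (α := d) (M := M) (by positivity) (by linarith) (by linarith)
      hδ hM (ae_of_all _ fun z hz => ?_)).trans_eq ?_
    · rw [dist_zero_right] at hz ⊢
      have hz0 : 0 < ‖z‖ := lt_of_le_of_ne (norm_nonneg z) (Ne.symm hz)
      have h1 : ‖z‖ ≤ ‖t • n p - T.lift z‖ := by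
        rw [norm_smul_sub_lift hu]
        exact Real.le_sqrt_of_sq_le (by nlinarith [sq_nonneg t])
      rw [Real.rpow_neg hz0.le, Real.rpow_natCast]
      refine (norm_inner_le_norm _ _).trans
        (mul_le_mul hqp ((norm_gradKernel_le _ _).trans ?_) (norm_nonneg _) hM)
      gcongr
    · rw [hpow', hc₃]; ring
  have hsum : (fun y => (inner ℝ (q y) (gradKernel d (p + t • n p - y)) : ℝ)) =
      fun y => f₁ y + f₂ y + k (T.coord (y - p)) := by
    funext y
    simp only [hf₁, hf₂, hk, inner_sub_left, inner_sub_right]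
    ring
  rw [hsum]
  refine ⟨(hi₁.add hi₂).add hi₃, ?_⟩
  have htot : ∫ y, f₁ y + f₂ y + k (T.coord (y - p)) ∂σ =
      (∫ y, f₁ y ∂σ) + (∫ y, f₂ y ∂σ) +
        (diskFlux d t δ * inner ℝ (q p) (n p) + ∫ z, k z ∂τ) := by
    have hi₁₂ : Integrable (fun y => f₁ y + f₂ y) σ := hi₁.add hi₂
    rw [integral_add hi₁₂ hi₃, integral_add hi₁ hi₂, hsplit]
  rw [htot]
  rw [Real.norm_eq_abs] at he₁ he₂ he₃
  calc _ = |(∫ y, f₁ y ∂σ) + (∫ y, f₂ y ∂σ) + ∫ z, k z ∂τ| := by congr 1; ring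
    _ ≤ |∫ y, f₁ y ∂σ| + |∫ y, f₂ y ∂σ| + |∫ z, k z ∂τ| := abs_add_three _ _ _
    _ ≤ c₁ * L * δ + c₂ * M * δ + c₃ * M * δ := by gcongr
    _ ≤ _ := by
      have h1 : 0 ≤ c₁ * M * δ := by positivity
      have h2 : 0 ≤ c₂ * L * δ := by positivity
      have h3 : 0 ≤ c₃ * L * δ := by positivity
      nlinarith

/-- At points of the surface where the density is normal, the singularity of the field is weak. -/
lemma IsLocalInterface.norm_inner_gradKernel_le (h : IsLocalInterface S A B n p₀ C r)
    (hp₀ : p₀ ∈ S) {a L : ℝ} (hq₀ : q p₀ = a • n p₀) {y : Space (d + 1)} (hyS : y ∈ S)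
    (hy : dist y p₀ < r) (hy0 : dist y p₀ ≠ 0) (hlip : ‖q y - q p₀‖ ≤ L * dist y p₀) :
    ‖(inner ℝ (q y) (gradKernel d (p₀ - y)) : ℝ)‖ ≤
      (|a| * C + L) * dist y p₀ ^ (-((d : ℝ) - 1)) := by
  have he : 0 < dist y p₀ := lt_of_le_of_ne dist_nonneg (Ne.symm hy0)
  have hpow : dist y p₀ * (dist y p₀ ^ d)⁻¹ = dist y p₀ ^ (-((d : ℝ) - 1)) := by
    rw [neg_sub, Real.rpow_sub he, Real.rpow_one, Real.rpow_natCast, div_eq_mul_inv]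
  have hn : ‖p₀ - y‖ = dist y p₀ := by rw [dist_comm, dist_eq_norm]
  have hsplit : (inner ℝ (q y) (gradKernel d (p₀ - y)) : ℝ) =
      a * ((dist y p₀ ^ (d + 1))⁻¹ * inner ℝ (n p₀) (p₀ - y)) +
        inner ℝ (q y - q p₀) (gradKernel d (p₀ - y)) := by
    rw [inner_sub_left, hq₀, real_inner_smul_left]
    conv_rhs => rw [gradKernel, inner_smul_right, inner_smul_right, hn]
    rw [gradKernel, inner_smul_right, hn]
    ring
  have h1 : |(inner ℝ (n p₀) (p₀ - y) : ℝ)| ≤ C * dist y p₀ ^ 2 := by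
    rw [← neg_sub, inner_neg_right, abs_neg, dist_eq_norm]
    exact h.abs_inner_le p₀ ⟨hp₀, Metric.mem_ball_self h.r_pos⟩ y ⟨hyS, hy⟩
  have h2 : |(inner ℝ (q y - q p₀) (gradKernel d (p₀ - y)) : ℝ)| ≤
      L * dist y p₀ * (dist y p₀ ^ d)⁻¹ := by
    refine (abs_real_inner_le_norm _ _).trans ?_
    refine mul_le_mul hlip ((norm_gradKernel_le _ _).trans ?_) (norm_nonneg _)
      ((norm_nonneg _).trans hlip)
    rw [hn]
  rw [hsplit, Real.norm_eq_abs]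
  refine (abs_add_le _ _).trans ?_
  rw [abs_mul, abs_mul, abs_of_pos (by positivity : 0 < (dist y p₀ ^ (d + 1))⁻¹), ← hpow]
  calc _ ≤ |a| * ((dist y p₀ ^ (d + 1))⁻¹ * (C * dist y p₀ ^ 2)) +
        L * dist y p₀ * (dist y p₀ ^ d)⁻¹ := by gcongr
    _ = _ := by field_simp; ring

/-- The field of a density `q` on `S` which is Lipschitz near `p₀` and normal at `p₀`, at points
`p + t n(p)` close to `p₀`: up to an arbitrarily small error it differs from the field at `p₀` by
the flux through a flat disk. -/
lemma IsLocalInterface.exists_field_sub_le (h : IsLocalInterface S A B n p₀ C r) (hd : 1 ≤ d)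
    (hS : IsCompact S) (hfinS : surfaceMeasure (d + 1) S < ⊤) (hp₀ : p₀ ∈ S) {a L M R : ℝ}
    (hqm : AEStronglyMeasurable q ((surfaceMeasure (d + 1)).restrict S))
    (hM : ∀ y ∈ S, ‖q y‖ ≤ M) (hR : 0 < R) (hL : 0 ≤ L)
    (hlip : ∀ y ∈ S ∩ Metric.ball p₀ R, ∀ y' ∈ S ∩ Metric.ball p₀ R, ‖q y - q y'‖ ≤ L * dist y y')
    (hq₀ : q p₀ = a • n p₀) {ε : ℝ} (hε : 0 < ε) :
    ∃ δ > 0, ∃ η > 0, ∀ p ∈ S, ∀ t : ℝ, t ≠ 0 → |t| < η → dist p p₀ < η →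
      |(∫ y in S, inner ℝ (q y) (gradKernel d (p + t • n p - y)) ∂(surfaceMeasure (d + 1))) -
        (∫ y in S, inner ℝ (q y) (gradKernel d (p₀ - y)) ∂(surfaceMeasure (d + 1))) -
        diskFlux d t δ * inner ℝ (q p) (n p)| ≤ ε := by
  have hd1 : (1 : ℝ) ≤ d := by exact_mod_cast hd
  have hM0 : 0 ≤ M := (norm_nonneg _).trans (hM p₀ hp₀)
  have hC := h.C_pos
  have hr := h.r_pos
  obtain ⟨c, hc, hpatch⟩ := h.exists_patch_estimate hd hS.measurableSet
  obtain ⟨c', R', hc', hR', hball⟩ := h.exists_measure_inter_ball_le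
  obtain ⟨δ₀, hδ₀, hscale⟩ := h.exists_patchScale
  set σ := surfaceMeasure (d + 1) with hσ
  set D := dyadicConst (d : ℝ) ((d : ℝ) - 1) with hD
  have hDpos : 0 < D := dyadicConst_pos (by linarith)
  have hpow : ∀ e : ℝ, e ^ ((d : ℝ) - ((d : ℝ) - 1)) = e := fun e => by
    rw [sub_sub_cancel, Real.rpow_one]
  set c₂ := (|a| * C + L) * (c' * D * 5) with hc₂
  have hc₂0 : 0 ≤ c₂ := by positivity
  have hfin : IsFiniteMeasure (σ.restrict S) := ⟨by rwa [Measure.restrict_apply_univ]⟩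
  set m := (σ S).toReal with hm
  -- the size of the patch
  set δ := min (min δ₀ (r / 10)) (min (min (R' / 5) (R / 10))
    (min (ε / 3 / (c * (L + M) + 1)) (ε / 3 / (c₂ + 1)))) with hδ
  have hδpos : 0 < δ := by positivity
  have hδ1 : δ ≤ δ₀ := (min_le_left _ _).trans (min_le_left _ _)
  have hδ2 : 10 * δ ≤ r := by
    have : δ ≤ r / 10 := (min_le_left _ _).trans (min_le_right _ _)
    linarith
  have hδ3 : 5 * δ ≤ R' := by
    have : δ ≤ R' / 5 := (min_le_right _ _).trans ((min_le_left _ _).trans (min_le_left _ _))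
    linarith
  have hδ4 : 10 * δ ≤ R := by
    have : δ ≤ R / 10 := (min_le_right _ _).trans ((min_le_left _ _).trans (min_le_right _ _))
    linarith
  have hδ5 : c * (L + M) * δ ≤ ε / 3 := by
    have : δ ≤ ε / 3 / (c * (L + M) + 1) :=
      (min_le_right _ _).trans ((min_le_right _ _).trans (min_le_left _ _))
    rw [le_div_iff₀ (by positivity)] at this
    linarith
  have hδ6 : c₂ * δ ≤ ε / 3 := by
    have : δ ≤ ε / 3 / (c₂ + 1) :=
      (min_le_right _ _).trans ((min_le_right _ _).trans (min_le_right _ _))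
    rw [le_div_iff₀ (by positivity)] at this
    linarith
  clear_value δ
  -- the far field
  set F := M * ((d + 2) * 2 * ((δ / 2) ^ (d + 1))⁻¹) with hF
  have hF0 : 0 ≤ F := by positivity
  set η := min (δ / 4) (ε / 3 / (F * m + 1)) with hη
  have hm0 : 0 ≤ m := ENNReal.toReal_nonneg
  have hηpos : 0 < η := by positivity
  have hη1 : η ≤ δ / 4 := min_le_left _ _
  have hη2 : F * η * m ≤ ε / 3 := by
    have : η ≤ ε / 3 / (F * m + 1) := min_le_right _ _
    rw [le_div_iff₀ (by positivity)] at this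
    nlinarith
  clear_value η
  refine ⟨δ, hδpos, η, hηpos, fun p hp t ht0 ht hpη => ?_⟩
  have hps : IsPatchScale S p₀ C r p δ := hscale p hp (by linarith) δ hδpos hδ1
  have hu := hps.norm_normal h
  obtain ⟨T⟩ := nonempty_tangentFrame hu
  have hP := measurableSet_patch (p := p) (δ := δ) T hS.measurableSet
  have hPS : patch S T p δ ⊆ S := fun y hy => hy.1
  set x := p + t • n p with hx
  have hxp : dist x p = |t| := by
    rw [hx, dist_self_add_left, norm_smul, hu, mul_one, Real.norm_eq_abs]
  have hPd : ∀ y ∈ patch S T p δ, dist y p₀ < 5 * δ := fun y hy => by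
    have := dist_triangle y p p₀
    linarith [hy.2.1]
  have hpR : p ∈ S ∩ Metric.ball p₀ R := ⟨hp, by rw [Metric.mem_ball]; linarith⟩
  have hp₀R : p₀ ∈ S ∩ Metric.ball p₀ R := ⟨hp₀, Metric.mem_ball_self hR⟩
  -- the patch, at `x`
  obtain ⟨hi₁, he₁⟩ := hpatch p δ hps T t ht0 q L M hL hM0
    (hqm.mono_measure (Measure.restrict_mono hPS le_rfl)) (hM p hp) (fun y hy hyd => by
      refine hlip y ⟨hy, ?_⟩ p hpR
      rw [Metric.mem_ball]
      linarith [dist_triangle y p p₀])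
  -- the patch, at `p₀`
  have hreg : RegularAt (σ.restrict (patch S T p δ)) p₀ c' d (5 * δ) := by
    refine ⟨fun ρ hρ hρδ => ?_, (ae_restrict_mem hP).mono fun y hy => hPd y hy⟩
    rw [Measure.restrict_apply Metric.isOpen_ball.measurableSet, Set.inter_comm]
    refine (measure_mono (Set.inter_subset_inter_left _ hPS)).trans ?_
    exact hball p₀ (by simpa using hR'.le) ρ hρ (hρδ.trans hδ3)
  have hb₂ : ∀ᵐ y ∂(σ.restrict (patch S T p δ)), dist y p₀ ≠ 0 →
      ‖(inner ℝ (q y) (gradKernel d (p₀ - y)) : ℝ)‖ ≤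
        (|a| * C + L) * dist y p₀ ^ (-((d : ℝ) - 1)) := by
    filter_upwards [ae_restrict_mem hP] with y hy hy0
    have := hPd y hy
    exact h.norm_inner_gradKernel_le hp₀ hq₀ hy.1 (by linarith) hy0
      (hlip y ⟨hy.1, by rw [Metric.mem_ball]; linarith⟩ p₀ hp₀R)
  have hi₂ : IntegrableOn (fun y => (inner ℝ (q y) (gradKernel d (p₀ - y)) : ℝ))
      (patch S T p δ) σ :=
    hreg.integrable hc' (by linarith) (by linarith) (by positivity) (by positivity)
      (aestronglyMeasurable_inner_gradKernel
        (hqm.mono_measure (Measure.restrict_mono hPS le_rfl)) _) hb₂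
  have he₂ : ‖∫ y in patch S T p δ, inner ℝ (q y) (gradKernel d (p₀ - y)) ∂σ‖ ≤ c₂ * δ := by
    refine (hreg.norm_integral_le hc' (by linarith) (by linarith) (by positivity)
      (by positivity) hb₂).trans_eq ?_
    rw [hpow, hc₂]; ring
  -- the rest of the surface
  have hfar : ∀ y ∈ S \ patch S T p δ, δ / 2 ≤ ‖x - y‖ ∧ δ / 2 ≤ ‖p₀ - y‖ := by
    rintro y ⟨hyS, hyP⟩
    have hyp : δ ≤ dist y p := by
      by_contra hcon
      refine hyP ⟨hyS, by linarith, ?_⟩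
      have := T.norm_coord_le hu (y - p)
      rw [← dist_eq_norm] at this
      linarith
    rw [← dist_eq_norm, ← dist_eq_norm]
    have h1 := dist_triangle_left y p x
    have h2 := dist_triangle_left y p p₀
    have h3 := dist_comm p p₀
    constructor <;> linarith
  have hmeasx := fun z => (aestronglyMeasurable_inner_gradKernel (d := d) hqm z)
  have hfarint : ∀ z, (∀ y ∈ S \ patch S T p δ, δ / 2 ≤ ‖z - y‖) →
      IntegrableOn (fun y => (inner ℝ (q y) (gradKernel d (z - y)) : ℝ)) (S \ patch S T p δ) σ := by
    intro z hz
    have hfin' : IsFiniteMeasure (σ.restrict (S \ patch S T p δ)) :=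
      isFiniteMeasure_of_le (σ.restrict S) (Measure.restrict_mono Set.sdiff_subset le_rfl)
    refine Integrable.of_bound
      ((hmeasx z).mono_measure (Measure.restrict_mono Set.sdiff_subset le_rfl))
      (M * ((δ / 2) ^ d)⁻¹) ?_
    filter_upwards [ae_restrict_mem (hS.measurableSet.diff hP)] with y hy
    refine (norm_inner_le_norm _ _).trans (mul_le_mul (hM y hy.1)
      ((norm_gradKernel_le _ _).trans ?_) (norm_nonneg _) hM0)
    have := hz y hy
    gcongr
  have hi₃ := hfarint x fun y hy => (hfar y hy).1
  have hi₄ := hfarint p₀ fun y hy => (hfar y hy).2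
  have he₃ : ‖∫ y in S \ patch S T p δ, ((inner ℝ (q y) (gradKernel d (x - y)) : ℝ) -
      inner ℝ (q y) (gradKernel d (p₀ - y))) ∂σ‖ ≤ F * η * m := by
    have hxp₀ : ‖x - p₀‖ ≤ 2 * η := by
      rw [← dist_eq_norm]
      linarith [dist_triangle x p p₀]
    have := norm_setIntegral_le_of_norm_le_const (μ := σ) (s := S \ patch S T p δ) (C := F * η)
      (f := fun y => ((inner ℝ (q y) (gradKernel d (x - y)) : ℝ) -
        inner ℝ (q y) (gradKernel d (p₀ - y))))
      ((measure_mono Set.sdiff_subset).trans_lt hfinS) (fun y hy => ?_)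
    · refine this.trans ?_
      gcongr
      exact ENNReal.toReal_mono hfinS.ne (measure_mono Set.sdiff_subset)
    · rw [← inner_sub_right]
      refine (norm_inner_le_norm _ _).trans ?_
      calc _ ≤ M * ((d + 2) * ‖x - y - (p₀ - y)‖ * ((δ / 2) ^ (d + 1))⁻¹) :=
            mul_le_mul (hM y hy.1) (norm_gradKernel_sub_le d (by positivity) (hfar y hy).1
              (hfar y hy).2) (norm_nonneg _) hM0
        _ ≤ M * ((d + 2) * (2 * η) * ((δ / 2) ^ (d + 1))⁻¹) := by
            rw [sub_sub_sub_cancel_right]; gcongr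
        _ = F * η := by rw [hF]; ring
  have hunion : patch S T p δ ∪ (S \ patch S T p δ) = S := Set.union_sdiff_cancel hPS
  have hsplit : ∀ f : Space (d + 1) → ℝ, IntegrableOn f (patch S T p δ) σ →
      IntegrableOn f (S \ patch S T p δ) σ → ∫ y in S, f y ∂σ =
        (∫ y in patch S T p δ, f y ∂σ) + ∫ y in S \ patch S T p δ, f y ∂σ := fun f h1 h2 => by
    rw [← setIntegral_union Set.disjoint_sdiff_right (hS.measurableSet.diff hP) h1 h2, hunion]
  rw [hsplit _ hi₁ hi₃, hsplit _ hi₂ hi₄]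
  rw [integral_sub hi₃ hi₄] at he₃
  rw [Real.norm_eq_abs] at he₂ he₃
  obtain ⟨a1, a2⟩ := abs_le.1 he₁
  obtain ⟨b1, b2⟩ := abs_le.1 he₂
  obtain ⟨c1, c2⟩ := abs_le.1 he₃
  rw [abs_le]
  constructor <;> linarith

/-- **Jump relation.** The field `∫_S ⟨q(y), K(x - y)⟩ dS(y)` of a density `q` which is Lipschitz
near `p₀ ∈ S` and equal to `a n(p₀)` at `p₀` tends to its value at `p₀` plus or minus `d π a` as
`x → p₀` from the side to which `n` points, or from the opposite side. -/
theorem tendsto_field (hd : d = 1 ∨ d = 2) (hS : IsCompact S) (hI : IsC2Interface S A B n)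
    (hp₀ : p₀ ∈ S) {a L M R : ℝ}
    (hqm : AEStronglyMeasurable q ((surfaceMeasure (d + 1)).restrict S))
    (hM : ∀ y ∈ S, ‖q y‖ ≤ M) (hR : 0 < R) (hL : 0 ≤ L)
    (hlip : ∀ y ∈ S ∩ Metric.ball p₀ R, ∀ y' ∈ S ∩ Metric.ball p₀ R, ‖q y - q y'‖ ≤ L * dist y y')
    (hq₀ : q p₀ = a • n p₀) :
    Tendsto (fun x => surfaceIntegral S fun y => inner ℝ (q y) (gradKernel d (x - y))) (𝓝[B] p₀)
      (𝓝 (surfaceIntegral S (fun y => inner ℝ (q y) (gradKernel d (p₀ - y))) +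
        d * Real.pi * a)) ∧
    Tendsto (fun x => surfaceIntegral S fun y => inner ℝ (q y) (gradKernel d (x - y))) (𝓝[A] p₀)
      (𝓝 (surfaceIntegral S (fun y => inner ℝ (q y) (gradKernel d (p₀ - y))) -
        d * Real.pi * a)) := by
  obtain ⟨C, r, h⟩ := hI.exists_isLocalInterface hS hp₀
  have hr := h.r_pos
  have hfinS := hI.surfaceMeasure_lt_top hS
  have hd1 : 1 ≤ d := by omega
  have hu₀ : ‖n p₀‖ = 1 := h.norm_normal p₀ ⟨hp₀, Metric.mem_ball_self hr⟩
  -- foot points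
  have hfoot : ∀ x, ∃ p, ∃ t : ℝ, x ∈ Metric.ball p₀ r → p ∈ S ∧ x = p + t • n p ∧
      |t| ≤ dist x p₀ ∧ dist p p₀ ≤ 2 * dist x p₀ ∧ (x ∈ A → t < 0) ∧ (x ∈ B → 0 < t) := fun x => by
    by_cases hx : x ∈ Metric.ball p₀ r
    · obtain ⟨p, hp, t, hpt⟩ := h.exists_foot x hx
      exact ⟨p, t, fun _ => ⟨hp, hpt⟩⟩
    · exact ⟨p₀, 0, fun h => absurd h hx⟩
  choose P t hPt using hfoot
  have hnear : ∀ᶠ x in 𝓝 p₀, x ∈ Metric.ball p₀ r := Metric.ball_mem_nhds p₀ hr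
  have hdist : Tendsto (fun x => dist x p₀) (𝓝 p₀) (𝓝 0) := by
    simpa using (continuous_id.dist continuous_const).tendsto (x := p₀) (f := fun x => dist x p₀)
  have ht : Tendsto t (𝓝 p₀) (𝓝 0) := by
    refine squeeze_zero_norm' ?_ hdist
    filter_upwards [hnear] with x hx using (hPt x hx).2.2.1
  have hPdist : ∀ᶠ x in 𝓝 p₀, dist (P x) p₀ ≤ 2 * dist x p₀ := by
    filter_upwards [hnear] with x hx using (hPt x hx).2.2.2.1
  have hP : Tendsto P (𝓝 p₀) (𝓝[S] p₀) := by
    refine tendsto_nhdsWithin_iff.2 ⟨?_, by filter_upwards [hnear] with x hx using (hPt x hx).1⟩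
    refine tendsto_iff_dist_tendsto_zero.2 ?_
    exact squeeze_zero' (Eventually.of_forall fun _ => dist_nonneg) hPdist
      (by simpa using hdist.const_mul 2)
  have hqt : Tendsto q (𝓝[S] p₀) (𝓝 (q p₀)) := by
    refine tendsto_iff_norm_sub_tendsto_zero.2 (squeeze_zero' (g := fun y => L * dist y p₀)
      (Eventually.of_forall fun _ => norm_nonneg _) ?_ ?_)
    · filter_upwards [self_mem_nhdsWithin, mem_nhdsWithin_of_mem_nhds (Metric.ball_mem_nhds p₀ hR)]
        with y hy hyR using hlip y ⟨hy, hyR⟩ p₀ ⟨hp₀, Metric.mem_ball_self hR⟩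
    · simpa using (hdist.const_mul L).mono_left (nhdsWithin_le_nhds (s := S))
  have hnt : Tendsto n (𝓝[S] p₀) (𝓝 (n p₀)) := by
    refine tendsto_iff_norm_sub_tendsto_zero.2 (squeeze_zero' (g := fun y => C * dist y p₀)
      (Eventually.of_forall fun _ => norm_nonneg _) ?_ ?_)
    · filter_upwards [self_mem_nhdsWithin, mem_nhdsWithin_of_mem_nhds (Metric.ball_mem_nhds p₀ hr)]
        with y hy hyr
      rw [dist_eq_norm]
      exact h.normal_lipschitz y ⟨hy, hyr⟩ p₀ ⟨hp₀, Metric.mem_ball_self hr⟩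
    · simpa using (hdist.const_mul C).mono_left (nhdsWithin_le_nhds (s := S))
  have hinner : Tendsto (fun x => (inner ℝ (q (P x)) (n (P x)) : ℝ)) (𝓝 p₀) (𝓝 a) := by
    have := (hqt.comp hP).inner (𝕜 := ℝ) (hnt.comp hP)
    rwa [hq₀, real_inner_smul_left, real_inner_self_eq_norm_sq, hu₀, one_pow, mul_one] at this
  have hmain : ∀ l ≤ 𝓝 p₀, ∀ s : ℝ, (∀ᶠ x in l, t x ≠ 0) →
      (∀ δ > 0, Tendsto (fun x => diskFlux d (t x) δ) l (𝓝 s)) →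
      Tendsto (fun x => surfaceIntegral S fun y => inner ℝ (q y) (gradKernel d (x - y))) l
        (𝓝 (surfaceIntegral S (fun y => inner ℝ (q y) (gradKernel d (p₀ - y))) + s * a)) := by
    intro l hl s hne hs
    refine Metric.tendsto_nhds.2 fun ε hε => ?_
    obtain ⟨δ, hδ, η, hη, hest⟩ := h.exists_field_sub_le hd1 hS hfinS hp₀ hqm hM hR hL hlip hq₀
      (half_pos hε)
    have hlim := (hs δ hδ).mul (hinner.mono_left hl)
    filter_upwards [hne, hl hnear, (Metric.tendsto_nhds.1 hlim) (ε / 2) (half_pos hε),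
      (Metric.tendsto_nhds.1 (ht.mono_left hl)) η hη, hl hPdist,
      (Metric.tendsto_nhds.1 (hdist.mono_left hl)) (η / 2) (half_pos hη)] with x h1 h2 h3 h4 h5 h6
    obtain ⟨hpS, hxe, -⟩ := hPt x h2
    rw [Real.dist_0_eq_abs] at h4 h6
    rw [abs_of_nonneg dist_nonneg] at h6
    have h7 := hest (P x) hpS (t x) h1 h4 (by linarith)
    rw [← hxe] at h7
    rw [Real.dist_eq] at h3 ⊢
    unfold surfaceIntegral
    obtain ⟨a1, a2⟩ := abs_lt.1 h3
    obtain ⟨b1, b2⟩ := abs_le.1 h7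
    rw [abs_lt]
    constructor <;> linarith
  constructor
  · have htB : ∀ᶠ x in 𝓝[B] p₀, 0 < t x := by
      filter_upwards [self_mem_nhdsWithin, nhdsWithin_le_nhds hnear] with x hxB hx
        using (hPt x hx).2.2.2.2.2 hxB
    have htl : Tendsto t (𝓝[B] p₀) (𝓝[>] 0) :=
      tendsto_nhdsWithin_iff.2 ⟨ht.mono_left nhdsWithin_le_nhds, htB⟩
    exact hmain _ nhdsWithin_le_nhds _ (htB.mono fun x hx => hx.ne') fun δ hδ =>
      (tendsto_diskFlux hd hδ).comp htl
  · have htA : ∀ᶠ x in 𝓝[A] p₀, 0 < -t x := by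
      filter_upwards [self_mem_nhdsWithin, nhdsWithin_le_nhds hnear] with x hxA hx
      exact neg_pos.2 ((hPt x hx).2.2.2.2.1 hxA)
    have htl : Tendsto (fun x => -t x) (𝓝[A] p₀) (𝓝[>] 0) := by
      refine tendsto_nhdsWithin_iff.2 ⟨?_, htA⟩
      simpa using (ht.mono_left nhdsWithin_le_nhds).neg
    have := hmain (𝓝[A] p₀) nhdsWithin_le_nhds (-(d * Real.pi))
      (htA.mono fun x hx => (neg_pos.1 hx).ne) fun δ hδ => by
        have := ((tendsto_diskFlux hd hδ).comp htl).neg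
        refine this.congr fun x => ?_
        simp [diskFlux_neg]
    rwa [neg_mul, ← sub_eq_add_neg] at this

end Jump

/-! ### Regularity of the densities -/

section Density

/-- A mean value inequality along a Lipschitz path `γ` which need not be differentiable, for a
function which is differentiable only within a set containing the path. -/
lemma norm_sub_le_of_path {E : Type*} [NormedAddCommGroup E] [NormedSpace ℝ E] {f : E → ℝ}
    {f' : E → E →L[ℝ] ℝ} {γ : ℝ → E} {S : Set E} {M K : ℝ} (hK : 0 < K) (hM : 0 ≤ M)
    (hγS : ∀ s ∈ Set.Icc (0 : ℝ) 1, γ s ∈ S)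
    (hγ : ∀ s ∈ Set.Icc (0 : ℝ) 1, ∀ s' ∈ Set.Icc (0 : ℝ) 1, ‖γ s - γ s'‖ ≤ K * |s - s'|)
    (hf : ∀ s ∈ Set.Icc (0 : ℝ) 1, HasFDerivWithinAt f (f' (γ s)) S (γ s))
    (hf' : ∀ s ∈ Set.Icc (0 : ℝ) 1, ‖f' (γ s)‖ ≤ M) :
    ‖f (γ 1) - f (γ 0)‖ ≤ (M + 2) * K := by
  have hγc : ∀ s ∈ Set.Icc (0 : ℝ) 1, Tendsto γ (𝓝[Set.Icc 0 1] s) (𝓝[S] (γ s)) := by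
    intro s hs
    refine tendsto_nhdsWithin_iff.2 ⟨tendsto_iff_norm_sub_tendsto_zero.2 ?_,
      eventually_nhdsWithin_of_forall hγS⟩
    refine squeeze_zero' (g := fun z => K * |z - s|) (Eventually.of_forall fun _ => norm_nonneg _)
      (eventually_nhdsWithin_of_forall fun z hz => hγ z hz s hs) ?_
    have : Tendsto (fun z : ℝ => K * |z - s|) (𝓝 s) (𝓝 (K * |s - s|)) :=
      Continuous.tendsto (by fun_prop) s
    simp only [sub_self, abs_zero, mul_zero] at this
    exact this.mono_left nhdsWithin_le_nhds
  set g : ℝ → ℝ := fun s => f (γ s) - f (γ 0) with hg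
  have hgc : ContinuousOn g (Set.Icc 0 1) := fun s hs =>
    ((hf s hs).continuousWithinAt.tendsto.comp (hγc s hs)).sub_const _
  have := image_norm_le_of_liminf_right_slope_norm_lt_deriv_boundary (f := g) (a := 0) (b := 1)
    (f' := fun _ => (M + 1) * K) (B := fun s => (M + 2) * K * s) (B' := fun _ => (M + 2) * K)
    hgc (fun s hs ρ hρ => ?_) (by simp [hg]) (by fun_prop)
    (fun s _ => by simpa using ((hasDerivAt_id s).const_mul ((M + 2) * K)).hasDerivWithinAt)
    (fun s _ _ => by nlinarith) (Set.right_mem_Icc.2 zero_le_one)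
  · simpa [hg] using this
  · have hs' : s ∈ Set.Icc (0 : ℝ) 1 := ⟨hs.1, hs.2.le⟩
    have hlo := (hf s hs').isLittleO.def one_pos
    have hlo2 := (hγc s hs').eventually hlo
    refine Eventually.frequently ?_
    have hmem : ∀ᶠ z in 𝓝[>] s, z ∈ Set.Icc (0 : ℝ) 1 ∧ s < z := by
      filter_upwards [Ioc_mem_nhdsGT hs.2] with z hz
      exact ⟨⟨hs.1.trans hz.1.le, hz.2⟩, hz.1⟩
    have hle : 𝓝[>] s ≤ 𝓝[Set.Icc 0 1] s :=
      le_inf nhdsWithin_le_nhds (le_principal_iff.2 (hmem.mono fun z hz => hz.1))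
    filter_upwards [hmem, hle hlo2] with z hz hlz
    have hzs : 0 < z - s := sub_pos.2 hz.2
    have h1 : ‖g z‖ - ‖g s‖ ≤ (M + 1) * (K * (z - s)) := by
      have h2 : ‖g z‖ - ‖g s‖ ≤ ‖f (γ z) - f (γ s)‖ := by
        refine (norm_sub_norm_le _ _).trans_eq ?_
        simp [hg]
      have h3 : ‖f (γ z) - f (γ s)‖ ≤ (M + 1) * ‖γ z - γ s‖ := by
        have h4 : ‖f' (γ s) (γ z - γ s)‖ ≤ M * ‖γ z - γ s‖ :=
          (f' (γ s)).le_of_opNorm_le (hf' s hs') _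
        have h5 : f (γ z) - f (γ s) =
            (f (γ z) - f (γ s) - f' (γ s) (γ z - γ s)) + f' (γ s) (γ z - γ s) := by ring
        rw [h5]
        refine (norm_add_le _ _).trans ?_
        linarith
      have h6 := hγ z hz.1 s hs'
      rw [abs_of_pos hzs] at h6
      refine h2.trans (h3.trans ?_)
      gcongr
    refine lt_of_le_of_lt ?_ hρ
    rw [slope_def_field, div_le_iff₀ hzs]
    simp only [Function.comp]
    linarith

variable {d : ℕ} {S A B : Set (Space (d + 1))} {n q : Space (d + 1) → Space (d + 1)}
  {p₀ : Space (d + 1)} {C r : ℝ}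

/-- A `C¹` function on the surface is locally Lipschitz, because nearby points of the surface are
joined by curves on it whose length is comparable with their distance. -/
lemma IsLocalInterface.exists_lipschitz (h : IsLocalInterface S A B n p₀ C r) (hp₀ : p₀ ∈ S)
    {f : Space (d + 1) → ℝ} (hf : ContDiffOn ℝ 1 f S) :
    ∃ L R, 0 ≤ L ∧ 0 < R ∧ ∀ y ∈ S ∩ Metric.ball p₀ R, ∀ y' ∈ S ∩ Metric.ball p₀ R,
      |f y - f y'| ≤ L * dist y y' := by
  obtain ⟨δ₀, hδ₀, hscale⟩ := h.exists_patchScale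
  have hr := h.r_pos
  obtain ⟨u, hu, -, -, f', hf', hf'c⟩ :=
    (contDiffWithinAt_succ_iff_hasFDerivWithinAt' (n := 0) (by simp)).1
      (show ContDiffWithinAt ℝ (0 + 1) f S p₀ by simpa using hf p₀ hp₀)
  set M := ‖f' p₀‖ + 1 with hM
  have hM0 : 0 ≤ M := by positivity
  have hbound : ∀ᶠ y in 𝓝[S] p₀, ‖f' y‖ ≤ M := by
    have := hf'c.continuousWithinAt.norm
    exact (this.eventually (gt_mem_nhds (lt_add_one _))).mono fun y hy => hy.le
  rw [Set.insert_eq_of_mem hp₀] at hu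
  obtain ⟨R, hR, hRS⟩ := Metric.mem_nhdsWithin_iff.1 (inter_mem hu hbound)
  set δ := min δ₀ (R / 4) with hδ
  have hδpos : 0 < δ := by positivity
  have hps := hscale p₀ hp₀ (by simpa using by positivity) δ hδpos (min_le_left _ _)
  have hδR : 4 * δ ≤ R := by linarith [min_le_right δ₀ (R / 4)]
  obtain ⟨T⟩ := nonempty_tangentFrame (hps.norm_normal h)
  have hC := h.C_pos
  have hnu := hps.norm_normal h
  have hex : ∀ z : Space d, ∃ y, ‖z‖ < δ → y ∈ patch S T p₀ δ ∧ T.coord (y - p₀) = z := fun z => by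
    by_cases hz : ‖z‖ < δ
    · obtain ⟨y, hy, hyz⟩ := hps.exists_mem_patch h T hz
      exact ⟨y, fun _ => ⟨hy, hyz⟩⟩
    · exact ⟨0, fun h => absurd h hz⟩
  choose G hG using hex
  have hlip : ∀ y ∈ patch S T p₀ δ, ∀ y' ∈ patch S T p₀ δ,
      ‖y - y'‖ ≤ 2 * ‖T.coord (y - p₀) - T.coord (y' - p₀)‖ := by
    intro y hy y' hy'
    have h1 := hps.dist_le_two_mul h T hy
    have h2 := hps.dist_le_two_mul h T hy'
    have := hps.norm_sub_le_of_dist_le h T (s := 2 * δ) hy.1 hy'.1 (by linarith [hy.2.2])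
      (by linarith [hy'.2.2]) hy.2.1 hy'.2.1 (by linarith)
    rw [← map_sub, sub_sub_sub_cancel_right]
    refine this.trans ?_
    gcongr
    linarith [hps.slope]
  refine ⟨(M + 2) * 2, δ, by positivity, hδpos, ?_⟩
  have hmem : ∀ y ∈ S ∩ Metric.ball p₀ δ, y ∈ patch S T p₀ δ := fun y hy =>
    (hps.patch_subset_ball_inter h T le_rfl hy).1
  intro y hy y' hy'
  rcases eq_or_ne y y' with rfl | hne
  · simp
  set z := T.coord (y - p₀) with hz
  set z' := T.coord (y' - p₀) with hz'
  have hzz : ‖z - z'‖ ≤ dist y y' := by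
    rw [hz, hz', ← map_sub, sub_sub_sub_cancel_right, dist_eq_norm]
    exact T.norm_coord_le hnu _
  have hKpos : 0 < 2 * ‖z - z'‖ := by
    have h1 := hlip y (hmem y hy) y' (hmem y' hy')
    have h2 : 0 < ‖y - y'‖ := norm_pos_iff.2 (sub_ne_zero.2 hne)
    linarith
  have hseg : ∀ s ∈ Set.Icc (0 : ℝ) 1, ‖z' + s • (z - z')‖ < δ := fun s hs => by
    have h1 : z' ∈ Metric.ball (0 : Space d) δ := by
      rw [mem_ball_zero_iff]; exact (hmem y' hy').2.2
    have h2 : z ∈ Metric.ball (0 : Space d) δ := by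
      rw [mem_ball_zero_iff]; exact (hmem y hy).2.2
    have h3 := (convex_ball (0 : Space d) δ).segment_subset h1 h2
      (segment_eq_image' ℝ z' z ▸ ⟨s, hs, rfl⟩ : z' + s • (z - z') ∈ segment ℝ z' z)
    exact mem_ball_zero_iff.1 h3
  have hpath := norm_sub_le_of_path (f := f) (f' := f') (S := S)
    (γ := fun s => G (z' + s • (z - z'))) hKpos hM0
    (fun s hs => (hG _ (hseg s hs)).1.1) (fun s hs s' hs' => ?_)
    (fun s hs => hf' _ (hRS ⟨?_, (hG _ (hseg s hs)).1.1⟩).1)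
    (fun s hs => (hRS ⟨?_, (hG _ (hseg s hs)).1.1⟩).2)
  · have hend : ∀ x ∈ patch S T p₀ δ, G (T.coord (x - p₀)) = x := fun x hx => by
      obtain ⟨h1, h2⟩ := hG _ hx.2.2
      have := hlip _ h1 x hx
      rw [h2, sub_self, norm_zero, mul_zero] at this
      exact sub_eq_zero.1 (norm_le_zero_iff.1 this)
    simp only [one_smul, add_sub_cancel, zero_smul, add_zero] at hpath
    rw [hz, hz', hend y (hmem y hy), hend y' (hmem y' hy'), ← hz, ← hz'] at hpath
    rw [← Real.norm_eq_abs]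
    refine hpath.trans ?_
    rw [← mul_assoc]
    gcongr
  · have h1 := hG _ (hseg s hs)
    have h2 := hG _ (hseg s' hs')
    have := hlip _ h1.1 _ h2.1
    rw [h1.2, h2.2, add_sub_add_left_eq_sub, ← sub_smul, norm_smul, Real.norm_eq_abs] at this
    refine this.trans_eq (by ring)
  · have := (hG _ (hseg s hs)).1.2.1
    rw [Metric.mem_ball]; linarith
  · have := (hG _ (hseg s hs)).1.2.1
    rw [Metric.mem_ball]; linarith

lemma IsC2Interface.continuousOn_normal (hS : IsCompact S) (hI : IsC2Interface S A B n) :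
    ContinuousOn n S := by
  intro p hp
  obtain ⟨C, r, h⟩ := hI.exists_isLocalInterface hS hp
  refine tendsto_iff_norm_sub_tendsto_zero.2 (squeeze_zero' (g := fun y => C * ‖y - p‖)
      (Eventually.of_forall fun _ => norm_nonneg _) ?_ ?_)
  · filter_upwards [self_mem_nhdsWithin,
      mem_nhdsWithin_of_mem_nhds (Metric.ball_mem_nhds p h.r_pos)] with y hy hyr
    exact h.normal_lipschitz y ⟨hy, hyr⟩ p ⟨hp, Metric.mem_ball_self h.r_pos⟩
  · have : Tendsto (fun y : Space (d + 1) => C * ‖y - p‖) (𝓝 p) (𝓝 (C * ‖p - p‖)) :=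
      Continuous.tendsto (by fun_prop) p
    simp only [sub_self, norm_zero, mul_zero] at this
    exact this.mono_left nhdsWithin_le_nhds

lemma IsC2Interface.norm_normal (hS : IsCompact S) (hI : IsC2Interface S A B n) :
    ∀ p ∈ S, ‖n p‖ = 1 := fun p hp => by
  obtain ⟨C, r, h⟩ := hI.exists_isLocalInterface hS hp
  exact h.norm_normal p ⟨hp, Metric.mem_ball_self h.r_pos⟩

end Density

/-! ### Weakly singular potentials -/

section Weak

variable {d : ℕ} {S A B : Set (Space (d + 1))} {n : Space (d + 1) → Space (d + 1)}
  {p₀ : Space (d + 1)}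

/-- A potential with a weakly singular kernel is continuous across the surface. -/
lemma continuousAt_potential (hS : IsCompact S) (hI : IsC2Interface S A B n) (hp₀ : p₀ ∈ S)
    {f H : Space (d + 1) → ℝ} {M c α : ℝ}
    (hfm : AEStronglyMeasurable f ((surfaceMeasure (d + 1)).restrict S))
    (hM : ∀ y ∈ S, |f y| ≤ M) (hH : ContDiffOn ℝ 1 H {0}ᶜ) (hHm : Measurable H) (hc : 0 ≤ c)
    (hα : 0 ≤ α) (hαd : α < d) (hHb : ∀ z, z ≠ 0 → ‖z‖ ≤ 1 → |H z| ≤ c * ‖z‖ ^ (-α)) :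
    ContinuousAt (potential (surfaceMeasure (d + 1)) S f H) p₀ := by
  obtain ⟨C, r, h⟩ := hI.exists_isLocalInterface hS hp₀
  obtain ⟨c', R, hc', hR, hball⟩ := h.exists_measure_inter_ball_le
  have hfinS := hI.surfaceMeasure_lt_top hS
  set σ := surfaceMeasure (d + 1) with hσ
  have hfin : IsFiniteMeasure (σ.restrict S) := ⟨by rwa [Measure.restrict_apply_univ]⟩
  have hM0 : 0 ≤ M := (abs_nonneg _).trans (hM p₀ hp₀)
  have hfint : IntegrableOn f S σ := by
    refine Integrable.of_bound hfm M ?_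
    filter_upwards [ae_restrict_mem hS.measurableSet] with y hy using hM y hy
  set D := dyadicConst (d : ℝ) α with hD
  have hDpos : 0 < D := dyadicConst_pos hαd
  set K := M * c * (c' * D) with hK
  have hK0 : 0 ≤ K := by positivity
  refine Metric.continuousAt_iff'.2 fun ε hε => ?_
  obtain ⟨δ, hδ, hδR, hδ1, hδε⟩ : ∃ δ > 0, 2 * δ ≤ R ∧ 2 * δ ≤ 1 ∧
      K * (2 * δ) ^ ((d : ℝ) - α) < ε / 3 := by
    have h1 : Tendsto (fun δ : ℝ => K * (2 * δ) ^ ((d : ℝ) - α)) (𝓝 0)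
        (𝓝 (K * (2 * 0) ^ ((d : ℝ) - α))) := by
      have h2 : ContinuousAt (fun x : ℝ => x ^ ((d : ℝ) - α)) (2 * 0) :=
        Real.continuousAt_rpow_const _ _ (Or.inr (by linarith))
      have h3 : ContinuousAt (fun δ : ℝ => 2 * δ) 0 := by fun_prop
      exact (ContinuousAt.comp (f := fun δ : ℝ => 2 * δ) h2 h3).const_mul K
    rw [mul_zero, Real.zero_rpow (by linarith), mul_zero] at h1
    have h4 := (h1.mono_left (nhdsWithin_le_nhds (s := Set.Ioi 0))).eventually
      (gt_mem_nhds (by positivity : 0 < ε / 3))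
    obtain ⟨δ, h5, h6⟩ := (h4.and (Ioc_mem_nhdsGT
      (by positivity : (0 : ℝ) < min (R / 2) (1 / 2)))).exists
    have h7 := h6.2.trans (min_le_left _ _)
    have h8 := h6.2.trans (min_le_right _ _)
    exact ⟨δ, h6.1, by linarith, by linarith, h5⟩
  set N := S ∩ Metric.ball p₀ δ with hN
  have hNm : MeasurableSet N := hS.measurableSet.inter Metric.isOpen_ball.measurableSet
  have hcomp : IsCompact (S \ Metric.ball p₀ δ) := hS.diff Metric.isOpen_ball
  have hfar : ∀ x ∈ Metric.ball p₀ δ, x ∉ S \ Metric.ball p₀ δ := fun x hx hx' => hx'.2 hx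
  have hfint' : IntegrableOn f (S \ Metric.ball p₀ δ) σ := hfint.mono_set Set.sdiff_subset
  -- the near part
  have hnear : ∀ x ∈ Metric.ball p₀ δ, IntegrableOn (fun y => f y • H (x - y)) N σ ∧
      ‖∫ y in N, f y • H (x - y) ∂σ‖ < ε / 3 := by
    intro x hx
    have hx : dist x p₀ < δ := hx
    have hreg : RegularAt (σ.restrict N) x c' d (2 * δ) := by
      refine ⟨fun ρ hρ hρδ => ?_, (ae_restrict_mem hNm).mono fun y hy => ?_⟩
      · rw [Measure.restrict_apply Metric.isOpen_ball.measurableSet, Set.inter_comm]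
        refine (measure_mono (Set.inter_subset_inter_left _ Set.inter_subset_left)).trans ?_
        exact hball x (by linarith) ρ hρ (hρδ.trans hδR)
      · have : dist y p₀ < δ := hy.2
        rw [Metric.mem_ball]
        linarith [dist_triangle_right y x p₀]
    have hb : ∀ᵐ y ∂(σ.restrict N), dist y x ≠ 0 →
        ‖f y • H (x - y)‖ ≤ M * c * dist y x ^ (-α) := by
      filter_upwards [ae_restrict_mem hNm, hreg.ae_mem] with y hy hyx hy0
      have hyx : dist y x < 2 * δ := hyx
      have hxy : ‖x - y‖ = dist y x := by rw [dist_comm, dist_eq_norm]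
      rw [norm_smul, mul_assoc]
      refine mul_le_mul (hM y hy.1) ?_ (norm_nonneg _) hM0
      rw [← hxy]
      refine hHb _ (fun h0 => hy0 ?_) (by linarith)
      rw [← hxy, h0, norm_zero]
    refine ⟨hreg.integrable hc' hα hαd (by positivity) (by positivity) ?_ hb, ?_⟩
    · exact (hfm.mono_measure (Measure.restrict_mono Set.inter_subset_left le_rfl)).smul
        (hHm.comp (by fun_prop)).aestronglyMeasurable
    · refine (hreg.norm_integral_le hc' hα hαd (by positivity) (by positivity) hb).trans_lt ?_
      refine lt_of_eq_of_lt ?_ hδε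
      rw [hK]; ring
  have hsplit : ∀ x ∈ Metric.ball p₀ δ, potential σ S f H x =
      (∫ y in N, f y • H (x - y) ∂σ) + potential σ (S \ Metric.ball p₀ δ) f H x := by
    intro x hx
    have hun : N ∪ (S \ Metric.ball p₀ δ) = S := Set.inter_union_sdiff _ _
    have hdisj : Disjoint N (S \ Metric.ball p₀ δ) :=
      Set.disjoint_left.2 fun y hy hy' => hy'.2 hy.2
    unfold potential
    rw [← setIntegral_union hdisj hcomp.measurableSet (hnear x hx).1
      (integrable_potential hcomp hfint' (hfar x hx) hH.continuousOn), hun]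
  have hp₀δ : p₀ ∈ Metric.ball p₀ δ := Metric.mem_ball_self hδ
  have hcont := (hasFDerivAt_potential hcomp hfint' (hfar p₀ hp₀δ) hH).continuousAt
  filter_upwards [Metric.ball_mem_nhds p₀ hδ,
    Metric.continuousAt_iff'.1 hcont (ε / 3) (by positivity)] with x hx hxε
  have h1 := (hnear x hx).2
  have h2 := (hnear p₀ hp₀δ).2
  rw [hsplit x hx, hsplit p₀ hp₀δ]
  rw [Real.dist_eq] at hxε ⊢
  rw [Real.norm_eq_abs] at h1 h2
  obtain ⟨a1, a2⟩ := abs_lt.1 h1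
  obtain ⟨b1, b2⟩ := abs_lt.1 h2
  obtain ⟨c1, c2⟩ := abs_lt.1 hxε
  rw [abs_lt]
  constructor <;> linarith

end Weak

/-! ### The fundamental solution -/

section Fundamental

variable {d : ℕ}

/-- The fundamental solution as a function of the difference of its arguments. -/
def fundSol (d : ℕ) (z : Space (d + 1)) : ℝ := Phi z 0

lemma Phi_eq_fundSol (x y : Space (d + 1)) : Phi x y = fundSol d (x - y) := by
  simp [fundSol, Phi]

lemma fundSol_neg (z : Space (d + 1)) : fundSol d (-z) = fundSol d z := by
  simp [fundSol, Phi]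

lemma measurable_fundSol : Measurable (fundSol d) := by
  unfold fundSol Phi
  split_ifs <;> fun_prop

lemma contDiffOn_fundSol (k : WithTop ℕ∞) : ContDiffOn ℝ k (fundSol d) {0}ᶜ := by
  intro z hz
  have hz : z ≠ 0 := hz
  have hn : ContDiffAt ℝ k (fun z : Space (d + 1) => ‖z‖) z := contDiffAt_norm ℝ hz
  have hn0 : ‖z‖ ≠ 0 := norm_ne_zero_iff.2 hz
  refine ContDiffAt.contDiffWithinAt ?_
  unfold fundSol Phi
  simp only [sub_zero]
  split_ifs with h
  · exact hn.log hn0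
  · simp only [one_div]
    exact ((contDiffAt_const.mul hn).inv (by positivity)).neg

lemma hasFDerivAt_fundSol (hd : d = 1 ∨ d = 2) {z : Space (d + 1)} (hz : z ≠ 0) :
    HasFDerivAt (fundSol d) ((d : ℝ)⁻¹ • innerSL ℝ (gradKernel d z)) z := by
  have hn0 : ‖z‖ ≠ 0 := norm_ne_zero_iff.2 hz
  have hn := hasFDerivAt_norm_of_ne hz
  rcases hd with rfl | rfl
  · have heq : fundSol 1 = fun z : Space 2 => Real.log ‖z‖ := by
      funext z; simp [fundSol, Phi]
    rw [heq]
    refine (hn.log hn0).congr_fderiv ?_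
    ext v
    simp [gradKernel]
    field_simp
  · have heq : fundSol 2 = fun z : Space 3 => -2⁻¹ * (‖z‖ ^ 1)⁻¹ := by
      funext z; simp [fundSol, Phi]; ring
    rw [heq]
    refine ((hasFDerivAt_inv_norm_pow 1 hz).const_mul (-2⁻¹ : ℝ)).congr_fderiv ?_
    ext v
    simp [gradKernel]

/-- The formula also holds at the origin, where the derivative of the even function `fundSol` is
the junk value `0`. -/
lemma fderiv_fundSol (hd : d = 1 ∨ d = 2) (z : Space (d + 1)) :
    fderiv ℝ (fundSol d) z = (d : ℝ)⁻¹ • innerSL ℝ (gradKernel d z) := by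
  rcases eq_or_ne z 0 with rfl | hz
  · rw [gradKernel_zero, map_zero, smul_zero]
    by_cases hD : DifferentiableAt ℝ (fundSol d) 0
    · have h1 := hD.hasFDerivAt
      have h2 : HasFDerivAt (fundSol d) (fderiv ℝ (fundSol d) 0) (-0) := by simpa using h1
      have h3 := h2.comp (0 : Space (d + 1)) (hasFDerivAt_id (0 : Space (d + 1))).neg
      have h4 : fundSol d ∘ Neg.neg = fundSol d := funext fundSol_neg
      rw [h4] at h3
      ext v
      have := congrArg (fun l : Space (d + 1) →L[ℝ] ℝ => l v) (h1.unique h3)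
      simp at this
      simp only [zero_apply]
      linarith
    · exact fderiv_zero_of_not_differentiableAt hD
  · exact (hasFDerivAt_fundSol hd hz).fderiv

/-- As in `laplacian_inner_gradKernel`, the Laplacian is the trace of the second derivative. -/
lemma laplacian_fundSol (hd : d = 1 ∨ d = 2) {ι : Type*} [Fintype ι]
    (b : OrthonormalBasis ι ℝ (Space (d + 1))) {z : Space (d + 1)} (hz : z ≠ 0) :
    ∑ i, fderiv ℝ (fderiv ℝ (fundSol d)) z (b i) (b i) = 0 := by
  have hcard : Fintype.card ι = d + 1 := by
    rw [← Module.finrank_eq_card_basis b.toBasis]; simp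
  have key : ∀ v, fderiv ℝ (fderiv ℝ (fundSol d)) z v v =
      (d : ℝ)⁻¹ * ((‖z‖ ^ (d + 1))⁻¹ * ‖v‖ ^ 2 -
        (d + 1) * (‖z‖ ^ (d + 3))⁻¹ * (inner ℝ z v * inner ℝ v z)) := by
    intro v
    have hdiff : DifferentiableAt ℝ (fderiv ℝ (fundSol d)) z :=
      (((contDiffOn_fundSol 2).fderiv_of_isOpen isOpen_compl_singleton
        (m := 1) (by norm_num)).contDiffAt (isOpen_compl_singleton.mem_nhds hz)).differentiableAt
        (by norm_num)
    have h0 : fderiv ℝ (fderiv ℝ (fundSol d)) z v v =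
        fderiv ℝ (fun w => fderiv ℝ (fundSol d) w v) z v := by
      rw [fderiv_clm_apply hdiff (by fun_prop)]
      simp
    have h1 : (fun w => fderiv ℝ (fundSol d) w v) =
        fun w => (d : ℝ)⁻¹ * inner ℝ v (gradKernel d w) := by
      funext w
      rw [fderiv_fundSol hd, real_inner_comm]
      rfl
    rw [h0, h1, ((hasFDerivAt_inner_gradKernel d v hz).const_mul _).fderiv]
    simp [real_inner_comm z v]
    ring_nf
    simp
  simp only [key]
  rw [← Finset.mul_sum, Finset.sum_sub_distrib, ← Finset.mul_sum, ← Finset.mul_sum,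
    b.sum_inner_mul_inner]
  have hn : ‖z‖ ≠ 0 := norm_ne_zero_iff.2 hz
  simp [hcard]
  right
  field_simp
  ring

/-- The exponent `d - 1 / 2` is a common upper bound for the logarithmic singularity in the plane
and the singularity of order `1` in space, and is still smaller than the dimension `d` of the
surface. -/
lemma abs_fundSol_le (hd : d = 1 ∨ d = 2) {z : Space (d + 1)} (hz : z ≠ 0) (hz1 : ‖z‖ ≤ 1) :
    |fundSol d z| ≤ 2 * ‖z‖ ^ (-((d : ℝ) - 1 / 2)) := by
  have hn : 0 < ‖z‖ := norm_pos_iff.2 hz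
  rcases hd with rfl | rfl
  · have h1 := Real.abs_log_mul_self_rpow_lt ‖z‖ (1 / 2) hn hz1 (by norm_num)
    have h2 : 0 < ‖z‖ ^ (1 / 2 : ℝ) := by positivity
    have h3 : (-(((1 : ℕ) : ℝ) - 1 / 2)) = -(1 / 2) := by norm_num
    have h4 : fundSol 1 z = Real.log ‖z‖ := by simp [fundSol, Phi]
    rw [h4, h3, Real.rpow_neg hn.le, ← div_eq_mul_inv, le_div_iff₀ h2]
    rw [abs_mul, abs_of_pos h2] at h1
    linarith
  · have h3 : (-(((2 : ℕ) : ℝ) - 1 / 2)) = -(3 / 2) := by norm_num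
    have h4 : fundSol 2 z = -(1 / (2 * ‖z‖)) := by simp [fundSol, Phi]
    have h5 : ‖z‖ ^ (-1 : ℝ) ≤ ‖z‖ ^ (-(3 / 2) : ℝ) :=
      Real.rpow_le_rpow_of_exponent_ge hn hz1 (by norm_num)
    rw [Real.rpow_neg_one] at h5
    rw [h3, h4, abs_neg, abs_of_pos (by positivity), one_div, mul_inv]
    have : 0 < ‖z‖⁻¹ := by positivity
    linarith

lemma Phi_n_eq (hd : d = 1 ∨ d = 2) (n : Space (d + 1) → Space (d + 1)) (x y : Space (d + 1)) :
    Phi_n n x y = (d : ℝ)⁻¹ * inner ℝ (n x) (gradKernel d (x - y)) := by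
  unfold Phi_n
  simp only [Phi_eq_fundSol]
  rw [fderiv_comp_sub, fderiv_fundSol hd, real_inner_comm]
  rfl

lemma Phi_m_eq (hd : d = 1 ∨ d = 2) (m : Space (d + 1) → Space (d + 1)) (x y : Space (d + 1)) :
    Phi_m m x y = -(d : ℝ)⁻¹ * inner ℝ (m y) (gradKernel d (x - y)) := by
  unfold Phi_m
  have h1 : (fun z => Phi x z) = fun z => fundSol d (z - x) := by
    funext z; rw [Phi_eq_fundSol, ← fundSol_neg, neg_sub]
  have h2 : gradKernel d (y - x) = -gradKernel d (x - y) := by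
    rw [← neg_sub x y, gradKernel, norm_neg, smul_neg]; rfl
  rw [h1, fderiv_comp_sub, fderiv_fundSol hd, h2, real_inner_comm]
  simp

end Fundamental

/-! ### Fields away from the charge -/

section Field

variable {d : ℕ} {S : Set (Space (d + 1))} {q : Space (d + 1) → Space (d + 1)}
  {x : Space (d + 1)}

/-- Off the charge, the field is a sum of potentials with the components of the kernel. -/
lemma field_eq_sum_potential (hS : IsCompact S)
    (hq : IntegrableOn q S (surfaceMeasure (d + 1))) (hx : x ∉ S) :
    surfaceIntegral S (fun y => inner ℝ (q y) (gradKernel d (x - y))) =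
      ∑ i, potential (surfaceMeasure (d + 1)) S (fun y => q y i)
        (fun z => inner ℝ (EuclideanSpace.basisFun (Fin (d + 1)) ℝ i) (gradKernel d z)) x := by
  unfold surfaceIntegral potential
  have hqi : ∀ i, IntegrableOn (fun y => q y i) S (surfaceMeasure (d + 1)) := fun i =>
    (EuclideanSpace.proj i : Space (d + 1) →L[ℝ] ℝ).integrable_comp hq
  rw [← integral_finsetSum]
  · refine integral_congr_ae (ae_of_all _ fun y => ?_)
    simp [PiLp.inner_apply, mul_comm]
  · intro i _
    exact integrable_potential hS (hqi i) hx (contDiffOn_inner_gradKernel d _ 1).continuousOn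

lemma harmonicAt_field (hS : IsCompact S)
    (hq : IntegrableOn q S (surfaceMeasure (d + 1))) (hx : x ∉ S) :
    HarmonicAt (fun x => surfaceIntegral S fun y => inner ℝ (q y) (gradKernel d (x - y))) x := by
  have hqi : ∀ i, IntegrableOn (fun y => q y i) S (surfaceMeasure (d + 1)) := fun i =>
    (EuclideanSpace.proj i : Space (d + 1) →L[ℝ] ℝ).integrable_comp hq
  have hev : (fun x => surfaceIntegral S fun y => inner ℝ (q y) (gradKernel d (x - y))) =ᶠ[𝓝 x]
      ∑ i, potential (surfaceMeasure (d + 1)) S (fun y => q y i)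
        (fun z => inner ℝ (EuclideanSpace.basisFun (Fin (d + 1)) ℝ i) (gradKernel d z)) := by
    filter_upwards [hS.isClosed.isOpen_compl.mem_nhds hx] with x' hx'
    rw [field_eq_sum_potential hS hq hx', Finset.sum_apply]
  rw [harmonicAt_congr_nhds hev]
  refine Finset.sum_induction _ (fun f => HarmonicAt f x) (fun _ _ => HarmonicAt.add)
    (harmonicAt_const 0) fun i _ => ?_
  have hΔ : ∀ z : Space (d + 1), z ≠ 0 → ∑ j, fderiv ℝ (fderiv ℝ (fun z : Space (d + 1) =>
      (inner ℝ (EuclideanSpace.basisFun (Fin (d + 1)) ℝ i) (gradKernel d z) : ℝ))) z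
      (EuclideanSpace.basisFun (Fin (d + 1)) ℝ j) (EuclideanSpace.basisFun (Fin (d + 1)) ℝ j) = 0 :=
    fun z hz => laplacian_inner_gradKernel _ d (Fintype.card_fin _) _ hz
  exact harmonicAt_potential (EuclideanSpace.basisFun (Fin (d + 1)) ℝ) hS (hqi i) hx
    (contDiffOn_inner_gradKernel d _ 3) hΔ

/-- The field may be differentiated under the integral sign off the charge. -/
lemma fderiv_field (hS : IsCompact S)
    (hq : IntegrableOn q S (surfaceMeasure (d + 1))) (hx : x ∉ S) (v : Space (d + 1)) :
    fderiv ℝ (fun x => surfaceIntegral S fun y => inner ℝ (q y) (gradKernel d (x - y))) x v =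
      surfaceIntegral S fun y =>
        fderiv ℝ (fun x => (inner ℝ (q y) (gradKernel d (x - y)) : ℝ)) x v := by
  have hqi : ∀ i, IntegrableOn (fun y => q y i) S (surfaceMeasure (d + 1)) := fun i =>
    (EuclideanSpace.proj i : Space (d + 1) →L[ℝ] ℝ).integrable_comp hq
  set H : Fin (d + 1) → Space (d + 1) → ℝ := fun i z =>
    inner ℝ (EuclideanSpace.basisFun (Fin (d + 1)) ℝ i) (gradKernel d z) with hH
  have hHc : ∀ i, ContDiffOn ℝ 2 (H i) {0}ᶜ := fun i => contDiffOn_inner_gradKernel d _ 2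
  have hint : ∀ i, IntegrableOn (fun y => q y i • fderiv ℝ (H i) (x - y)) S
      (surfaceMeasure (d + 1)) := fun i => integrable_potential hS (hqi i) hx
    ((hHc i).continuousOn_fderiv_of_isOpen isOpen_compl_singleton (by norm_num))
  have hev : (fun x => surfaceIntegral S fun y => inner ℝ (q y) (gradKernel d (x - y))) =ᶠ[𝓝 x]
      fun x => ∑ i, potential (surfaceMeasure (d + 1)) S (fun y => q y i) (H i) x := by
    filter_upwards [hS.isClosed.isOpen_compl.mem_nhds hx] with x' hx'
    exact field_eq_sum_potential hS hq hx'
  have hsum := HasFDerivAt.fun_sum (u := Finset.univ) fun i _ =>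
    hasFDerivAt_potential hS (hqi i) hx ((hHc i).of_le (by norm_num))
  rw [hev.fderiv_eq, hsum.fderiv, sum_apply]
  unfold potential surfaceIntegral
  simp only [ContinuousLinearMap.integral_apply (hint _)]
  rw [← integral_finsetSum _ fun i _ => (hint i).apply_continuousLinearMap v]
  refine setIntegral_congr_fun hS.measurableSet fun y hy => ?_
  have hne : x - y ≠ 0 := fun h0 => hx (by rwa [sub_eq_zero.1 h0])
  have hfun : (fun x => (inner ℝ (q y) (gradKernel d (x - y)) : ℝ)) =
      fun x => ∑ i, q y i • H i (x - y) := by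
    funext x
    simp [hH, PiLp.inner_apply, mul_comm]
  have hd : ∀ i, HasFDerivAt (fun x => q y i • H i (x - y)) (q y i • fderiv ℝ (H i) (x - y)) x := by
    intro i
    have h1 : HasFDerivAt (H i) (fderiv ℝ (H i) (x - y)) (x - y) :=
      (((hHc i).contDiffAt (isOpen_compl_singleton.mem_nhds hne)).differentiableAt
        (by norm_num)).hasFDerivAt
    exact (h1.comp x ((hasFDerivAt_id x).sub_const y)).const_smul (q y i)
  simp only [hfun]
  rw [(HasFDerivAt.fun_sum (u := Finset.univ) fun i _ => hd i).fderiv, sum_apply]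

end Field

/-! ### The deficit problem -/

section Deficit

variable {d : ℕ} {S A B : Set (Space (d + 1))} {n m : Space (d + 1) → Space (d + 1)}
  {f : Space (d + 1) → ℝ} {x : Space (d + 1)}

/-- The product of a `C¹` function on the surface and the unit normal is locally Lipschitz. -/
lemma IsC2Interface.exists_lipschitz_smul (hS : IsCompact S) (hI : IsC2Interface S A B n)
    (hf : ContDiffOn ℝ 1 f S) {p₀ : Space (d + 1)} (hp₀ : p₀ ∈ S) :
    ∃ L R, 0 ≤ L ∧ 0 < R ∧ ∀ y ∈ S ∩ Metric.ball p₀ R, ∀ y' ∈ S ∩ Metric.ball p₀ R,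
      |f y - f y'| ≤ L * dist y y' ∧ ‖f y • n y - f y' • n y'‖ ≤ L * dist y y' := by
  obtain ⟨C, r, h⟩ := hI.exists_isLocalInterface hS hp₀
  obtain ⟨L, R, hL, hR, hlip⟩ := h.exists_lipschitz hp₀ hf
  obtain ⟨M, hM⟩ := hS.exists_bound_of_continuousOn hf.continuousOn
  have hM0 : 0 ≤ M := (norm_nonneg _).trans (hM p₀ hp₀)
  have hC := h.C_pos
  refine ⟨L + M * C, min R r, by positivity, lt_min hR h.r_pos, fun y hy y' hy' => ?_⟩
  have hyR : y ∈ S ∩ Metric.ball p₀ R := ⟨hy.1, Metric.ball_subset_ball (min_le_left _ _) hy.2⟩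
  have hyR' : y' ∈ S ∩ Metric.ball p₀ R := ⟨hy'.1, Metric.ball_subset_ball (min_le_left _ _) hy'.2⟩
  have hyr : y ∈ S ∩ Metric.ball p₀ r := ⟨hy.1, Metric.ball_subset_ball (min_le_right _ _) hy.2⟩
  have hyr' : y' ∈ S ∩ Metric.ball p₀ r := ⟨hy'.1, Metric.ball_subset_ball (min_le_right _ _) hy'.2⟩
  have h1 := hlip y hyR y' hyR'
  have h2 := h.normal_lipschitz y hyr y' hyr'
  rw [← dist_eq_norm] at h2
  have h3 : 0 ≤ M * C * dist y y' := by positivity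
  refine ⟨by linarith, ?_⟩
  have hsplit : f y • n y - f y' • n y' = f y' • (n y - n y') + (f y - f y') • n y := by module
  rw [hsplit]
  refine (norm_add_le _ _).trans ?_
  rw [norm_smul, norm_smul, h.norm_normal y hyr, mul_one, Real.norm_eq_abs (f y - f y')]
  have h4 : ‖f y'‖ * ‖n y - n y'‖ ≤ M * (C * dist y y') :=
    mul_le_mul (hM y' hy'.1) h2 (norm_nonneg _) hM0
  linarith

/-- The derivative of the single layer potential in the direction of a fixed vector. -/
lemma fderiv_singleLayer (hd : d = 1 ∨ d = 2) (hS : IsCompact S)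
    (hf : IntegrableOn f S (surfaceMeasure (d + 1))) (hx : x ∉ S) (v : Space (d + 1)) :
    fderiv ℝ (potential (surfaceMeasure (d + 1)) S f (fundSol d)) x v =
      (d : ℝ)⁻¹ * surfaceIntegral S fun y => inner ℝ (f y • v) (gradKernel d (x - y)) := by
  have hH : ContDiffOn ℝ 1 (fundSol d) {0}ᶜ := contDiffOn_fundSol 1
  have hint := integrable_potential hS hf hx
    (hH.continuousOn_fderiv_of_isOpen isOpen_compl_singleton le_rfl)
  rw [(hasFDerivAt_potential hS hf hx hH).fderiv, potential,
    ContinuousLinearMap.integral_apply hint, surfaceIntegral, ← integral_const_mul]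
  congr 1
  funext y
  rw [fderiv_fundSol hd, real_inner_smul_left, real_inner_comm]
  simp
  ring

/-- The double layer potential is the field of a normal density. -/
lemma doubleLayer_eq (hd : d = 1 ∨ d = 2) (S : Set (Space (d + 1)))
    (m : Space (d + 1) → Space (d + 1)) (f : Space (d + 1) → ℝ) (x : Space (d + 1)) :
    surfaceIntegral S (fun y => f y * Phi_m m x y) = surfaceIntegral S fun y =>
      inner ℝ ((-(d : ℝ)⁻¹ * f y) • m y) (gradKernel d (x - y)) := by
  unfold surfaceIntegral
  congr 1
  funext y
  dsimp only
  rw [Phi_m_eq hd, real_inner_smul_left]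
  ring

end Deficit

/-- The theorem with `ν = d + 1`, in which form the surface dimension `d` enters all estimates. -/
theorem solvesDeficitProblem {d : ℕ} (hd : d = 1 ∨ d = 2)
    {Ω Ωp Ωm Γ : Set (Space (d + 1))} {n m : Space (d + 1) → Space (d + 1)}
    (hgeom : IsSplitDomain Ω Ωp Ωm Γ n m) {βp βm : ℝ} (hβp : 0 < βp) (hβm : 0 < βm)
    {b gD v vn : Space (d + 1) → ℝ}
    (hv : ∀ x ∈ Γ, HasSideNormalDeriv v Ωp n x (vn x) ∧ HasSideNormalDeriv v Ωm n x (vn x))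
    {ρ μ : Space (d + 1) → ℝ} (hρ : ContDiffOn ℝ 1 ρ Γ) (hμ : ContDiffOn ℝ 1 μ (frontier Ω))
    (hsys : SolvesIntegralSystem Ω Γ n m βp βm b vn gD v ρ μ) :
    SolvesDeficitProblem Ω Ωp Ωm Γ n βp βm b gD v (layerPotential Ω Γ m ρ μ) := by
  set σ := surfaceMeasure (d + 1) with hσ
  have hπ := Real.pi_pos
  have hd0 : (d : ℝ) ≠ 0 := by rcases hd with rfl | rfl <;> norm_num
  have hd1 : (1 : ℝ) ≤ d := by rcases hd with rfl | rfl <;> norm_num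
  have hΓ := hgeom.isCompact_interface
  have hF : IsCompact (frontier Ω) := Metric.isCompact_of_isClosed_isBounded isClosed_frontier
    (hgeom.isBounded.closure.subset frontier_subset_closure)
  have hΓΩ : Γ ⊆ Ω := fun x hx => hgeom.union_eq ▸ Or.inl (Or.inr hx)
  have hpΩ : Ωp ⊆ Ω := fun x hx => hgeom.union_eq ▸ Or.inl (Or.inl hx)
  have hmΩ : Ωm ⊆ Ω := fun x hx => hgeom.union_eq ▸ Or.inr hx
  have hΩF : ∀ x ∈ Ω, x ∉ frontier Ω := fun x hx hxF => by
    rw [hgeom.isOpen.frontier_eq] at hxF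
    exact hxF.2 hx
  have hpΓ : ∀ x ∈ Ωp, x ∉ Γ := fun x hx hxΓ =>
    Set.disjoint_left.1 hgeom.disjoint_plus_interface hx hxΓ
  have hmΓ : ∀ x ∈ Ωm, x ∉ Γ := fun x hx hxΓ =>
    Set.disjoint_left.1 hgeom.disjoint_minus_interface hx hxΓ
  have hIΓ := hgeom.interface
  have hIF := hgeom.boundary
  obtain ⟨Mρ, hMρ⟩ := hΓ.exists_bound_of_continuousOn hρ.continuousOn
  have hfinΓ : IsFiniteMeasure (σ.restrict Γ) :=
    ⟨by rw [Measure.restrict_apply_univ]; exact hIΓ.surfaceMeasure_lt_top hΓ⟩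
  have hfinF : IsFiniteMeasure (σ.restrict (frontier Ω)) :=
    ⟨by rw [Measure.restrict_apply_univ]; exact hIF.surfaceMeasure_lt_top hF⟩
  have hρm : AEStronglyMeasurable ρ (σ.restrict Γ) :=
    hρ.continuousOn.aestronglyMeasurable_of_isCompact hΓ hΓ.measurableSet
  have hρi : IntegrableOn ρ Γ σ :=
    Integrable.of_bound hρm Mρ
      ((ae_restrict_mem hΓ.measurableSet).mono fun y hy => hMρ y hy)
  set q : Space (d + 1) → Space (d + 1) := fun y => (-(d : ℝ)⁻¹ * μ y) • m y with hq
  have hqc : ContinuousOn q (frontier Ω) :=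
    (continuousOn_const.mul hμ.continuousOn).smul (hIF.continuousOn_normal hF)
  have hqm : AEStronglyMeasurable q (σ.restrict (frontier Ω)) :=
    hqc.aestronglyMeasurable_of_isCompact hF hF.measurableSet
  obtain ⟨Mq, hMq⟩ := hF.exists_bound_of_continuousOn hqc
  have hqi : IntegrableOn q (frontier Ω) σ :=
    Integrable.of_bound hqm Mq
      ((ae_restrict_mem hF.measurableSet).mono fun y hy => hMq y hy)
  -- up to the factor `1 / (2π)`, `W₁` is the single layer and `W₂` the double layer potential,
  -- written as the field of the normal density `q`
  set W₁ : Space (d + 1) → ℝ := potential σ Γ ρ (fundSol d) with hW₁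
  set W₂ : Space (d + 1) → ℝ := fun x => surfaceIntegral (frontier Ω) fun y =>
    inner ℝ (q y) (gradKernel d (x - y)) with hW₂
  have hW₁eq : ∀ x, surfaceIntegral Γ (fun y => ρ y * Phi x y) = W₁ x := fun x => by
    simp only [Phi_eq_fundSol]; rfl
  have hW₂eq : ∀ x, surfaceIntegral (frontier Ω) (fun y => μ y * Phi_m m x y) = W₂ x := fun x =>
    doubleLayer_eq hd _ m μ x
  have hw : layerPotential Ω Γ m ρ μ =
      (1 / (2 * Real.pi)) • W₁ + (1 / (2 * Real.pi)) • W₂ := by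
    funext x
    rw [layerPotential, hW₁eq, hW₂eq]
    rfl
  have hW₁h : ∀ x, x ∉ Γ → HarmonicAt W₁ x := fun x hx =>
    harmonicAt_potential (EuclideanSpace.basisFun (Fin (d + 1)) ℝ) hΓ hρi hx (contDiffOn_fundSol 3)
      fun z hz => laplacian_fundSol hd _ hz
  have hW₂h : ∀ x, x ∉ frontier Ω → HarmonicAt W₂ x := fun x hx => harmonicAt_field hF hqi hx
  have hwh : ∀ x, x ∉ Γ → x ∉ frontier Ω → HarmonicAt (layerPotential Ω Γ m ρ μ) x :=
    fun x h1 h2 => hw ▸ ((hW₁h x h1).const_smul).add ((hW₂h x h2).const_smul)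
  have hW₁d : ∀ x, x ∉ Γ → DifferentiableAt ℝ W₁ x := fun x hx =>
    (hW₁h x hx).1.differentiableAt (by norm_num)
  have hW₂d : ∀ x, x ∉ frontier Ω → DifferentiableAt ℝ W₂ x := fun x hx =>
    (hW₂h x hx).1.differentiableAt (by norm_num)
  have hW₁c : ∀ x ∈ Γ, ContinuousAt W₁ x := fun x hx =>
    continuousAt_potential hΓ hIΓ hx hρm hMρ (contDiffOn_fundSol 1) measurable_fundSol
      (c := 2) (α := (d : ℝ) - 1 / 2) (by norm_num) (by linarith) (by linarith)
      fun z hz hz1 => abs_fundSol_le hd hz hz1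
  refine ⟨fun x hx => ?_, fun x hx => ?_, fun x hx => ?_, fun x hx => ?_⟩
  · rcases hx with hx | hx
    · exact hwh x (hpΓ x hx) (hΩF x (hpΩ hx))
    · exact hwh x (hmΓ x hx) (hΩF x (hmΩ hx))
  · have hc : ContinuousAt (layerPotential Ω Γ m ρ μ) x := by
      rw [hw]
      exact ((hW₁c x hx).const_smul _).add
        ((hW₂d x (hΩF x (hΓΩ hx))).continuousAt.const_smul _)
    exact ⟨hc.tendsto.mono_left nhdsWithin_le_nhds, hc.tendsto.mono_left nhdsWithin_le_nhds⟩
  · -- The direction `n x` is fixed, so the derivative of the single layer in this direction is the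
    -- field of `y ↦ ρ y • n x`, which is normal at `x`; the double layer is smooth near `x`.
    obtain ⟨L, R, hL, hR, hlip⟩ := hIΓ.exists_lipschitz_smul hΓ hρ hx
    have hn1 := hIΓ.norm_normal hΓ x hx
    have hjump := tendsto_field (q := fun y => ρ y • n x) (a := ρ x) (M := Mρ) (L := L) hd hΓ hIΓ hx
      (hρm.smul_const _) (fun y hy => by rw [norm_smul, hn1, mul_one]; exact hMρ y hy) hR hL
      (fun y hy y' hy' => by
        rw [← sub_smul, norm_smul, hn1, mul_one]; exact (hlip y hy y' hy').1) rfl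
    set I := surfaceIntegral Γ (fun y => ρ y * Phi_n n x y) with hI
    set J := surfaceIntegral (frontier Ω) (fun y => μ y * Phi_nm n m x y) with hJ
    have hIeq : surfaceIntegral Γ (fun y => inner ℝ (ρ y • n x) (gradKernel d (x - y))) =
        d * I := by
      rw [hI]
      unfold surfaceIntegral
      rw [← integral_const_mul]
      congr 1
      funext y
      dsimp only
      rw [Phi_n_eq hd, real_inner_smul_left]
      field_simp
    have hxF : x ∉ frontier Ω := hΩF x (hΓΩ hx)
    have hJeq : fderiv ℝ W₂ x (n x) = J := by
      rw [hW₂, fderiv_field hF hqi hxF, hJ]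
      unfold surfaceIntegral
      congr 1
      funext y
      dsimp only
      have h2 : (fun z => (inner ℝ (q y) (gradKernel d (z - y)) : ℝ)) =
          fun z => μ y * Phi_m m z y := by
        funext z
        rw [Phi_m_eq hd, hq, real_inner_smul_left]
        ring
      have h3 : (fun z => μ y * Phi_m m z y) = μ y • fun z => Phi_m m z y := rfl
      rw [h2, h3, fderiv_const_smul_field]
      rfl
    have hW₂lim : Tendsto (fun y => fderiv ℝ W₂ y (n x)) (𝓝 x) (𝓝 J) := by
      have h1 : ContinuousAt (fderiv ℝ W₂) x :=
        ((hW₂h x hxF).1.fderiv_right (m := 1) (by norm_num)).continuousAt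
      rw [← hJeq]
      exact (h1.clm_apply continuousAt_const).tendsto
    have hside : ∀ D : Set (Space (d + 1)), (∀ y ∈ D, y ∉ Γ ∧ y ∉ frontier Ω) → ∀ s : ℝ,
        Tendsto (fun y => surfaceIntegral Γ fun y' => inner ℝ (ρ y' • n x) (gradKernel d (y - y')))
          (𝓝[D] x) (𝓝 (d * I + d * s)) →
        HasSideNormalDeriv (layerPotential Ω Γ m ρ μ) D n x (1 / (2 * Real.pi) * (I + s + J)) := by
      intro D hD s hs
      refine ⟨eventually_nhdsWithin_of_forall fun y hy =>
        (hwh y (hD y hy).1 (hD y hy).2).1.differentiableAt (by norm_num), ?_⟩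
      have h1 := ((hs.const_mul (d : ℝ)⁻¹).add (hW₂lim.mono_left nhdsWithin_le_nhds)).const_mul
        (1 / (2 * Real.pi))
      have h2 : (d : ℝ)⁻¹ * (d * I + d * s) + J = I + s + J := by field_simp
      rw [h2] at h1
      refine h1.congr' (eventually_nhdsWithin_of_forall fun y hy => ?_)
      have hyd₁ := hW₁d y (hD y hy).1
      have hyd₂ := hW₂d y (hD y hy).2
      beta_reduce
      rw [hw, fderiv_add (hyd₁.const_smul _) (hyd₂.const_smul _), fderiv_const_smul hyd₁,
        fderiv_const_smul hyd₂]
      simp only [add_apply, smul_apply, smul_eq_mul]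
      rw [hW₁, fderiv_singleLayer hd hΓ hρi (hD y hy).1]
      ring
    have hp := hside Ωp (fun y hy => ⟨hpΓ y hy, hΩF y (hpΩ hy)⟩) (Real.pi * ρ x) (by
      have := hjump.1
      rwa [hIeq, mul_assoc] at this)
    have hm := hside Ωm (fun y hy => ⟨hmΓ y hy, hΩF y (hmΩ hy)⟩) (-(Real.pi * ρ x)) (by
      have := hjump.2
      rwa [hIeq, mul_assoc, sub_eq_add_neg, ← mul_neg] at this)
    refine ⟨_, _, _, _, hp, hm, (hv x hx).1, (hv x hx).2, ?_⟩
    have hsysx := hsys.on_interface x hx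
    rw [← hI, ← hJ] at hsysx
    have hmean : 0 < βp + βm := by linarith
    unfold lam mean at hsysx
    field_simp at hsysx ⊢
    linarith
  · -- `q x` is `-d⁻¹ μ x` times the outer normal and `x` is approached from inside, so the double
    -- layer gains `π μ x`; the single layer is continuous near the boundary.
    have hxΓ : x ∉ Γ := fun hxΓ => hΩF x (hΓΩ hxΓ) hx
    obtain ⟨L, R, hL, hR, hlip⟩ := hIF.exists_lipschitz_smul hF
      (contDiffOn_const.mul hμ : ContDiffOn ℝ 1 (fun y => -(d : ℝ)⁻¹ * μ y) (frontier Ω)) hx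
    have hjump := (tendsto_field (q := q) (a := -(d : ℝ)⁻¹ * μ x) hd hF hIF hx hqm hMq hR hL
      (fun y hy y' hy' => (hlip y hy y' hy').2) rfl).2
    have hlim := (((hW₁d x hxΓ).continuousAt.tendsto.mono_left
      (nhdsWithin_le_nhds (s := Ω))).const_mul (1 / (2 * Real.pi))).add
      (hjump.const_mul (1 / (2 * Real.pi)))
    have hsysx := hsys.on_boundary x hx
    rw [hW₁eq, hW₂eq] at hsysx
    have hval : 1 / (2 * Real.pi) * W₁ x + 1 / (2 * Real.pi) *
        (W₂ x - d * Real.pi * (-(d : ℝ)⁻¹ * μ x)) = gD x - v x := by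
      have h1 : (d : ℝ) * Real.pi * (-(d : ℝ)⁻¹ * μ x) = -(Real.pi * μ x) := by field_simp
      rw [h1]
      field_simp at hsysx ⊢
      linarith
    unfold HasSideValue
    rw [hw, ← hval]
    exact hlim

end InterfaceProblem
end

theorem theorem1 {ν : ℕ} (hν : ν = 2 ∨ ν = 3)
    (Ω Ωp Ωm Γ : Set (InterfaceProblem.Space ν))
    (n m : InterfaceProblem.Space ν → InterfaceProblem.Space ν)
    (hgeom : InterfaceProblem.IsSplitDomain Ω Ωp Ωm Γ n m)
    (βp βm : ℝ) (hβp : 0 < βp) (hβm : 0 < βm)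
    (b gD v vn : InterfaceProblem.Space ν → ℝ)
    (hv : ∀ x ∈ Γ, InterfaceProblem.HasSideNormalDeriv v Ωp n x (vn x) ∧
      InterfaceProblem.HasSideNormalDeriv v Ωm n x (vn x))
    (ρ μ : InterfaceProblem.Space ν → ℝ)
    (hρ : ContDiffOn ℝ 1 ρ Γ) (hμ : ContDiffOn ℝ 1 μ (frontier Ω))
    (hsys : InterfaceProblem.SolvesIntegralSystem Ω Γ n m βp βm b vn gD v ρ μ) :
    InterfaceProblem.SolvesDeficitProblem Ω Ωp Ωm Γ n βp βm b gD v
      (InterfaceProblem.layerPotential Ω Γ m ρ μ) := by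
  obtain ⟨d, rfl⟩ : ∃ d, ν = d + 1 := ⟨ν - 1, by omega⟩
  exact InterfaceProblem.solvesDeficitProblem (by omega) hgeom hβp hβm hv hρ hμ hsys
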